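/- Let $d\ge 0$ be an integer, let $\mathbb{B}^d$ be the open unit ball of $\mathbb{C}^d$, and let $d\tau(z)=(1-|z|^2)^{-(d+1)}\,dz$ be the hyperbolic volume measure on $\mathbb{B}^d$, where $dz$ is $2d$-dimensional Lebesgue measure. For $\lambda>0$ put $$c_\lambda=\frac{\Gamma(\lambda)}{\pi^d\,\Gamma(\lambda-d)},$$ interpreted as $0$ when $\lambda$ is an integer with $\lambda\le d$, and, for $\lambda>d$, $d\mu_\lambda(z)=c_\lambda(1-|z|^2)^\lambda\,d\tau(z)$. Let $N=\sum_{j=1}^d z_j\,\partial/\partial z_j$. For $\lambda>0$ choose any integer $n\ge 0$ with $\lambda+2n>d$, and let $$H(\mathbb{B}^d,\lambda)=\{f \text{ holomorphic on } \mathbb{B}^d : N^kf\in L^2(\mathbb{B}^d,\mu_{\lambda+2n}),\ 0\le k\le n\},\qquad \langle f,g\rangle_\lambda=\langle Af,Bg\rangle_{L^2(\mathbb{B}^d,\mu_{\lambda+2n})},$$ where $$A=\Big(I+\tfrac{N}{\lambda+n}\Big)\cdots\Big(I+\tfrac{N}{\lambda+2n-1}\Big),\qquad B=\Big(I+\tfrac{N}{\lambda}\Big)\cdots\Big(I+\tfrac{N}{\lambda+n-1}\Big)$$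 (inner products are conjugate-linear in the first variable). **Theorem.** Fix $\lambda>d/2$. For $\phi\in L^2(\mathbb{B}^d,\tau)$ put $$A_\lambda\phi(z)=c_\lambda^2\int_{\mathbb{B}^d}\left[\frac{(1-|z|^2)(1-|w|^2)}{(1-w\cdot\bar z)(1-\bar w\cdot z)}\right]^\lambda\phi(w)\,d\tau(w).$$ Then for each $\phi\in L^2(\mathbb{B}^d,\tau)$ there is a unique Hilbert--Schmidt operator $T_\phi$ on $H(\mathbb{B}^d,\lambda)$ such that $$\langle f,T_\phi g\rangle_\lambda=c_\lambda\int_{\mathbb{B}^d}\overline{f(z)}\,\phi(z)\,g(z)\,(1-|z|^2)^\lambda\,d\tau(z)$$ for all bounded holomorphic functions $f$ and $g$ in $H(\mathbb{B}^d,\lambda)$, the integrals being absolutely convergent. Moreover $A_\lambda\phi\in L^2(\mathbb{B}^d,\tau)$, and the Hilbert--Schmidt norm of $T_\phi$ is given by $$\|T_\phi\|_{HS}^2=\langle\phi,A_\lambda\phi\rangle_{L^2(\mathbb{B}^d,\tau)}.$$ -/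

import Mathlib

open MeasureTheory Set
open scoped ENNReal InnerProductSpace ComplexConjugate

noncomputable section

namespace BergmanBall

/-- `ℂ^d` with its Euclidean norm; its `volume` is `2d`-dimensional Lebesgue measure, and
`inner ℂ z w = ∑ j, conj (z j) * w j`. -/
abbrev Cd (d : ℕ) : Type := EuclideanSpace ℂ (Fin d)

/-- The open unit ball of `ℂ^d`. -/
def unitBall (d : ℕ) : Set (Cd d) := Metric.ball 0 1

/-- The hyperbolic volume measure `dτ(z) = (1 - |z|²)^{-(d+1)} dz` on the unit ball (as a measure
on `ℂ^d` carried by the ball). -/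
def tau (d : ℕ) : Measure (Cd d) :=
  (volume.restrict (unitBall d)).withDensity
    fun z => ENNReal.ofReal ((1 - ‖z‖ ^ 2) ^ (-((d : ℝ) + 1)))

/-- `c_lam = Γ(lam) / (π^d Γ(lam - d))`. As `Real.Gamma` is `0` at `0, -1, -2, …` and `x / 0 = 0`,
this is `0` when `lam - d` is one of `0, -1, -2, …`, which is the usual convention `1/Γ = 0`. -/
def cConst (d : ℕ) (lam : ℝ) : ℝ :=
  Real.Gamma lam / (Real.pi ^ d * Real.Gamma (lam - d))

/-- `dμ_s(z) = c_s (1 - |z|²)^s dτ(z)`, used only for `s > d`, when `c_s > 0`. -/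
def mu (d : ℕ) (s : ℝ) : Measure (Cd d) :=
  (tau d).withDensity fun z => ENNReal.ofReal (cConst d s * (1 - ‖z‖ ^ 2) ^ s)

/-- The space of holomorphic (that is, complex analytic) functions on the unit ball. A function on
the ball is represented by its extension by `0` to `ℂ^d`. -/
def Hol (d : ℕ) : Submodule ℂ (Cd d → ℂ) where
  carrier := {f | AnalyticOnNhd ℂ f (unitBall d) ∧ ∀ z ∉ unitBall d, f z = 0}
  add_mem' := by
    rintro f g ⟨hf, hf'⟩ ⟨hg, hg'⟩
    exact ⟨hf.add hg, fun z hz => by simp [hf' z hz, hg' z hz]⟩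
  zero_mem' := ⟨analyticOnNhd_const, fun _ _ => rfl⟩
  smul_mem' := by
    rintro c f ⟨hf, hf'⟩
    exact ⟨fun z hz => (hf z hz).const_smul, fun z hz => by simp [hf' z hz]⟩

theorem isOpen_unitBall (d : ℕ) : IsOpen (unitBall d) := Metric.isOpen_ball

/-- The expression `∑ j, z_j ∂f/∂z_j` on the ball. -/
def numberFun (d : ℕ) (f : Cd d → ℂ) : Cd d → ℂ :=
  (unitBall d).indicator fun z => ∑ j, z j * fderiv ℂ f z (EuclideanSpace.single j 1)

theorem numberFun_apply {d : ℕ} (f : Cd d → ℂ) {z : Cd d} (hz : z ∈ unitBall d) :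
    numberFun d f z = fderiv ℂ f z z := by
  have h : z = ∑ j, z j • EuclideanSpace.single j (1 : ℂ) := by
    ext i
    simp [Finset.sum_apply, Pi.single_apply]
  conv_rhs => rw [h]
  rw [numberFun, indicator_of_mem hz, map_sum]
  conv_rhs => rw [← h]
  simp

theorem numberFun_mem {d : ℕ} {f : Cd d → ℂ} (hf : f ∈ Hol d) : numberFun d f ∈ Hol d := by
  refine ⟨?_, fun z hz => indicator_of_notMem hz _⟩
  have h : AnalyticOnNhd ℂ (fun z => fderiv ℂ f z z) (unitBall d) := fun z hz =>
    ((ContinuousLinearMap.id ℂ (Cd d →L[ℂ] ℂ)).analyticAt_bilinear (fderiv ℂ f z, z)).comp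
      (f := fun y => (fderiv ℂ f y, y)) ((hf.1.fderiv z hz).prod analyticAt_id)
  exact h.congr (isOpen_unitBall d) fun z hz => (numberFun_apply f hz).symm

/-- The number operator `N = ∑ j, z_j ∂/∂z_j` on holomorphic functions. -/
def numberOp (d : ℕ) : Hol d →ₗ[ℂ] Hol d where
  toFun f := ⟨numberFun d f, numberFun_mem f.2⟩
  map_add' f g := by
    ext z
    by_cases hz : z ∈ unitBall d
    · have h1 := (f.2.1 z hz).differentiableAt
      have h2 := (g.2.1 z hz).differentiableAt
      simp [numberFun_apply _ hz, fderiv_add h1 h2]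
    · simp [numberFun, hz]
  map_smul' c f := by
    ext z
    by_cases hz : z ∈ unitBall d
    · have h1 := (f.2.1 z hz).differentiableAt
      simp [numberFun_apply _ hz, fderiv_const_smul h1]
    · simp [numberFun, hz]

/-- `(I + N/a) (I + N/(a+1)) ⋯ (I + N/(a+n-1))`. -/
def shiftProd (d : ℕ) (a : ℝ) (n : ℕ) : Hol d →ₗ[ℂ] Hol d :=
  ((List.range n).map fun j : ℕ => (1 + ((a + j : ℝ) : ℂ)⁻¹ • numberOp d : Module.End ℂ (Hol d))).prod

/-- The underlying vector space of `H(𝔹^d, lam)`: the holomorphic `f` with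
`N^k f ∈ L²(μ_{lam+2n})` for `0 ≤ k ≤ n`. -/
def sobolevSubmodule (d : ℕ) (lam : ℝ) (n : ℕ) : Submodule ℂ (Hol d) where
  carrier := {f | ∀ k ≤ n, MemLp ((numberOp d ^ k) f : Cd d → ℂ) 2 (mu d (lam + 2 * n))}
  add_mem' := by
    intro f g hf hg k hk
    simpa using (hf k hk).add (hg k hk)
  zero_mem' := by
    intro k _
    simp
  smul_mem' := by
    intro c f hf k hk
    simpa using (hf k hk).const_smul c

/-- The Hermitian form `⟨f, g⟩_lam = ⟨A f, B g⟩_{L²(μ_{lam+2n})}` (conjugate linear in `f`), with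
`A = (I + N/(lam+n)) ⋯ (I + N/(lam+2n-1))` and `B = (I + N/lam) ⋯ (I + N/(lam+n-1))`. -/
def sobolevForm (d : ℕ) (lam : ℝ) (n : ℕ) (f g : Hol d) : ℂ :=
  ∫ z, conj ((shiftProd d (lam + n) n f : Cd d → ℂ) z) * (shiftProd d lam n g : Cd d → ℂ) z
    ∂(mu d (lam + 2 * n))

/-! Next: the form `sobolevForm` is positive definite on `sobolevSubmodule` (Parseval on circles
`θ ↦ e^{iθ} z` and rotation invariance of the measure), so that it defines an inner product. -/

/-- The point `e^{iθ}` of the unit circle. -/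
def cis (θ : ℝ) : ℂ := Complex.exp (θ * Complex.I)

theorem norm_cis (θ : ℝ) : ‖cis θ‖ = 1 := Complex.norm_exp_ofReal_mul_I θ

theorem continuous_cis : Continuous cis := by unfold cis; fun_prop

/-- Lebesgue measure on `(0, 2π]`. -/
def arc : Measure ℝ := volume.restrict (Ioc 0 (2 * Real.pi))

instance : IsFiniteMeasure arc := by unfold arc; infer_instance

theorem integral_cis (m k : ℕ) :
    ∫ θ, conj (cis θ ^ m) * cis θ ^ k ∂arc = if m = k then ((2 * Real.pi : ℝ) : ℂ) else 0 := by
  have h (θ : ℝ) : conj (cis θ ^ m) * cis θ ^ k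
      = Complex.exp ((((k : ℂ) - m) * Complex.I) * θ) := by
    simp only [cis, ← Complex.exp_conj, ← Complex.exp_nat_mul, ← Complex.exp_add]
    congr 1
    simp
    ring
  simp only [h, arc]
  rw [← intervalIntegral.integral_of_le (by positivity)]
  split_ifs with hmk
  · simp [hmk]
  · have hne : ((k : ℂ) - m) * Complex.I ≠ 0 := by
      refine mul_ne_zero (sub_ne_zero.2 ?_) Complex.I_ne_zero
      exact_mod_cast Ne.symm hmk
    rw [integral_exp_mul_complex hne]
    have : Complex.exp (((k : ℂ) - m) * Complex.I * ((2 * Real.pi : ℝ) : ℂ)) = 1 := by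
      rw [Complex.exp_eq_one_iff]
      exact ⟨(k : ℤ) - m, by push_cast; ring⟩
    rw [this]
    simp

/-- Parseval's identity for absolutely convergent power series on the unit circle. -/
theorem parseval {F G : ℝ → ℂ} {a b : ℕ → ℂ}
    (ha : ∀ θ, HasSum (fun m => a m * cis θ ^ m) (F θ))
    (hb : ∀ θ, HasSum (fun m => b m * cis θ ^ m) (G θ)) :
    HasSum (fun m => ((2 * Real.pi : ℝ) : ℂ) * (conj (a m) * b m))
      (∫ θ, conj (F θ) * G θ ∂arc) := by
  have sa : Summable fun m => ‖a m‖ := by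
    simpa [norm_cis] using (ha 0).summable.norm
  have sb : Summable fun m => ‖b m‖ := by
    simpa [norm_cis] using (hb 0).summable.norm
  have sab : Summable fun p : ℕ × ℕ => ‖a p.1‖ * ‖b p.2‖ :=
    sa.mul_of_nonneg sb (fun _ => norm_nonneg _) fun _ => norm_nonneg _
  let T : ℕ × ℕ → ℝ → ℂ := fun p θ => conj (a p.1 * cis θ ^ p.1) * (b p.2 * cis θ ^ p.2)
  have hT (p : ℕ × ℕ) (θ : ℝ) : ‖T p θ‖ = ‖a p.1‖ * ‖b p.2‖ := by
    simp [T, norm_cis]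
  have hcont (p : ℕ × ℕ) : Continuous (T p) := by
    have := continuous_cis
    simp only [T]
    fun_prop
  have hInt (p : ℕ × ℕ) : Integrable (T p) arc :=
    Integrable.of_bound (hcont p).aestronglyMeasurable _ (ae_of_all _ fun θ => (hT p θ).le)
  have hsum (θ : ℝ) : HasSum (fun p => T p θ) (conj (F θ) * G θ) := by
    have h1 : HasSum (fun m => conj (a m * cis θ ^ m)) (conj (F θ)) :=
      (ha θ).map (starRingEnd ℂ) Complex.continuous_conj
    have h2 : Summable (fun p : ℕ × ℕ => conj (a p.1 * cis θ ^ p.1) * (b p.2 * cis θ ^ p.2)) :=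
      Summable.of_norm (f := fun p => T p θ) (by simp only [hT]; exact sab)
    have h3 := HasSum.mul (f := fun m => conj (a m * cis θ ^ m)) (g := fun m => b m * cis θ ^ m)
      h1 (hb θ) h2
    exact h3
  have key := hasSum_integral_of_summable_integral_norm (F := T) hInt (by
    simp only [hT, integral_const, smul_eq_mul]
    exact sab.mul_left _)
  simp only [fun θ => (hsum θ).tsum_eq] at key
  have hval (p : ℕ × ℕ) : ∫ θ, T p θ ∂arc
      = if p.1 = p.2 then ((2 * Real.pi : ℝ) : ℂ) * (conj (a p.1) * b p.2) else 0 := by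
    have : T p = fun θ => (conj (a p.1) * b p.2) * (conj (cis θ ^ p.1) * cis θ ^ p.2) := by
      funext θ
      simp only [T, map_mul]
      ring
    rw [this, integral_const_mul, integral_cis]
    split_ifs <;> ring
  simp only [hval] at key
  have hinj : Function.Injective fun m : ℕ => (m, m) := fun _ _ h => (Prod.mk.inj h).1
  rw [← hinj.hasSum_iff] at key
  · simpa [Function.comp_def] using key
  · rintro ⟨m, k⟩ hmk
    rw [if_neg]
    exact fun h => hmk ⟨m, congrArg (Prod.mk m) h⟩

/-- The `m`-th Taylor coefficient at `0` of `ζ ↦ f (ζ z)`. -/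
def sliceCoeff {d : ℕ} (f : Hol d) (z : Cd d) (m : ℕ) : ℂ :=
  (m.factorial : ℂ)⁻¹ * iteratedDeriv m (fun ζ : ℂ => (f : Cd d → ℂ) (ζ • z)) 0

theorem exists_radius {d : ℕ} {z : Cd d} (hz : z ∈ unitBall d) :
    ∃ r : ℝ, 1 < r ∧ ∀ ζ ∈ Metric.ball (0 : ℂ) r, ζ • z ∈ unitBall d := by
  have hz1 : ‖z‖ < 1 := by simpa [unitBall] using hz
  obtain ⟨s, hs, hs1⟩ := exists_between hz1
  have hs0 : 0 < s := (norm_nonneg z).trans_lt hs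
  refine ⟨s⁻¹, (one_lt_inv₀ hs0).2 hs1, fun ζ hζ => ?_⟩
  have hζ' : ‖ζ‖ < s⁻¹ := by simpa using hζ
  have : ‖ζ‖ * ‖z‖ < 1 := by
    calc ‖ζ‖ * ‖z‖ ≤ ‖ζ‖ * s := by gcongr
      _ < s⁻¹ * s := by gcongr
      _ = 1 := inv_mul_cancel₀ hs0.ne'
  simpa [unitBall, norm_smul] using this

theorem slice_hasDerivAt {d : ℕ} (f : Hol d) {z : Cd d} {ζ : ℂ} (h : ζ • z ∈ unitBall d) :
    HasDerivAt (fun ζ : ℂ => (f : Cd d → ℂ) (ζ • z))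
      (fderiv ℂ (f : Cd d → ℂ) (ζ • z) z) ζ := by
  have h1 := (f.2.1 _ h).differentiableAt.hasFDerivAt
  have h2 : HasDerivAt (fun ζ : ℂ => ζ • z) z ζ := by
    simpa using (hasDerivAt_id ζ).smul_const z
  exact h1.comp_hasDerivAt ζ h2

theorem slice_differentiableOn {d : ℕ} (f : Hol d) {z : Cd d} {r : ℝ}
    (hr : ∀ ζ ∈ Metric.ball (0 : ℂ) r, ζ • z ∈ unitBall d) :
    DifferentiableOn ℂ (fun ζ : ℂ => (f : Cd d → ℂ) (ζ • z)) (Metric.ball 0 r) :=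
  fun ζ hζ => (slice_hasDerivAt f (hr ζ hζ)).differentiableAt.differentiableWithinAt

theorem hasSum_slice {d : ℕ} (f : Hol d) {z : Cd d} (hz : z ∈ unitBall d) (θ : ℝ) :
    HasSum (fun m => sliceCoeff f z m * cis θ ^ m) ((f : Cd d → ℂ) (cis θ • z)) := by
  obtain ⟨r, hr1, hr⟩ := exists_radius hz
  have h := Complex.hasSum_taylorSeries_on_ball (slice_differentiableOn f hr)
    (z := cis θ) (by simpa [norm_cis] using hr1)
  have e : (fun m => sliceCoeff f z m * cis θ ^ m) = fun m : ℕ => (m.factorial : ℂ)⁻¹ •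
      (cis θ - 0) ^ m • iteratedDeriv m (fun ζ : ℂ => (f : Cd d → ℂ) (ζ • z)) 0 := by
    funext m
    simp only [sliceCoeff, sub_zero, smul_eq_mul]
    ring
  rw [e]
  exact h

theorem sliceCoeff_add {d : ℕ} (f g : Hol d) {z : Cd d} (hz : z ∈ unitBall d) (m : ℕ) :
    sliceCoeff (f + g) z m = sliceCoeff f z m + sliceCoeff g z m := by
  obtain ⟨r, hr1, hr⟩ := exists_radius hz
  have h0 : (0 : ℂ) ∈ Metric.ball (0 : ℂ) r := Metric.mem_ball_self (by linarith)
  have hn := Metric.isOpen_ball.mem_nhds h0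
  have hf := ((slice_differentiableOn f hr).analyticAt hn).contDiffAt (n := m)
  have hg := ((slice_differentiableOn g hr).analyticAt hn).contDiffAt (n := m)
  change _ * iteratedDeriv m (fun ζ : ℂ => (f : Cd d → ℂ) (ζ • z) + (g : Cd d → ℂ) (ζ • z)) 0 = _
  rw [sliceCoeff, sliceCoeff, iteratedDeriv_fun_add hf hg, mul_add]

theorem sliceCoeff_smul {d : ℕ} (c : ℂ) (f : Hol d) (z : Cd d) (m : ℕ) :
    sliceCoeff (c • f) z m = c * sliceCoeff f z m := by
  change _ * iteratedDeriv m (fun ζ : ℂ => c * (f : Cd d → ℂ) (ζ • z)) 0 = _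
  rw [iteratedDeriv_const_mul_field, sliceCoeff]
  ring

theorem sliceCoeff_numberOp {d : ℕ} (f : Hol d) {z : Cd d} (hz : z ∈ unitBall d) (m : ℕ) :
    sliceCoeff (numberOp d f) z m = m * sliceCoeff f z m := by
  obtain ⟨r, hr1, hr⟩ := exists_radius hz
  have h0 : (0 : ℂ) ∈ Metric.ball (0 : ℂ) r := Metric.mem_ball_self (by linarith)
  have hn := Metric.isOpen_ball.mem_nhds h0
  set h : ℂ → ℂ := fun ζ => (f : Cd d → ℂ) (ζ • z) with hh
  have hf : AnalyticAt ℂ h 0 := (slice_differentiableOn f hr).analyticAt hn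
  have heq : (fun ζ : ℂ => (numberOp d f : Cd d → ℂ) (ζ • z)) =ᶠ[nhds 0]
      fun ζ => ζ * deriv h ζ := by
    filter_upwards [hn] with ζ hζ
    change numberFun d f (ζ • z) = _
    rw [numberFun_apply _ (hr ζ hζ), (slice_hasDerivAt f (hr ζ hζ)).deriv, map_smul, smul_eq_mul]
  simp only [sliceCoeff]
  rw [heq.iteratedDeriv_eq m, iteratedDeriv_fun_mul (f := fun x : ℂ => x) contDiffAt_id hf.deriv.contDiffAt]
  cases m with
  | zero => simp
  | succ m =>
    rw [Finset.sum_eq_single 1]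
    · have : iteratedDeriv 1 (fun x : ℂ => x) 0 = 1 := by simp
      rw [this, iteratedDeriv_succ' (n := m) (f := h)]
      simp
      ring
    · intro i _ hi
      rcases i with _ | _ | i
      · simp
      · simp at hi
      · simp [iteratedDeriv_succ']
    · simp

/-- The eigenvalue `(1 + m/a) ⋯ (1 + m/(a+n-1))` of `shiftProd d a n` in degree `m`. -/
def shiftEigen (a : ℝ) (n m : ℕ) : ℝ :=
  ((List.range n).map fun j : ℕ => (1 + (a + j : ℝ)⁻¹ * m)).prod

theorem one_le_shiftEigen {a : ℝ} (ha : 0 < a) (n m : ℕ) : 1 ≤ shiftEigen a n m := by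
  unfold shiftEigen
  generalize List.range n = l
  induction l with
  | nil => simp
  | cons j l ih =>
    simp only [List.map_cons, List.prod_cons]
    have : (0 : ℝ) ≤ (a + j)⁻¹ * m := by positivity
    exact one_le_mul_of_one_le_of_one_le (by linarith) ih

theorem sliceCoeff_shiftProd {d : ℕ} (a : ℝ) (n : ℕ) (f : Hol d) {z : Cd d}
    (hz : z ∈ unitBall d) (m : ℕ) :
    sliceCoeff (shiftProd d a n f) z m = shiftEigen a n m * sliceCoeff f z m := by
  unfold shiftProd shiftEigen
  generalize List.range n = l
  induction l with
  | nil => simp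
  | cons j l ih =>
    simp only [List.map_cons, List.prod_cons, Module.End.mul_apply, LinearMap.add_apply,
      Module.End.one_apply, LinearMap.smul_apply]
    rw [sliceCoeff_add _ _ hz, sliceCoeff_smul, sliceCoeff_numberOp _ hz, ih]
    push_cast
    ring

theorem measurePreserving_withDensity {X : Type*} [MeasurableSpace X] {ν : Measure X} {g : X → X}
    (hg : MeasurePreserving g ν ν) {ρ : X → ℝ≥0∞} (hρ : Measurable ρ) (h : ∀ x, ρ (g x) = ρ x) :
    MeasurePreserving g (ν.withDensity ρ) (ν.withDensity ρ) := by
  refine ⟨hg.measurable, Measure.ext fun s hs => ?_⟩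
  rw [Measure.map_apply hg.measurable hs, withDensity_apply _ (hg.measurable hs),
    withDensity_apply _ hs]
  conv_rhs => rw [← hg.map_eq]
  rw [setLIntegral_map hs hρ hg.measurable]
  simp only [h]

theorem measurePreserving_smul (d : ℕ) {u : ℂ} (hu : ‖u‖ = 1) :
    MeasurePreserving (fun z : Cd d => u • z) volume volume := by
  have hu0 : u ≠ 0 := norm_ne_zero_iff.1 (by rw [hu]; exact one_ne_zero)
  let L : Cd d →ₗᵢ[ℝ] Cd d :=
    { toFun := fun z => u • z
      map_add' := smul_add u
      map_smul' := fun c z => smul_comm u c z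
      norm_map' := fun z => by
        change ‖u • z‖ = ‖z‖
        rw [norm_smul, hu, one_mul] }
  have hs : Function.Surjective L := fun z => ⟨u⁻¹ • z, smul_inv_smul₀ hu0 z⟩
  exact (LinearIsometryEquiv.ofSurjective L hs).measurePreserving

theorem measurePreserving_smul_mu (d : ℕ) (s : ℝ) {u : ℂ} (hu : ‖u‖ = 1) :
    MeasurePreserving (fun z : Cd d => u • z) (mu d s) (mu d s) := by
  refine measurePreserving_withDensity (measurePreserving_withDensity ?_ (by fun_prop) ?_)
    (by fun_prop) ?_
  · have h := (measurePreserving_smul d hu).restrict_preimage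
      (isOpen_unitBall d).measurableSet
    have e : (fun z : Cd d => u • z) ⁻¹' unitBall d = unitBall d := by
      ext z
      simp [unitBall, norm_smul, hu]
    rwa [e] at h
  · intro z
    simp only [norm_smul, hu, one_mul]
  · intro z
    simp only [norm_smul, hu, one_mul]

instance (d : ℕ) (s : ℝ) : SFinite (mu d s) := by unfold mu tau; infer_instance

theorem ae_mem_unitBall (d : ℕ) (s : ℝ) : ∀ᵐ z ∂mu d s, z ∈ unitBall d := by
  have h : mu d s ≪ volume.restrict (unitBall d) :=
    (withDensity_absolutelyContinuous _ _).trans (withDensity_absolutelyContinuous _ _)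
  exact h.ae_le (ae_restrict_mem (isOpen_unitBall d).measurableSet)

theorem measurePreserving_skew (d : ℕ) (s : ℝ) :
    MeasurePreserving (fun p : ℝ × Cd d => (p.1, cis p.1 • p.2))
      (arc.prod (mu d s)) (arc.prod (mu d s)) := by
  refine (MeasurePreserving.id arc).skew_product (g := fun θ z => cis θ • z) ?_
    (ae_of_all _ fun θ => (measurePreserving_smul_mu d s (norm_cis θ)).map_eq)
  have : Continuous (Function.uncurry fun (θ : ℝ) (z : Cd d) => cis θ • z) := by
    have := continuous_cis
    unfold Function.uncurry
    fun_prop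
  exact this.measurable

theorem integrable_skew {d : ℕ} {s : ℝ} {F : Cd d → ℂ} (hF : Integrable F (mu d s)) :
    Integrable (fun p : ℝ × Cd d => F (cis p.1 • p.2)) (arc.prod (mu d s)) :=
  (measurePreserving_skew d s).integrable_comp_of_integrable (hF.comp_snd arc)

theorem integrable_average {d : ℕ} {s : ℝ} {F : Cd d → ℂ} (hF : Integrable F (mu d s)) :
    Integrable (fun z => ∫ θ, F (cis θ • z) ∂arc) (mu d s) :=
  (integrable_skew hF).integral_prod_right

theorem integral_average {d : ℕ} {s : ℝ} {F : Cd d → ℂ} (hF : Integrable F (mu d s)) :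
    ∫ z, (∫ θ, F (cis θ • z) ∂arc) ∂mu d s = ((2 * Real.pi : ℝ) : ℂ) * ∫ z, F z ∂mu d s := by
  have h := integral_integral_swap (f := fun (θ : ℝ) (z : Cd d) => F (cis θ • z))
    (integrable_skew hF)
  rw [← h]
  have h2 (θ : ℝ) : ∫ z, F (cis θ • z) ∂mu d s = ∫ z, F z ∂mu d s := by
    have hp := measurePreserving_smul_mu d s (norm_cis θ)
    have hFm : AEStronglyMeasurable F ((mu d s).map fun z => cis θ • z) := by
      rw [hp.map_eq]
      exact hF.1
    have := integral_map hp.measurable.aemeasurable hFm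
    rw [hp.map_eq] at this
    exact this.symm
  simp only [h2, integral_const, arc]
  rw [measureReal_restrict_apply_univ, Real.volume_real_Ioc_of_le (by positivity)]
  simp [Complex.real_smul]

theorem memLp_shiftProd {d : ℕ} {lam : ℝ} {n : ℕ} (a : ℝ) {f : Hol d}
    (hf : f ∈ sobolevSubmodule d lam n) :
    MemLp (shiftProd d a n f : Cd d → ℂ) 2 (mu d (lam + 2 * n)) := by
  have key : ∀ l : List ℕ, ∀ k : ℕ, k + l.length ≤ n →
      MemLp ((numberOp d ^ k) ((l.map fun j : ℕ => (1 + ((a + j : ℝ) : ℂ)⁻¹ • numberOp d :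
        Module.End ℂ (Hol d))).prod f) : Cd d → ℂ) 2 (mu d (lam + 2 * n)) := by
    intro l
    induction l with
    | nil =>
      intro k hk
      simpa using hf k (by simpa using hk)
    | cons j l ih =>
      intro k hk
      rw [List.length_cons] at hk
      have h1 := ih k (by omega)
      have h2 := ih (k + 1) (by omega)
      rw [List.map_cons, List.prod_cons, Module.End.mul_apply, LinearMap.add_apply,
        Module.End.one_apply, LinearMap.smul_apply, map_add, map_smul]
      rw [pow_succ, Module.End.mul_apply] at h2
      exact h1.add (h2.const_smul _)
  simpa [shiftProd] using key (List.range n) 0 (by simp)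

theorem integrable_form {d : ℕ} {lam : ℝ} {n : ℕ} (a b : ℝ) {f g : Hol d}
    (hf : f ∈ sobolevSubmodule d lam n) (hg : g ∈ sobolevSubmodule d lam n) :
    Integrable (fun z => conj ((shiftProd d a n f : Cd d → ℂ) z) *
      (shiftProd d b n g : Cd d → ℂ) z) (mu d (lam + 2 * n)) :=
  (memLp_shiftProd a hf).star.integrable_mul (memLp_shiftProd b hg)

/-- The circle average of the integrand of `sobolevForm`. -/
theorem hasSum_circle {d : ℕ} (a b : ℝ) (n : ℕ) (f g : Hol d) {z : Cd d} (hz : z ∈ unitBall d) :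
    HasSum (fun m => (((2 * Real.pi) * (shiftEigen a n m * shiftEigen b n m) : ℝ) : ℂ) *
        (conj (sliceCoeff f z m) * sliceCoeff g z m))
      (∫ θ, conj ((shiftProd d a n f : Cd d → ℂ) (cis θ • z)) *
        (shiftProd d b n g : Cd d → ℂ) (cis θ • z) ∂arc) := by
  have h := parseval (hasSum_slice (shiftProd d a n f) hz) (hasSum_slice (shiftProd d b n g) hz)
  convert h using 1
  funext m
  rw [sliceCoeff_shiftProd _ _ _ hz, sliceCoeff_shiftProd _ _ _ hz]
  simp only [map_mul, Complex.conj_ofReal]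
  push_cast
  ring

theorem sobolevForm_average {d : ℕ} {lam : ℝ} {n : ℕ} {f g : Hol d}
    (hf : f ∈ sobolevSubmodule d lam n) (hg : g ∈ sobolevSubmodule d lam n) :
    ((2 * Real.pi : ℝ) : ℂ) * sobolevForm d lam n f g =
      ∫ z, ∑' m, (((2 * Real.pi) * (shiftEigen (lam + n) n m * shiftEigen lam n m) : ℝ) : ℂ) *
        (conj (sliceCoeff f z m) * sliceCoeff g z m) ∂mu d (lam + 2 * n) := by
  rw [sobolevForm, ← integral_average (integrable_form _ _ hf hg)]
  refine integral_congr_ae ?_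
  filter_upwards [ae_mem_unitBall d (lam + 2 * n)] with z hz
  exact (hasSum_circle _ _ n f g hz).tsum_eq.symm

theorem two_pi_ne_zero : ((2 * Real.pi : ℝ) : ℂ) ≠ 0 := by
  exact_mod_cast Real.two_pi_pos.ne'

theorem sobolevForm_conj_symm {d : ℕ} {lam : ℝ} {n : ℕ} {f g : Hol d}
    (hf : f ∈ sobolevSubmodule d lam n) (hg : g ∈ sobolevSubmodule d lam n) :
    conj (sobolevForm d lam n g f) = sobolevForm d lam n f g := by
  apply mul_left_cancel₀ two_pi_ne_zero
  rw [sobolevForm_average hf hg, ← Complex.conj_ofReal (2 * Real.pi), ← map_mul,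
    sobolevForm_average hg hf, ← integral_conj]
  congr 1
  funext z
  rw [Complex.conj_tsum]
  congr 1
  funext m
  simp only [map_mul, Complex.conj_ofReal, Complex.conj_conj]
  ring

theorem integral_norm_sq_le {d : ℕ} {lam : ℝ} (hlam : 0 < lam) {n : ℕ} {f : Hol d}
    (hf : f ∈ sobolevSubmodule d lam n) :
    ∫ z, ‖(f : Cd d → ℂ) z‖ ^ 2 ∂mu d (lam + 2 * n) ≤ (sobolevForm d lam n f f).re := by
  have hlam' : 0 < lam + n := by positivity
  have hf0 : MemLp (f : Cd d → ℂ) 2 (mu d (lam + 2 * n)) := by simpa using hf 0 (Nat.zero_le n)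
  have hi1 : Integrable (fun z => conj ((f : Cd d → ℂ) z) * (f : Cd d → ℂ) z)
      (mu d (lam + 2 * n)) := hf0.star.integrable_mul hf0
  have hi2 := integrable_form (lam + n) lam hf hf
  have e1 := integral_average hi1
  have e2 := integral_average hi2
  have hle : (∫ z, (∫ θ, conj ((f : Cd d → ℂ) (cis θ • z)) * (f : Cd d → ℂ) (cis θ • z) ∂arc)
        ∂mu d (lam + 2 * n)).re ≤
      (∫ z, (∫ θ, conj ((shiftProd d (lam + n) n f : Cd d → ℂ) (cis θ • z)) *
        (shiftProd d lam n f : Cd d → ℂ) (cis θ • z) ∂arc) ∂mu d (lam + 2 * n)).re := by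
    have r1 := integral_re (integrable_average hi1)
    have r2 := integral_re (integrable_average hi2)
    simp only [RCLike.re_eq_complex_re] at r1 r2
    rw [← r1, ← r2]
    refine integral_mono_ae (integrable_average hi1).re (integrable_average hi2).re ?_
    filter_upwards [ae_mem_unitBall d (lam + 2 * n)] with z hz
    have s1 := Complex.hasSum_re (parseval (hasSum_slice f hz) (hasSum_slice f hz))
    have s2 := Complex.hasSum_re (hasSum_circle (lam + n) lam n f f hz)
    refine hasSum_le (fun m => ?_) s1 s2
    rw [← Complex.normSq_eq_conj_mul_self, ← Complex.ofReal_mul, ← Complex.ofReal_mul,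
      Complex.ofReal_re, Complex.ofReal_re]
    have h1 := one_le_shiftEigen hlam' n m
    have h2 := one_le_shiftEigen hlam n m
    have h3 := one_le_mul_of_one_le_of_one_le h1 h2
    have h4 := Complex.normSq_nonneg (sliceCoeff f z m)
    have h5 := Real.two_pi_pos
    exact mul_le_mul_of_nonneg_right (by nlinarith) h4
  rw [e1, e2, Complex.re_ofReal_mul, Complex.re_ofReal_mul] at hle
  have hle' := le_of_mul_le_mul_left hle Real.two_pi_pos
  refine le_trans (le_of_eq ?_) hle'
  have e3 : (fun z => conj ((f : Cd d → ℂ) z) * (f : Cd d → ℂ) z) =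
      fun z => ((‖(f : Cd d → ℂ) z‖ ^ 2 : ℝ) : ℂ) := by
    funext z
    rw [← Complex.normSq_eq_conj_mul_self, Complex.normSq_eq_norm_sq]
  rw [e3, integral_complex_ofReal, Complex.ofReal_re]

theorem cConst_pos {d : ℕ} {s : ℝ} (hs : (d : ℝ) < s) : 0 < cConst d s := by
  have h0 : (0 : ℝ) ≤ d := Nat.cast_nonneg d
  have h1 := Real.Gamma_pos_of_pos (h0.trans_lt hs)
  have h2 := Real.Gamma_pos_of_pos (sub_pos.2 hs)
  have := Real.pi_pos
  unfold cConst
  positivity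

theorem eq_zero_of_sobolevForm {d : ℕ} {lam : ℝ} (hlam : 0 < lam) {n : ℕ}
    (hn : (d : ℝ) < lam + 2 * n) {f : Hol d} (hf : f ∈ sobolevSubmodule d lam n)
    (h : sobolevForm d lam n f f = 0) : f = 0 := by
  have hf0 : MemLp (f : Cd d → ℂ) 2 (mu d (lam + 2 * n)) := by simpa using hf 0 (Nat.zero_le n)
  have h1 := integral_norm_sq_le hlam hf
  rw [h, Complex.zero_re] at h1
  have h2 : ∫ z, ‖(f : Cd d → ℂ) z‖ ^ 2 ∂mu d (lam + 2 * n) = 0 :=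
    le_antisymm h1 (integral_nonneg fun _ => by positivity)
  rw [integral_eq_zero_iff_of_nonneg (fun _ => by positivity) hf0.norm.integrable_sq] at h2
  have hac : volume.restrict (unitBall d) ≪ mu d (lam + 2 * n) := by
    have hball : ∀ᵐ z ∂volume.restrict (unitBall d), 0 < 1 - ‖z‖ ^ 2 := by
      filter_upwards [ae_restrict_mem (isOpen_unitBall d).measurableSet] with z hz
      have hz1 : ‖z‖ < 1 := by simpa [unitBall] using hz
      nlinarith [norm_nonneg z]
    have a1 : volume.restrict (unitBall d) ≪ tau d := by
      refine withDensity_absolutelyContinuous' (by fun_prop) ?_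
      filter_upwards [hball] with z hz
      have := Real.rpow_pos_of_pos hz (-((d : ℝ) + 1))
      simpa using this
    refine a1.trans (withDensity_absolutelyContinuous' (by fun_prop) ?_)
    have hball' := (withDensity_absolutelyContinuous (volume.restrict (unitBall d))
      fun z : Cd d => ENNReal.ofReal ((1 - ‖z‖ ^ 2) ^ (-((d : ℝ) + 1)))).ae_le hball
    filter_upwards [hball'] with z hz
    have := mul_pos (cConst_pos hn) (Real.rpow_pos_of_pos hz (lam + 2 * n))
    simpa using this
  have h3 : (f : Cd d → ℂ) =ᵐ[volume.restrict (unitBall d)] fun _ => 0 := by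
    filter_upwards [hac.ae_le h2] with z hz
    simpa using hz
  have h4 := Measure.eqOn_open_of_ae_eq h3 (isOpen_unitBall d) f.2.1.continuousOn
    continuousOn_const
  ext z
  by_cases hz : z ∈ unitBall d
  · exact h4 hz
  · exact f.2.2 z hz

/-- The generalized Bergman space `H(𝔹^d, lam)`, realized with the number `n` of derivatives. -/
def GenBergman (d : ℕ) (lam : ℝ) (n : ℕ) (_ : 0 < lam) (_ : (d : ℝ) < lam + 2 * n) : Type :=
  sobolevSubmodule d lam n

section GenBergman

variable {d : ℕ} {lam : ℝ} {n : ℕ} {hlam : 0 < lam} {hn : (d : ℝ) < lam + 2 * n}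

instance : AddCommGroup (GenBergman d lam n hlam hn) :=
  inferInstanceAs (AddCommGroup (sobolevSubmodule d lam n))

instance : Module ℂ (GenBergman d lam n hlam hn) :=
  inferInstanceAs (Module ℂ (sobolevSubmodule d lam n))

/-- The holomorphic function underlying an element of `H(𝔹^d, lam)`. -/
def GenBergman.toHol (f : GenBergman d lam n hlam hn) : Hol d := Subtype.val f

theorem GenBergman.mem (f : GenBergman d lam n hlam hn) : f.toHol ∈ sobolevSubmodule d lam n :=
  Subtype.property f

instance : CoeFun (GenBergman d lam n hlam hn) fun _ => Cd d → ℂ where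
  coe f := (f.toHol : Cd d → ℂ)

/-- `sobolevForm` is an inner product on `H(𝔹^d, lam)`. -/
abbrev genBergmanCore : InnerProductSpace.Core ℂ (GenBergman d lam n hlam hn) where
  inner f g := sobolevForm d lam n f.toHol g.toHol
  conj_inner_symm f g := sobolevForm_conj_symm f.mem g.mem
  re_inner_nonneg f :=
    (integral_nonneg fun _ => by positivity).trans (integral_norm_sq_le hlam f.mem)
  add_left f g h := by
    have e : (f + g).toHol = f.toHol + g.toHol := rfl
    simp only [sobolevForm, e, map_add, Submodule.coe_add, Pi.add_apply, add_mul]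
    exact integral_add (integrable_form _ _ f.mem h.mem) (integrable_form _ _ g.mem h.mem)
  smul_left f g c := by
    have e : (c • f).toHol = c • f.toHol := rfl
    simp only [sobolevForm, e, map_smul, Submodule.coe_smul, Pi.smul_apply, smul_eq_mul, map_mul,
      mul_assoc]
    exact integral_const_mul _ _
  definite f h := Subtype.ext (eq_zero_of_sobolevForm hlam hn f.mem h)

instance : NormedAddCommGroup (GenBergman d lam n hlam hn) :=
  genBergmanCore.toNormedAddCommGroup

instance : InnerProductSpace ℂ (GenBergman d lam n hlam hn) :=
  InnerProductSpace.ofCore genBergmanCore.toCore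

theorem GenBergman.inner_def (f g : GenBergman d lam n hlam hn) :
    inner ℂ f g = sobolevForm d lam n f.toHol g.toHol := rfl

end GenBergman

/-- An operator is Hilbert-Schmidt if `∑ ‖T e_i‖²` converges for some orthonormal (Hilbert) basis
`e`. -/
def IsHilbertSchmidt {E : Type} [NormedAddCommGroup E] [InnerProductSpace ℂ E]
    (T : E →L[ℂ] E) : Prop :=
  ∃ (ι : Type) (e : HilbertBasis ι ℂ E), Summable fun i => ‖T (e i)‖ ^ 2

/-- `conj f · φ · g · (1 - |z|²)^lam`. -/
def toeplitzIntegrand (d : ℕ) (lam : ℝ) (φ f g : Cd d → ℂ) (z : Cd d) : ℂ :=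
  conj (f z) * φ z * g z * (((1 - ‖z‖ ^ 2) ^ lam : ℝ) : ℂ)

/-- `f` is bounded on the unit ball. -/
def IsBoundedOnBall {d : ℕ} (f : Cd d → ℂ) : Prop := ∃ C : ℝ, ∀ z ∈ unitBall d, ‖f z‖ ≤ C

/-- `⟨f, T g⟩_lam = c_lam ∫ conj f φ g (1 - |z|²)^lam dτ` for all bounded `f`, `g` in
`H(𝔹^d, lam)`. -/
def HasToeplitzEntries {d : ℕ} {lam : ℝ} {n : ℕ} {hlam : 0 < lam} {hn : (d : ℝ) < lam + 2 * n}
    (φ : Cd d → ℂ) (T : GenBergman d lam n hlam hn →L[ℂ] GenBergman d lam n hlam hn) : Prop :=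
  ∀ f g : GenBergman d lam n hlam hn, IsBoundedOnBall f → IsBoundedOnBall g →
    inner ℂ f (T g) = (cConst d lam : ℂ) * ∫ z, toeplitzIntegrand d lam φ f g z ∂tau d

/-- `A_lam φ (z) = c_lam² ∫ [(1-|z|²)(1-|w|²) / ((1 - w·z̄)(1 - w̄·z))]^lam φ(w) dτ(w)`; the
denominator is `|1 - w·z̄|²`, since its two factors are complex conjugates. -/
def aOp (d : ℕ) (lam : ℝ) (φ : Cd d → ℂ) (z : Cd d) : ℂ :=
  (cConst d lam : ℂ) ^ 2 *
    ∫ w, ((((1 - ‖z‖ ^ 2) * (1 - ‖w‖ ^ 2) / ‖1 - inner ℂ z w‖ ^ 2) ^ lam : ℝ) : ℂ) * φ w ∂tau d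

theorem pos_of_half_lt {d : ℕ} {lam : ℝ} (h : (d : ℝ) / 2 < lam) : 0 < lam :=
  lt_of_le_of_lt (by positivity) h

end BergmanBall

end

noncomputable section

namespace BergmanBall


theorem integral_coord_eq (d : ℕ) (F : Cd d → ℂ) :
    ∫ z : Cd d, F z = ∫ x : Fin d → ℂ, F (WithLp.toLp 2 x) := by
  let e : (Fin d → ℂ) ≃L[ℝ] Cd d := (PiLp.continuousLinearEquiv 2 ℝ (fun _ : Fin d => ℂ)).symm
  let ν : Measure (Cd d) := Measure.map e volume
  have hν : ν.IsAddHaarMeasure := e.isAddHaarMeasure_map volume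
  have h1 : ν = Measure.addHaarScalarFactor ν volume • volume :=
    Measure.isAddLeftInvariant_eq_smul ν volume
  set c := Measure.addHaarScalarFactor ν volume
  have key (G : Cd d → ℂ) : ∫ x : Fin d → ℂ, G (WithLp.toLp 2 x) = (c : ℝ) * ∫ z, G z := by
    have h2 : ∫ x, G x ∂ν = ∫ x : Fin d → ℂ, G (WithLp.toLp 2 x) :=
      integral_map_equiv e.toHomeomorph.toMeasurableEquiv G
    rw [← h2, h1, integral_smul_nnreal_measure, NNReal.smul_def, Complex.real_smul]
  have hg := GaussianFourier.integral_rexp_neg_mul_sq_norm (V := Cd d) one_pos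
  have hfin : (Module.finrank ℝ (Cd d) : ℝ) / 2 = d := by
    have : Module.finrank ℝ (Cd d) = 2 * d := by
      rw [← Module.finrank_mul_finrank ℝ ℂ (Cd d)]
      simp
    rw [this]
    push_cast
    ring
  rw [hfin, div_one, Real.rpow_natCast] at hg
  have hg' : ∫ z : Cd d, ((Real.exp (-1 * ‖z‖ ^ 2) : ℝ) : ℂ) = Real.pi ^ d := by
    rw [integral_complex_ofReal, hg]
    push_cast
    rfl
  have h3 := key fun z => ((Real.exp (-1 * ‖z‖ ^ 2) : ℝ) : ℂ)
  have h4 : ∫ x : Fin d → ℂ, ((Real.exp (-1 * ‖(WithLp.toLp 2 x : Cd d)‖ ^ 2) : ℝ) : ℂ)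
      = Real.pi ^ d := by
    have : (fun x : Fin d → ℂ => ((Real.exp (-1 * ‖(WithLp.toLp 2 x : Cd d)‖ ^ 2) : ℝ) : ℂ))
        = fun x => ∏ j, ((Real.exp (-1 * ‖x j‖ ^ 2) : ℝ) : ℂ) := by
      funext x
      rw [EuclideanSpace.norm_sq_eq, Finset.mul_sum, Real.exp_sum]
      push_cast
      rfl
    rw [this, integral_fintype_prod_volume_eq_prod
      (f := fun _ (z : ℂ) => ((Real.exp (-1 * ‖z‖ ^ 2) : ℝ) : ℂ))]
    have h1 := GaussianFourier.integral_rexp_neg_mul_sq_norm (V := ℂ) one_pos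
    simp only [integral_complex_ofReal, h1]
    simp
  rw [h4, hg'] at h3
  have hpi : (Real.pi : ℂ) ^ d ≠ 0 := pow_ne_zero _ (by exact_mod_cast Real.pi_ne_zero)
  have hc : ((c : ℝ) : ℂ) = 1 := by
    have := mul_right_cancel₀ hpi ((one_mul _).trans h3)
    exact this.symm
  rw [key, hc, one_mul]

theorem integral_gaussian_norm_pow (a : ℕ) :
    ∫ z : ℂ, ‖z‖ ^ a * Real.exp (-‖z‖ ^ 2) = Real.pi * Real.Gamma ((a + 2) / 2) := by
  have h := Complex.integral_rpow_mul_exp_neg_rpow (p := 2) (q := a) (by norm_num)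
    (by have : (0 : ℝ) ≤ a := Nat.cast_nonneg a
        linarith)
  simp only [Real.rpow_natCast, Real.rpow_two] at h
  rw [h]
  ring

theorem integrable_gaussian_monomial (a b : ℕ) :
    Integrable fun z : ℂ => conj z ^ a * z ^ b * ((Real.exp (-‖z‖ ^ 2) : ℝ) : ℂ) := by
  have h : Integrable fun z : ℂ => ‖z‖ ^ (a + b) * Real.exp (-‖z‖ ^ 2) := by
    by_contra hn
    have h1 := integral_gaussian_norm_pow (a + b)
    rw [integral_undef hn] at h1
    have h2 : 0 < Real.Gamma (((a + b : ℕ) + 2) / 2) := Real.Gamma_pos_of_pos (by positivity)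
    have := Real.pi_pos
    exact absurd h1 (by positivity)
  refine h.mono' (Continuous.aestronglyMeasurable (by fun_prop)) (ae_of_all _ fun z => ?_)
  simp [pow_add, Complex.norm_exp]
  norm_cast

theorem integral_gaussian_monomial (a b : ℕ) :
    ∫ z : ℂ, conj z ^ a * z ^ b * ((Real.exp (-‖z‖ ^ 2) : ℝ) : ℂ) =
      if a = b then ((Real.pi * a.factorial : ℝ) : ℂ) else 0 := by
  split_ifs with h
  · subst h
    have e : (fun z : ℂ => conj z ^ a * z ^ a * ((Real.exp (-‖z‖ ^ 2) : ℝ) : ℂ)) =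
        fun z => ((‖z‖ ^ (2 * a) * Real.exp (-‖z‖ ^ 2) : ℝ) : ℂ) := by
      funext z
      rw [← mul_pow, ← Complex.normSq_eq_conj_mul_self, Complex.normSq_eq_norm_sq, pow_mul]
      push_cast
      rfl
    rw [e, integral_complex_ofReal, integral_gaussian_norm_pow]
    have : ((2 * a : ℕ) + 2 : ℝ) / 2 = a + 1 := by
      push_cast
      ring
    rw [this, Real.Gamma_nat_eq_factorial]
  · have hne : ((b : ℂ) - a) ≠ 0 := sub_ne_zero.2 (by exact_mod_cast Ne.symm h)
    set θ : ℝ := Real.pi / (b - a) with hθ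
    have hu : conj (cis θ) ^ a * cis θ ^ b = -1 := by
      simp only [cis, ← Complex.exp_conj, ← Complex.exp_nat_mul, ← Complex.exp_add]
      rw [← Complex.exp_pi_mul_I]
      congr 1
      simp [hθ]
      field_simp
      ring
    let R : ℂ ≃ₗᵢ[ℝ] ℂ := rotation ⟨cis θ, mem_sphere_zero_iff_norm.2 (norm_cis θ)⟩
    have h2 := R.measurePreserving.integral_comp R.toHomeomorph.measurableEmbedding
      (fun z : ℂ => conj z ^ a * z ^ b * ((Real.exp (-‖z‖ ^ 2) : ℝ) : ℂ))
    have h3 : (fun z : ℂ => conj (R z) ^ a * R z ^ b * ((Real.exp (-‖R z‖ ^ 2) : ℝ) : ℂ)) =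
        fun z => -(conj z ^ a * z ^ b * ((Real.exp (-‖z‖ ^ 2) : ℝ) : ℂ)) := by
      funext z
      have : R z = cis θ * z := rfl
      rw [R.norm_map, this, map_mul, mul_pow, mul_pow]
      linear_combination (conj z ^ a * z ^ b * ((Real.exp (-‖z‖ ^ 2) : ℝ) : ℂ)) * hu
    rw [h3, integral_neg] at h2
    exact self_eq_neg.1 h2.symm

/-- The monomial `∏ i, z (σ i)` attached to a word `σ`. -/
def wordMonomial {d m : ℕ} (σ : Fin m → Fin d) (z : Cd d) : ℂ := ∏ i, z (σ i)

theorem sum_conj_wordMonomial_mul {d : ℕ} (m : ℕ) (w z : Cd d) :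
    ∑ σ : Fin m → Fin d, conj (wordMonomial σ w) * wordMonomial σ z = inner ℂ w z ^ m := by
  have : inner ℂ w z = ∑ j, conj (w j) * z j := by
    simp [PiLp.inner_apply, mul_comm]
  rw [this, Finset.sum_pow', ← Fintype.piFinset_univ]
  refine Finset.sum_congr rfl fun σ _ => ?_
  simp [wordMonomial, Finset.prod_mul_distrib]

theorem integral_gaussian_inner_pow {d m : ℕ} (w : Cd d) (τ : Fin m → Fin d) :
    ∫ z : Cd d, conj (inner ℂ w z ^ m) * wordMonomial τ z * ((Real.exp (-‖z‖ ^ 2) : ℝ) : ℂ) =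
      (Real.pi ^ d * m.factorial : ℝ) * wordMonomial τ w := by
  classical
  let β : Fin d → ℕ := fun j => (Finset.univ.filter fun i => τ i = j).card
  have hβ (z : Fin d → ℂ) : ∏ i, z (τ i) = ∏ j, z j ^ β j := by
    rw [← Finset.prod_fiberwise Finset.univ τ]
    refine Finset.prod_congr rfl fun j _ => ?_
    rw [Finset.prod_congr rfl (g := fun _ => z j), Finset.prod_const]
    intro i hi
    rw [(Finset.mem_filter.1 hi).2]
  have hβm : ∑ j, β j = m := by
    have := Finset.card_eq_sum_card_fiberwise (f := τ) (s := Finset.univ) (t := Finset.univ)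
      (by simp)
    simpa [β] using this.symm
  rw [integral_coord_eq]
  have e (x : Fin d → ℂ) : conj (inner ℂ w (WithLp.toLp 2 x : Cd d) ^ m) *
      wordMonomial τ (WithLp.toLp 2 x : Cd d) *
        ((Real.exp (-‖(WithLp.toLp 2 x : Cd d)‖ ^ 2) : ℝ) : ℂ) =
      ∑ k ∈ Finset.univ.piAntidiag m, ((Nat.multinomial Finset.univ k : ℂ) * ∏ j, w j ^ k j) *
        ∏ j, (conj (x j) ^ k j * x j ^ β j * ((Real.exp (-‖x j‖ ^ 2) : ℝ) : ℂ)) := by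
    have h1 : conj (inner ℂ w (WithLp.toLp 2 x : Cd d)) = ∑ j, w j * conj (x j) := by
      simp [PiLp.inner_apply, mul_comm]
    have h2 : wordMonomial τ (WithLp.toLp 2 x : Cd d) = ∏ j, x j ^ β j := hβ x
    have h3 : ((Real.exp (-‖(WithLp.toLp 2 x : Cd d)‖ ^ 2) : ℝ) : ℂ) =
        ∏ j, ((Real.exp (-‖x j‖ ^ 2) : ℝ) : ℂ) := by
      rw [EuclideanSpace.norm_sq_eq, ← Finset.sum_neg_distrib, Real.exp_sum]
      push_cast
      rfl
    rw [map_pow, h1, h2, h3, Finset.sum_pow_eq_sum_piAntidiag, Finset.sum_mul, Finset.sum_mul]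
    refine Finset.sum_congr rfl fun k _ => ?_
    simp only [Finset.prod_mul_distrib, mul_pow]
    ring
  simp only [e]
  rw [integral_finsetSum]
  · have hI (k : Fin d → ℕ) : ∫ x : Fin d → ℂ,
        ∏ j, (conj (x j) ^ k j * x j ^ β j * ((Real.exp (-‖x j‖ ^ 2) : ℝ) : ℂ)) =
        ∏ j, if k j = β j then ((Real.pi * (k j).factorial : ℝ) : ℂ) else 0 := by
      rw [integral_fintype_prod_volume_eq_prod
        (f := fun j (z : ℂ) => conj z ^ k j * z ^ β j * ((Real.exp (-‖z‖ ^ 2) : ℝ) : ℂ))]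
      simp only [integral_gaussian_monomial]
    simp only [integral_const_mul, hI]
    rw [Finset.sum_eq_single β]
    · have hw : wordMonomial τ w = ∏ j, w j ^ β j := hβ w
      have hs := Nat.multinomial_spec Finset.univ β
      rw [hβm] at hs
      rw [hw, ← hs]
      simp only [if_true]
      push_cast
      rw [Finset.prod_mul_distrib]
      simp
      ring
    · intro k _ hk
      obtain ⟨j, hj⟩ := Function.ne_iff.1 hk
      exact mul_eq_zero_of_right _ (Finset.prod_eq_zero (Finset.mem_univ j) (if_neg hj))
    · intro h
      exact absurd (Finset.mem_piAntidiag.2 ⟨hβm, fun _ _ => Finset.mem_univ _⟩) h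
  · intro k _
    exact (Integrable.fintype_prod (f := fun j (z : ℂ) => conj z ^ k j * z ^ β j *
      ((Real.exp (-‖z‖ ^ 2) : ℝ) : ℂ)) fun j => integrable_gaussian_monomial _ _).const_mul _


open Module in
/-- Integration in polar coordinates of a homogeneous function times a radial one. -/
theorem integral_homogeneous_mul_radial {E : Type*} [NormedAddCommGroup E] [NormedSpace ℝ E]
    [MeasurableSpace E] [Nontrivial E] (μ : Measure E) [FiniteDimensional ℝ E] [BorelSpace E]
    [μ.IsAddHaarMeasure] {F : E → ℂ} {k : ℕ} (hF : ∀ r : ℝ, 0 < r → ∀ x, F (r • x) = r ^ k * F x)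
    (g : ℝ → ℝ) :
    ∫ x, (g ‖x‖ : ℂ) * F x ∂μ = (∫ x, F x.1 ∂μ.toSphere) *
      ((∫ y in Ioi (0 : ℝ), y ^ (finrank ℝ E - 1) * (g y * y ^ k) : ℝ) : ℂ) := by
  calc
    ∫ x, (g ‖x‖ : ℂ) * F x ∂μ
      = ∫ x : ({(0)}ᶜ : Set E), (g ‖x.1‖ : ℂ) * F x.1 ∂(μ.comap (↑)) := by
      rw [integral_subtype_comap (measurableSet_singleton _).compl
        fun x => (g ‖x‖ : ℂ) * F x, restrict_compl_singleton]
    _ = ∫ x : Metric.sphere (0 : E) 1 × Ioi (0 : ℝ), F x.1.1 * ((g x.2.1 * x.2.1 ^ k : ℝ) : ℂ)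
          ∂μ.toSphere.prod (.volumeIoiPow (finrank ℝ E - 1)) := by
      rw [← μ.measurePreserving_homeomorphUnitSphereProd.integral_comp
        (Homeomorph.measurableEmbedding _)]
      refine integral_congr_ae (ae_of_all _ fun x : ({0}ᶜ : Set E) => ?_)
      have hx : x.1 ≠ 0 := x.2
      have h1 : x.1 = ‖x.1‖ • (‖x.1‖⁻¹ • x.1) := by
        rw [smul_smul, mul_inv_cancel₀ (norm_ne_zero_iff.2 hx), one_smul]
      have h2 := hF ‖x.1‖ (norm_pos_iff.2 hx) (‖x.1‖⁻¹ • x.1)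
      rw [← h1] at h2
      simp only [homeomorphUnitSphereProd_apply_snd_coe, homeomorphUnitSphereProd_apply_fst_coe]
      rw [h2]
      push_cast
      ring
    _ = (∫ x, F x.1 ∂μ.toSphere) *
        ∫ x : Ioi (0 : ℝ), ((g x.1 * x.1 ^ k : ℝ) : ℂ) ∂.volumeIoiPow (finrank ℝ E - 1) :=
      integral_prod_mul (fun x : Metric.sphere (0 : E) 1 => F x.1) (fun x : Ioi (0 : ℝ) => ((g x.1 * x.1 ^ k : ℝ) : ℂ))
    _ = _ := by
      congr 1
      rw [integral_complex_ofReal]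
      congr 1
      simp only [Measure.volumeIoiPow, ENNReal.ofReal]
      rw [integral_withDensity_eq_integral_smul, integral_subtype_comap measurableSet_Ioi
          fun a : ℝ => Real.toNNReal (a ^ (finrank ℝ E - 1)) • (g a * a ^ k),
        setIntegral_congr_fun measurableSet_Ioi fun x hx => ?_]
      · rw [NNReal.smul_def, Real.coe_toNNReal _ (pow_nonneg hx.out.le _), smul_eq_mul]
      · exact (measurable_subtype_coe.pow_const _).real_toNNReal

theorem integral_beta_Ioi {a b : ℝ} (ha : 0 < a) (hb : 0 < b) :
    ∫ y in Ioi (0 : ℝ), (if y < 1 then y ^ (a - 1) * (1 - y) ^ (b - 1) else 0) =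
      Real.Gamma a * Real.Gamma b / Real.Gamma (a + b) := by
  have h1 := ProbabilityTheory.beta_eq_betaIntegralReal a b ha hb
  rw [ProbabilityTheory.beta] at h1
  rw [h1, Complex.betaIntegral, intervalIntegral.integral_of_le zero_le_one,
    ← setIntegral_congr_set Ioo_ae_eq_Ioc]
  have h2 : ∫ x in Ioo (0 : ℝ) 1, (x : ℂ) ^ ((a : ℂ) - 1) * (1 - (x : ℂ)) ^ ((b : ℂ) - 1) =
      ∫ x in Ioo (0 : ℝ) 1, ((x ^ (a - 1) * (1 - x) ^ (b - 1) : ℝ) : ℂ) := by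
    refine setIntegral_congr_fun measurableSet_Ioo fun x hx => ?_
    push_cast
    rw [Complex.ofReal_cpow hx.1.le, Complex.ofReal_cpow (by linarith [hx.2])]
    push_cast
    rfl
  rw [h2, integral_complex_ofReal, Complex.ofReal_re, ← integral_indicator measurableSet_Ioi,
    ← integral_indicator measurableSet_Ioo]
  congr 1
  funext y
  by_cases h0 : 0 < y <;> by_cases h3 : y < 1 <;> simp [indicator, h0, h3]

theorem integral_radial_gaussian {a : ℝ} (ha : 0 < a) :
    ∫ y in Ioi (0 : ℝ), y ^ (2 * a - 1) * Real.exp (-y ^ 2) = Real.Gamma a / 2 := by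
  have h := integral_rpow_mul_exp_neg_rpow (p := 2) (q := 2 * a - 1) (by norm_num) (by linarith)
  simp only [Real.rpow_two] at h
  rw [h]
  ring_nf

theorem integral_radial_beta {a b : ℝ} (ha : 0 < a) (hb : 0 < b) :
    ∫ y in Ioi (0 : ℝ), (if y < 1 then y ^ (2 * a - 1) * (1 - y ^ 2) ^ (b - 1) else 0) =
      Real.Gamma a * Real.Gamma b / Real.Gamma (a + b) / 2 := by
  have h := integral_comp_rpow_Ioi
    (fun y : ℝ => if y < 1 then y ^ (a - 1) * (1 - y) ^ (b - 1) else 0) (two_ne_zero (α := ℝ))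
  rw [← integral_beta_Ioi ha hb, ← h, ← integral_div]
  refine setIntegral_congr_fun measurableSet_Ioi fun y hy => ?_
  have hy0 : (0 : ℝ) < y := hy
  have h1 : y ^ (2 : ℝ) < 1 ↔ y < 1 := by
    rw [Real.rpow_two, sq_lt_one_iff₀ hy0.le]
  have h2 : y ^ (2 * a - 1) = y * (y ^ (2 : ℝ)) ^ (a - 1) := by
    rw [← Real.rpow_mul hy0.le]
    nth_rw 2 [← Real.rpow_one y]
    rw [← Real.rpow_add hy0]
    ring_nf
  simp only [h1, h2, smul_eq_mul]
  rw [Real.rpow_two]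
  split_ifs
  · norm_num
    ring
  · simp

theorem one_sub_norm_sq_pos {d : ℕ} {z : Cd d} (hz : z ∈ unitBall d) : 0 < 1 - ‖z‖ ^ 2 := by
  have hz1 : ‖z‖ < 1 := by simpa [unitBall] using hz
  nlinarith [norm_nonneg z]

theorem ae_tau_mem_unitBall (d : ℕ) : ∀ᵐ z ∂tau d, z ∈ unitBall d :=
  (withDensity_absolutelyContinuous _ _).ae_le (ae_restrict_mem (isOpen_unitBall d).measurableSet)

theorem lintegral_mu {d : ℕ} {s : ℝ} (F : Cd d → ℝ≥0∞) :
    ∫⁻ z, F z ∂mu d s =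
      ∫⁻ z, ENNReal.ofReal (cConst d s * (1 - ‖z‖ ^ 2) ^ s) * F z ∂tau d := by
  rw [mu, lintegral_withDensity_eq_lintegral_mul_non_measurable _ (by fun_prop)
    (ae_of_all _ fun _ => ENNReal.ofReal_lt_top)]
  rfl

theorem integral_mu {d : ℕ} {s : ℝ} (hs : (d : ℝ) < s) (F : Cd d → ℂ) :
    ∫ z, F z ∂mu d s = ∫ z, ((cConst d s * (1 - ‖z‖ ^ 2) ^ s : ℝ) : ℂ) * F z ∂tau d := by
  rw [mu, integral_withDensity_eq_integral_toReal_smul (by fun_prop)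
    (ae_of_all _ fun _ => ENNReal.ofReal_lt_top)]
  refine integral_congr_ae ?_
  filter_upwards [ae_tau_mem_unitBall d] with z hz
  have h1 := (cConst_pos hs).le
  have h2 := (one_sub_norm_sq_pos hz).le
  rw [ENNReal.toReal_ofReal (by positivity), Complex.real_smul]

theorem integral_tau {d : ℕ} (F : Cd d → ℂ) :
    ∫ z, F z ∂tau d =
      ∫ z in unitBall d, (((1 - ‖z‖ ^ 2) ^ (-((d : ℝ) + 1)) : ℝ) : ℂ) * F z := by
  rw [tau, integral_withDensity_eq_integral_toReal_smul (by fun_prop)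
    (ae_of_all _ fun _ => ENNReal.ofReal_lt_top)]
  refine setIntegral_congr_fun (isOpen_unitBall d).measurableSet fun z hz => ?_
  have h2 := (one_sub_norm_sq_pos hz).le
  rw [ENNReal.toReal_ofReal (by positivity), Complex.real_smul]

theorem integral_mu_eq_volume {d : ℕ} {s : ℝ} (hs : (d : ℝ) < s) (F : Cd d → ℂ) :
    ∫ z, F z ∂mu d s =
      cConst d s * ∫ z, ((if ‖z‖ < 1 then (1 - ‖z‖ ^ 2) ^ (s - d - 1) else 0 : ℝ) : ℂ) * F z := by
  rw [integral_mu hs, integral_tau, ← integral_const_mul,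
    ← integral_indicator (isOpen_unitBall d).measurableSet]
  congr 1
  funext z
  by_cases hz : z ∈ unitBall d
  · have hz1 : ‖z‖ < 1 := by simpa [unitBall] using hz
    have h : (1 - ‖z‖ ^ 2) ^ (s - d - 1) =
        (1 - ‖z‖ ^ 2) ^ (-((d : ℝ) + 1)) * (1 - ‖z‖ ^ 2) ^ s := by
      rw [← Real.rpow_add (one_sub_norm_sq_pos hz)]
      ring_nf
    rw [indicator_of_mem hz, if_pos hz1, h]
    push_cast
    ring
  · have hz1 : ¬ ‖z‖ < 1 := by simpa [unitBall] using hz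
    simp [hz, hz1]

/-- The integral of a homogeneous function against `mu d s`, compared with its Gaussian integral. -/
theorem integral_mu_homogeneous {d : ℕ} {s : ℝ} (hs : (d : ℝ) < s) {F : Cd d → ℂ} {m : ℕ}
    (hF : ∀ r : ℝ, 0 < r → ∀ x, F (r • x) = r ^ (2 * m) * F x) :
    ∫ z, F z ∂mu d s = ((Real.Gamma s / (Real.pi ^ d * Real.Gamma (s + m)) : ℝ) : ℂ) *
      ∫ z, F z * ((Real.exp (-‖z‖ ^ 2) : ℝ) : ℂ) := by
  have hs0 : 0 < s := lt_of_le_of_lt (Nat.cast_nonneg d) hs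
  have hG := (Real.Gamma_pos_of_pos hs0).ne'
  rw [integral_mu_eq_volume hs, cConst]
  rcases Nat.eq_zero_or_pos d with rfl | hd
  · have hz (z : Cd 0) : z = 0 := Subsingleton.elim _ _
    have e1 : (fun z : Cd 0 => ((if ‖z‖ < 1 then (1 - ‖z‖ ^ 2) ^ (s - (0 : ℕ) - 1) else 0 : ℝ) : ℂ)
        * F z) = F := by
      funext z
      rw [hz z]
      simp
    have e2 : (fun z : Cd 0 => F z * ((Real.exp (-‖z‖ ^ 2) : ℝ) : ℂ)) = F := by
      funext z
      rw [hz z]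
      simp
    rw [e1, e2]
    rcases Nat.eq_zero_or_pos m with rfl | hm
    · simp [hG]
    · have h0 : F = fun _ => 0 := by
        funext z
        have h := hF 2 two_pos z
        rw [hz (2 • z), hz z] at h
        rw [hz z]
        have h4 : (2 : ℂ) ^ (2 * m) ≠ 1 := by
          have : (1 : ℝ) < 2 ^ (2 * m) := one_lt_pow₀ one_lt_two (by omega)
          exact_mod_cast this.ne'
        have h5 : ((2 : ℂ) ^ (2 * m) - 1) * F 0 = 0 := by
          push_cast at h
          linear_combination -h
        exact (mul_eq_zero.1 h5).resolve_left (sub_ne_zero.2 h4)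
      simp [h0]
  · have : Nonempty (Fin d) := ⟨⟨0, hd⟩⟩
    have hfin : Module.finrank ℝ (Cd d) = 2 * d := by
      rw [← Module.finrank_mul_finrank ℝ ℂ (Cd d)]
      simp
    have hd' : (0 : ℝ) < d := by exact_mod_cast hd
    have ha : (0 : ℝ) < d + m := by positivity
    have hb : 0 < s - d := sub_pos.2 hs
    have hpow {y : ℝ} (hy : y ∈ Ioi (0 : ℝ)) :
        y ^ (2 * d - 1) * y ^ (2 * m) = y ^ (2 * ((d : ℝ) + m) - 1) := by
      have hy0 : (0 : ℝ) < y := hy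
      rw [← pow_add, ← Real.rpow_natCast]
      congr 1
      rw [show 2 * d - 1 + 2 * m = 2 * (d + m) - 1 by omega, Nat.cast_sub (by omega)]
      push_cast
      ring
    have r1 := integral_homogeneous_mul_radial (volume : Measure (Cd d)) hF
      fun y => if y < 1 then (1 - y ^ 2) ^ (s - d - 1) else 0
    have r2 := integral_homogeneous_mul_radial (volume : Measure (Cd d)) hF
      fun y => Real.exp (-y ^ 2)
    rw [hfin] at r1 r2
    have s1 : ∫ y in Ioi (0 : ℝ), y ^ (2 * d - 1) *
        ((if y < 1 then (1 - y ^ 2) ^ (s - d - 1) else 0) * y ^ (2 * m)) =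
        Real.Gamma (d + m) * Real.Gamma (s - d) / Real.Gamma (d + m + (s - d)) / 2 := by
      rw [← integral_radial_beta ha hb]
      refine setIntegral_congr_fun measurableSet_Ioi fun y hy => ?_
      split_ifs
      · rw [← hpow hy]
        ring
      · ring
    have s2 : ∫ y in Ioi (0 : ℝ), y ^ (2 * d - 1) * (Real.exp (-y ^ 2) * y ^ (2 * m)) =
        Real.Gamma (d + m) / 2 := by
      rw [← integral_radial_gaussian ha]
      refine setIntegral_congr_fun measurableSet_Ioi fun y hy => ?_
      rw [← hpow hy]
      ring
    rw [s1] at r1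
    rw [s2] at r2
    rw [r1]
    simp only [mul_comm (F _)]
    rw [r2]
    have g1 := (Real.Gamma_pos_of_pos ha).ne'
    have g2 := (Real.Gamma_pos_of_pos hb).ne'
    have g3 : Real.Gamma (s + m) ≠ 0 := (Real.Gamma_pos_of_pos (by positivity)).ne'
    have g4 : (d : ℝ) + m + (s - d) = s + m := by ring
    have g5 : Real.pi ≠ 0 := Real.pi_ne_zero
    rw [g4, mul_left_comm, mul_left_comm (((Real.Gamma s / _ : ℝ)) : ℂ)]
    congr 1
    norm_cast
    field_simp

/-- The rising factorial `(a)_m = Γ(a + m) / Γ(a)`. -/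
def risingFactorial (a : ℝ) (m : ℕ) : ℝ := Real.Gamma (a + m) / Real.Gamma a

theorem risingFactorial_pos {a : ℝ} (ha : 0 < a) (m : ℕ) : 0 < risingFactorial a m :=
  div_pos (Real.Gamma_pos_of_pos (by positivity)) (Real.Gamma_pos_of_pos ha)

theorem risingFactorial_zero {a : ℝ} (ha : 0 < a) : risingFactorial a 0 = 1 := by
  simp [risingFactorial, (Real.Gamma_pos_of_pos ha).ne']

theorem risingFactorial_succ {a : ℝ} (ha : 0 < a) (m : ℕ) :
    risingFactorial a (m + 1) = risingFactorial a m * (a + m) := by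
  have h : a + m ≠ 0 := by positivity
  rw [risingFactorial, risingFactorial]
  push_cast
  rw [← add_assoc, Real.Gamma_add_one h]
  ring

theorem wordMonomial_smul {d m : ℕ} (σ : Fin m → Fin d) (c : ℂ) (z : Cd d) :
    wordMonomial σ (c • z) = c ^ m * wordMonomial σ z := by
  simp [wordMonomial, Finset.prod_mul_distrib]

/-- The reproducing property in degree `m`. -/
theorem integral_mu_inner_pow {d m : ℕ} {s : ℝ} (hs : (d : ℝ) < s) (w : Cd d)
    (τ : Fin m → Fin d) :
    ∫ z, conj (inner ℂ w z ^ m) * wordMonomial τ z ∂mu d s =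
      ((m.factorial / risingFactorial s m : ℝ) : ℂ) * wordMonomial τ w := by
  have hs0 : 0 < s := lt_of_le_of_lt (Nat.cast_nonneg d) hs
  rw [integral_mu_homogeneous (m := m) hs, integral_gaussian_inner_pow, ← mul_assoc]
  · congr 1
    have g1 := (Real.Gamma_pos_of_pos hs0).ne'
    have g3 : Real.Gamma (s + m) ≠ 0 := (Real.Gamma_pos_of_pos (by positivity)).ne'
    have g5 : Real.pi ≠ 0 := Real.pi_ne_zero
    rw [risingFactorial]
    norm_cast
    field_simp
  · intro r _ x
    have : r • x = (r : ℂ) • x := rfl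
    rw [this, wordMonomial_smul, inner_smul_right]
    simp only [map_mul, map_pow, Complex.conj_ofReal]
    ring

theorem isFiniteMeasure_mu {d : ℕ} {s : ℝ} (hs : (d : ℝ) < s) : IsFiniteMeasure (mu d s) := by
  have hs0 : 0 < s := lt_of_le_of_lt (Nat.cast_nonneg d) hs
  have h := integral_mu_inner_pow hs 0 (Fin.elim0 : Fin 0 → Fin d)
  simp only [pow_zero, map_one, wordMonomial, Finset.univ_eq_empty, Finset.prod_empty, mul_one,
    risingFactorial_zero hs0, Nat.factorial_zero] at h
  have hi : Integrable (fun _ : Cd d => (1 : ℂ)) (mu d s) := by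
    by_contra hn
    rw [integral_undef hn] at h
    norm_num at h
  exact (integrable_const_iff_isFiniteMeasure one_ne_zero).1 hi


/-- The coefficient `(a)_m / m!` of the binomial series of `(1 - x) ^ (-a)`. -/
def binomCoeff (a : ℝ) (m : ℕ) : ℝ := risingFactorial a m / m.factorial

theorem binomCoeff_pos {a : ℝ} (ha : 0 < a) (m : ℕ) : 0 < binomCoeff a m :=
  div_pos (risingFactorial_pos ha m) (by positivity)

theorem ringChoose_eq_binomCoeff {a : ℝ} (ha : 0 < a) (m : ℕ) :
    Ring.choose (a + m - 1) m = binomCoeff a m := by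
  have h1 : Ring.choose (a + m - 1) m = Ring.multichoose a m := by
    rw [Ring.choose]
    congr 1
    ring
  have h2 := Ring.factorial_nsmul_multichoose_eq_ascPochhammer a m
  rw [Polynomial.ascPochhammer_smeval_eq_eval, nsmul_eq_mul] at h2
  have h3 : (ascPochhammer ℝ m).eval a = risingFactorial a m := by
    clear h1 h2
    induction m with
    | zero => simp [risingFactorial_zero ha]
    | succ m ih => rw [ascPochhammer_succ_eval, ih, risingFactorial_succ ha]
  rw [h1, binomCoeff, eq_div_iff (by positivity), ← h3, ← h2, mul_comm]

theorem hasSum_binomCoeff_complex {a : ℝ} (ha : 0 < a) {x : ℂ} (hx : ‖x‖ < 1) :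
    HasSum (fun m => (binomCoeff a m : ℂ) * x ^ m) ((1 - x) ^ (-a : ℂ)) := by
  have h := (Complex.one_div_one_sub_cpow_hasFPowerSeriesOnBall_zero (a : ℂ)).hasSum (y := x)
    (by simpa [enorm_eq_nnnorm, ← NNReal.coe_lt_coe] using hx)
  rw [zero_add, one_div, ← Complex.cpow_neg] at h
  have e : (fun m => (binomCoeff a m : ℂ) * x ^ m) = fun m =>
      FormalMultilinearSeries.ofScalars ℂ (fun n : ℕ => Ring.choose ((a : ℂ) + n - 1) n) m
        fun _ => x := by
    funext m
    rw [FormalMultilinearSeries.ofScalars_apply_eq, ← ringChoose_eq_binomCoeff ha,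
      Complex.ofReal_choose, smul_eq_mul]
    push_cast
    rfl
  rw [e]
  exact h

theorem hasSum_binomCoeff {a : ℝ} (ha : 0 < a) {x : ℝ} (hx : |x| < 1) :
    HasSum (fun m => binomCoeff a m * x ^ m) ((1 - x) ^ (-a)) := by
  have h := hasSum_binomCoeff_complex ha (x := x) (by simpa using hx)
  rw [← Complex.hasSum_ofReal, Complex.ofReal_cpow (by linarith [le_abs_self x])]
  push_cast
  exact h

theorem risingFactorial_sq_le {a δ : ℝ} (hδ : |δ| < a) (m : ℕ) :
    risingFactorial a m ^ 2 ≤ (Real.Gamma (a + δ) * Real.Gamma (a - δ) / Real.Gamma a ^ 2) *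
      (risingFactorial (a + δ) m * risingFactorial (a - δ) m) := by
  obtain ⟨h1, h2⟩ := abs_lt.1 hδ
  have g0 := Real.Gamma_pos_of_pos (show 0 < a by linarith)
  have g1 := Real.Gamma_pos_of_pos (show 0 < a + δ by linarith)
  have g2 := Real.Gamma_pos_of_pos (show 0 < a - δ by linarith)
  have hm : (0 : ℝ) ≤ m := Nat.cast_nonneg m
  have p1 : 0 < a + δ + m := by linarith
  have p2 : 0 < a - δ + m := by linarith
  have k := Real.Gamma_mul_add_mul_le_rpow_Gamma_mul_rpow_Gamma p1 p2
    (a := 1 / 2) (b := 1 / 2) (by norm_num) (by norm_num) (by norm_num)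
  rw [show 1 / 2 * (a + δ + m) + 1 / 2 * (a - δ + m) = a + m by ring, ← Real.sqrt_eq_rpow,
    ← Real.sqrt_eq_rpow] at k
  have g3 := Real.Gamma_pos_of_pos p1
  have g4 := Real.Gamma_pos_of_pos p2
  have g5 := Real.Gamma_pos_of_pos (show 0 < a + m by linarith)
  have k2 : Real.Gamma (a + m) ^ 2 ≤ Real.Gamma (a + δ + m) * Real.Gamma (a - δ + m) := by
    calc Real.Gamma (a + m) ^ 2
        ≤ (√(Real.Gamma (a + δ + m)) * √(Real.Gamma (a - δ + m))) ^ 2 := by gcongr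
      _ = _ := by rw [mul_pow, Real.sq_sqrt g3.le, Real.sq_sqrt g4.le]
  have e : (Real.Gamma (a + δ) * Real.Gamma (a - δ) / Real.Gamma a ^ 2) *
      (risingFactorial (a + δ) m * risingFactorial (a - δ) m) =
      Real.Gamma (a + δ + m) * Real.Gamma (a - δ + m) / Real.Gamma a ^ 2 := by
    unfold risingFactorial
    field_simp
  rw [e, risingFactorial, div_pow]
  gcongr

theorem shiftEigen_eq {a : ℝ} (ha : 0 < a) (n m : ℕ) :
    shiftEigen a n m = Real.Gamma (a + m + n) * Real.Gamma a /
      (Real.Gamma (a + m) * Real.Gamma (a + n)) := by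
  have g0 := (Real.Gamma_pos_of_pos ha).ne'
  have g1 : Real.Gamma (a + m) ≠ 0 := (Real.Gamma_pos_of_pos (by positivity)).ne'
  induction n with
  | zero =>
    simp [shiftEigen]
    field_simp
  | succ n ih =>
    have h : shiftEigen a (n + 1) m = shiftEigen a n m * (1 + (a + n : ℝ)⁻¹ * m) := by
      simp [shiftEigen, List.range_succ]
    have e1 : a + m + ((n + 1 : ℕ) : ℝ) = a + m + n + 1 := by push_cast; ring
    have e2 : a + ((n + 1 : ℕ) : ℝ) = a + n + 1 := by push_cast; ring
    have p1 : a + n ≠ 0 := by positivity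
    have g2 : Real.Gamma (a + n) ≠ 0 := (Real.Gamma_pos_of_pos (by positivity)).ne'
    rw [h, ih, e1, e2, Real.Gamma_add_one p1, Real.Gamma_add_one (by positivity)]
    field_simp
    ring

theorem shiftEigen_mul_shiftEigen {a : ℝ} (ha : 0 < a) (n m : ℕ) :
    shiftEigen (a + n) n m * shiftEigen a n m =
      risingFactorial (a + 2 * n) m / risingFactorial a m := by
  rw [shiftEigen_eq ha, shiftEigen_eq (by positivity), risingFactorial, risingFactorial]
  have g0 := (Real.Gamma_pos_of_pos ha).ne'
  have g1 : Real.Gamma (a + m) ≠ 0 := (Real.Gamma_pos_of_pos (by positivity)).ne'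
  have g2 : Real.Gamma (a + n) ≠ 0 := (Real.Gamma_pos_of_pos (by positivity)).ne'
  have g3 : Real.Gamma (a + m + n) ≠ 0 := (Real.Gamma_pos_of_pos (by positivity)).ne'
  rw [show a + n + m + n = a + 2 * n + m by ring, show a + n + n = a + 2 * n by ring,
    show a + n + m = a + m + n by ring]
  have g4 : Real.Gamma (a + 2 * n) ≠ 0 := (Real.Gamma_pos_of_pos (by positivity)).ne'
  field_simp

theorem exists_pow_le_shiftEigen {a : ℝ} (ha : 0 < a) (n : ℕ) :
    ∃ C : ℝ, 0 < C ∧ ∀ k ≤ n, ∀ m : ℕ, (m : ℝ) ^ k ≤ C * shiftEigen a n m := by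
  have key : ∀ n : ℕ, ∃ C : ℝ, 0 < C ∧ ∀ m : ℕ, (m : ℝ) ^ n ≤ C * shiftEigen a n m := by
    intro n
    induction n with
    | zero => exact ⟨1, one_pos, fun m => by simp [shiftEigen]⟩
    | succ n ih =>
      obtain ⟨C, hC, h⟩ := ih
      refine ⟨C * (a + n), by positivity, fun m => ?_⟩
      have e : shiftEigen a (n + 1) m = shiftEigen a n m * (1 + (a + n : ℝ)⁻¹ * m) := by
        simp [shiftEigen, List.range_succ]
      have p1 : 0 < a + n := by positivity
      have h1 : (m : ℝ) ≤ (a + n) * (1 + (a + n : ℝ)⁻¹ * m) := by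
        field_simp
        linarith
      have h2 := one_le_shiftEigen ha n m
      rw [e, pow_succ]
      calc (m : ℝ) ^ n * m
          ≤ (C * shiftEigen a n m) * ((a + n) * (1 + (a + n : ℝ)⁻¹ * m)) := by
            gcongr
            exact h m
        _ = _ := by ring
  obtain ⟨C, hC, h⟩ := key n
  refine ⟨C + 1, by positivity, fun k hk m => ?_⟩
  have h2 := one_le_shiftEigen ha n m
  rcases Nat.eq_zero_or_pos m with rfl | hm
  · calc ((0 : ℕ) : ℝ) ^ k ≤ 1 := pow_le_one₀ (by simp) (by simp)
      _ ≤ (C + 1) * shiftEigen a n 0 := by nlinarith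
  · have hm1 : (1 : ℝ) ≤ m := by exact_mod_cast hm
    calc (m : ℝ) ^ k ≤ (m : ℝ) ^ n := pow_le_pow_right₀ hm1 hk
      _ ≤ C * shiftEigen a n m := h m
      _ ≤ (C + 1) * shiftEigen a n m := by nlinarith


theorem Hol.measurable {d : ℕ} (f : Hol d) : Measurable (f : Cd d → ℂ) := by
  classical
  have h := f.2.1.continuousOn.measurable_piecewise (g := fun _ : Cd d => (0 : ℂ))
    continuousOn_const (isOpen_unitBall d).measurableSet
  convert h using 1
  funext z
  by_cases hz : z ∈ unitBall d
  · rw [piecewise_eq_of_mem _ _ _ hz]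
  · rw [piecewise_eq_of_notMem _ _ _ hz, f.2.2 z hz]

theorem lintegral_circle {F : ℝ → ℂ} {a : ℕ → ℂ}
    (ha : ∀ θ, HasSum (fun m => a m * cis θ ^ m) (F θ)) :
    ∫⁻ θ, ‖F θ‖ₑ ^ 2 ∂arc = ENNReal.ofReal (2 * Real.pi) * ∑' m, ‖a m‖ₑ ^ 2 := by
  have sa : Summable fun m => ‖a m‖ := by
    simpa [norm_cis] using (ha 0).summable.norm
  have hF : F = fun θ => ∑' m, a m * cis θ ^ m := funext fun θ => (ha θ).tsum_eq.symm
  have hc : Continuous F := by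
    rw [hF]
    have := continuous_cis
    refine continuous_tsum (fun m => by fun_prop) sa fun m θ => ?_
    simp [norm_cis]
  have hb (θ : ℝ) : ‖F θ‖ ≤ ∑' m, ‖a m‖ := by
    rw [hF]
    exact tsum_of_norm_bounded sa.hasSum fun m => by simp [norm_cis]
  have hint : Integrable (fun θ => ‖F θ‖ ^ 2) arc := by
    refine Integrable.of_bound (by fun_prop) ((∑' m, ‖a m‖) ^ 2) (ae_of_all _ fun θ => ?_)
    rw [Real.norm_of_nonneg (by positivity)]
    have := hb θ
    gcongr
  have h1 : ∫⁻ θ, ‖F θ‖ₑ ^ 2 ∂arc = ENNReal.ofReal (∫ θ, ‖F θ‖ ^ 2 ∂arc) := by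
    rw [ofReal_integral_eq_lintegral_ofReal hint (ae_of_all _ fun _ => by positivity)]
    simp [ENNReal.ofReal_pow]
  have h2 := Complex.hasSum_re (parseval ha ha)
  have e1 : (∫ θ, conj (F θ) * F θ ∂arc).re = ∫ θ, ‖F θ‖ ^ 2 ∂arc := by
    have : (fun θ => conj (F θ) * F θ) = fun θ => ((‖F θ‖ ^ 2 : ℝ) : ℂ) := by
      funext θ
      rw [← Complex.normSq_eq_conj_mul_self, Complex.normSq_eq_norm_sq]
    rw [this, integral_complex_ofReal, Complex.ofReal_re]
  have e2 : (fun m => (((2 * Real.pi : ℝ) : ℂ) * (conj (a m) * a m)).re) =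
      fun m => 2 * Real.pi * ‖a m‖ ^ 2 := by
    funext m
    rw [← Complex.normSq_eq_conj_mul_self, Complex.normSq_eq_norm_sq, ← Complex.ofReal_mul,
      Complex.ofReal_re]
  rw [e1, e2] at h2
  rw [h1, ← h2.tsum_eq, ENNReal.ofReal_tsum_of_nonneg (fun m => by positivity) h2.summable,
    ← ENNReal.tsum_mul_left]
  congr 1
  funext m
  rw [ENNReal.ofReal_mul (by positivity), ENNReal.ofReal_pow (norm_nonneg _), ofReal_norm]

theorem arc_univ : arc univ = ENNReal.ofReal (2 * Real.pi) := by
  simp [arc]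

/-- Parseval's identity for the expansion of a function along circles. -/
theorem lintegral_norm_sq_eq_tsum {d : ℕ} {s : ℝ} {f : Cd d → ℂ} (hf : Measurable f)
    {a : ℕ → Cd d → ℂ} (hm : ∀ m, Measurable (a m))
    (ha : ∀ z ∈ unitBall d, ∀ θ, HasSum (fun m => a m z * cis θ ^ m) (f (cis θ • z))) :
    ∫⁻ z, ‖f z‖ₑ ^ 2 ∂mu d s = ∑' m, ∫⁻ z, ‖a m z‖ₑ ^ 2 ∂mu d s := by
  have hG : Measurable fun z => ‖f z‖ₑ ^ 2 := by fun_prop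
  have h0 : ENNReal.ofReal (2 * Real.pi) ≠ 0 := by
    simp [Real.pi_pos]
  have h1 : ∫⁻ θ, ∫⁻ z, ‖f (cis θ • z)‖ₑ ^ 2 ∂mu d s ∂arc =
      ENNReal.ofReal (2 * Real.pi) * ∫⁻ z, ‖f z‖ₑ ^ 2 ∂mu d s := by
    have (θ : ℝ) : ∫⁻ z, ‖f (cis θ • z)‖ₑ ^ 2 ∂mu d s = ∫⁻ z, ‖f z‖ₑ ^ 2 ∂mu d s :=
      (measurePreserving_smul_mu d s (norm_cis θ)).lintegral_comp hG
    simp only [this, lintegral_const, arc_univ, mul_comm]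
  have hcont : Continuous fun p : ℝ × Cd d => cis p.1 • p.2 := by
    have := continuous_cis
    fun_prop
  have h2 : ∫⁻ θ, ∫⁻ z, ‖f (cis θ • z)‖ₑ ^ 2 ∂mu d s ∂arc =
      ∫⁻ z, ∫⁻ θ, ‖f (cis θ • z)‖ₑ ^ 2 ∂arc ∂mu d s :=
    lintegral_lintegral_swap (f := fun θ z => ‖f (cis θ • z)‖ₑ ^ 2)
      (hG.comp hcont.measurable).aemeasurable
  have h3 : ∫⁻ z, ∫⁻ θ, ‖f (cis θ • z)‖ₑ ^ 2 ∂arc ∂mu d s =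
      ENNReal.ofReal (2 * Real.pi) * ∑' m, ∫⁻ z, ‖a m z‖ₑ ^ 2 ∂mu d s := by
    rw [← lintegral_tsum fun m => by have := hm m; fun_prop, ← lintegral_const_mul _
      (by fun_prop)]
    refine lintegral_congr_ae ?_
    filter_upwards [ae_mem_unitBall d s] with z hz
    exact lintegral_circle (ha z hz)
  rw [← h2, h1] at h3
  exact (ENNReal.mul_right_inj h0 ENNReal.ofReal_ne_top).1 h3

theorem sliceCoeff_eq_of_hasFPowerSeriesAt {d : ℕ} {f : Hol d}
    {p : FormalMultilinearSeries ℂ (Cd d) ℂ} (hp : HasFPowerSeriesAt (f : Cd d → ℂ) p 0)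
    (z : Cd d) (m : ℕ) : sliceCoeff f z m = p m fun _ => z := by
  obtain ⟨r, hr⟩ := hp
  let u : ℂ →L[ℂ] Cd d := (1 : ℂ →L[ℂ] ℂ).smulRight z
  have hr' : HasFPowerSeriesOnBall (f : Cd d → ℂ) p (u 0) r := by simpa using hr
  have h := hr'.compContinuousLinearMap.factorial_smul 1 m
  rw [← iteratedDeriv_eq_iteratedFDeriv] at h
  have h1 : (f : Cd d → ℂ) ∘ u = fun ζ : ℂ => (f : Cd d → ℂ) (ζ • z) := by
    funext ζ
    simp [u]
  have h2 : (p.compContinuousLinearMap u m fun _ => (1 : ℂ)) = p m fun _ => z := by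
    rw [FormalMultilinearSeries.compContinuousLinearMap_apply]
    congr 1
    funext i
    simp [u]
  rw [h1, h2, nsmul_eq_mul] at h
  rw [sliceCoeff, ← h, inv_mul_cancel_left₀ (by exact_mod_cast m.factorial_ne_zero)]

theorem zero_mem_unitBall (d : ℕ) : (0 : Cd d) ∈ unitBall d := by simp [unitBall]

theorem exists_sliceCoeff_eq_sum {d : ℕ} (f : Hol d) (m : ℕ) :
    ∃ a : (Fin m → Fin d) → ℂ, ∀ z, sliceCoeff f z m = ∑ σ, a σ * wordMonomial σ z := by
  obtain ⟨p, hp⟩ := f.2.1 0 (zero_mem_unitBall d)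
  refine ⟨fun σ => p m fun i => EuclideanSpace.single (σ i) 1, fun z => ?_⟩
  rw [sliceCoeff_eq_of_hasFPowerSeriesAt hp]
  have h : z = ∑ j, z j • EuclideanSpace.single j (1 : ℂ) := by
    ext i
    simp [Finset.sum_apply, Pi.single_apply]
  have h1 : (p m fun _ => z) = p m fun _ => ∑ j, z j • EuclideanSpace.single j (1 : ℂ) := by
    rw [← h]
  rw [h1, ContinuousMultilinearMap.map_sum]
  refine Finset.sum_congr rfl fun σ _ => ?_
  rw [ContinuousMultilinearMap.map_smul_univ, smul_eq_mul, mul_comm]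
  rfl

theorem continuous_wordMonomial {d m : ℕ} (σ : Fin m → Fin d) : Continuous (wordMonomial σ) := by
  unfold wordMonomial
  fun_prop

theorem measurable_sliceCoeff {d : ℕ} (f : Hol d) (m : ℕ) :
    Measurable fun z => sliceCoeff f z m := by
  obtain ⟨a, ha⟩ := exists_sliceCoeff_eq_sum f m
  simp only [ha]
  have h (σ : Fin m → Fin d) := continuous_wordMonomial σ
  exact Continuous.measurable (by fun_prop)

theorem lintegral_hol {d : ℕ} (s : ℝ) (f : Hol d) :
    ∫⁻ z, ‖(f : Cd d → ℂ) z‖ₑ ^ 2 ∂mu d s = ∑' m, ∫⁻ z, ‖sliceCoeff f z m‖ₑ ^ 2 ∂mu d s :=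
  lintegral_norm_sq_eq_tsum (Hol.measurable f) (measurable_sliceCoeff f) fun _ hz θ =>
    hasSum_slice f hz θ

theorem sliceCoeff_numberOp_pow {d : ℕ} (f : Hol d) {z : Cd d} (hz : z ∈ unitBall d) (k m : ℕ) :
    sliceCoeff ((numberOp d ^ k) f) z m = (m : ℂ) ^ k * sliceCoeff f z m := by
  induction k with
  | zero => simp
  | succ k ih =>
    rw [pow_succ', Module.End.mul_apply, sliceCoeff_numberOp _ hz, ih]
    ring

/-- The weight of degree `m` in `sobolevForm`. -/
def sobolevWeight (lam : ℝ) (n m : ℕ) : ℝ := shiftEigen (lam + n) n m * shiftEigen lam n m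

theorem one_le_sobolevWeight {lam : ℝ} (hlam : 0 < lam) (n m : ℕ) : 1 ≤ sobolevWeight lam n m :=
  one_le_mul_of_one_le_of_one_le (one_le_shiftEigen (by positivity) n m)
    (one_le_shiftEigen hlam n m)

theorem mem_sobolevSubmodule_of_tsum {d : ℕ} {lam : ℝ} (hlam : 0 < lam) {n : ℕ} {f : Hol d}
    (h : ∑' m, ENNReal.ofReal (sobolevWeight lam n m) *
      ∫⁻ z, ‖sliceCoeff f z m‖ₑ ^ 2 ∂mu d (lam + 2 * n) < ⊤) :
    f ∈ sobolevSubmodule d lam n := by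
  intro k hk
  obtain ⟨C₁, hC₁, h₁⟩ := exists_pow_le_shiftEigen (show 0 < lam + n by positivity) n
  obtain ⟨C₂, hC₂, h₂⟩ := exists_pow_le_shiftEigen hlam n
  refine ⟨(Hol.measurable _).aestronglyMeasurable, ?_⟩
  rw [eLpNorm_lt_top_iff_lintegral_rpow_enorm_lt_top two_ne_zero ENNReal.ofNat_ne_top]
  simp only [ENNReal.toReal_ofNat, ENNReal.rpow_two]
  rw [lintegral_hol]
  have hle (m : ℕ) : ∫⁻ z, ‖sliceCoeff ((numberOp d ^ k) f) z m‖ₑ ^ 2 ∂mu d (lam + 2 * n) ≤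
      ENNReal.ofReal (C₁ * C₂) * (ENNReal.ofReal (sobolevWeight lam n m) *
      ∫⁻ z, ‖sliceCoeff f z m‖ₑ ^ 2 ∂mu d (lam + 2 * n)) := by
    have e : ∫⁻ z, ‖sliceCoeff ((numberOp d ^ k) f) z m‖ₑ ^ 2 ∂mu d (lam + 2 * n) =
        ENNReal.ofReal ((m : ℝ) ^ k * (m : ℝ) ^ k) *
          ∫⁻ z, ‖sliceCoeff f z m‖ₑ ^ 2 ∂mu d (lam + 2 * n) := by
      rw [← lintegral_const_mul _ (by have := measurable_sliceCoeff f m; fun_prop)]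
      refine lintegral_congr_ae ?_
      filter_upwards [ae_mem_unitBall d _] with z hz
      rw [sliceCoeff_numberOp_pow f hz, enorm_mul, mul_pow, ← pow_two, ENNReal.ofReal_pow
        (by positivity)]
      congr 2
      rw [← ofReal_norm, norm_pow, Complex.norm_natCast]
    rw [e, ← mul_assoc, ← ENNReal.ofReal_mul (by positivity)]
    refine mul_le_mul_left (ENNReal.ofReal_le_ofReal ?_) _
    calc (m : ℝ) ^ k * (m : ℝ) ^ k
        ≤ (C₁ * shiftEigen (lam + n) n m) * (C₂ * shiftEigen lam n m) := by
          have := one_le_shiftEigen (show 0 < lam + n by positivity) n m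
          gcongr
          · exact h₁ k hk m
          · exact h₂ k hk m
      _ = _ := by
        rw [sobolevWeight]
        ring
  refine (ENNReal.tsum_le_tsum hle).trans_lt ?_
  rw [ENNReal.tsum_mul_left]
  exact ENNReal.mul_lt_top ENNReal.ofReal_lt_top h

/-- The monomial of a word, as a holomorphic function on the ball. -/
def wordHol {d m : ℕ} (σ : Fin m → Fin d) : Hol d :=
  ⟨(unitBall d).indicator (wordMonomial σ), by
    refine ⟨AnalyticOnNhd.congr (f := wordMonomial σ) (isOpen_unitBall d) (fun z _ => ?_)
      fun z hz => (indicator_of_mem hz _).symm, fun z hz => indicator_of_notMem hz _⟩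
    unfold wordMonomial
    exact Finset.analyticAt_fun_prod _ fun i _ =>
      (EuclideanSpace.proj (𝕜 := ℂ) (σ i) : Cd d →L[ℂ] ℂ).analyticAt z⟩

theorem wordHol_apply {d m : ℕ} (σ : Fin m → Fin d) {z : Cd d} (hz : z ∈ unitBall d) :
    (wordHol σ : Cd d → ℂ) z = wordMonomial σ z := indicator_of_mem hz _

theorem sliceCoeff_wordHol {d m : ℕ} (σ : Fin m → Fin d) {z : Cd d} (hz : z ∈ unitBall d)
    (k : ℕ) : sliceCoeff (wordHol σ) z k = if k = m then wordMonomial σ z else 0 := by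
  obtain ⟨r, hr1, hr⟩ := exists_radius hz
  have h0 : (0 : ℂ) ∈ Metric.ball (0 : ℂ) r := Metric.mem_ball_self (by linarith)
  have hn := Metric.isOpen_ball.mem_nhds h0
  have heq : (fun ζ : ℂ => (wordHol σ : Cd d → ℂ) (ζ • z)) =ᶠ[nhds 0]
      fun ζ => wordMonomial σ z * ζ ^ m := by
    filter_upwards [hn] with ζ hζ
    rw [wordHol_apply σ (hr ζ hζ), wordMonomial_smul, mul_comm]
  rw [sliceCoeff, heq.iteratedDeriv_eq k, iteratedDeriv_const_mul_field,
    iteratedDeriv_fun_pow_zero]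
  split_ifs with hkm
  · have : (k.factorial : ℂ) ≠ 0 := by exact_mod_cast k.factorial_ne_zero
    subst hkm
    field_simp
  · simp

/-- `sliceCoeff · z m` as a linear functional. -/
def sliceCoeffLin {d : ℕ} {z : Cd d} (hz : z ∈ unitBall d) (m : ℕ) : Hol d →ₗ[ℂ] ℂ where
  toFun f := sliceCoeff f z m
  map_add' f g := sliceCoeff_add f g hz m
  map_smul' c f := sliceCoeff_smul c f z m


theorem integrable_mu_of_continuous {d : ℕ} {s : ℝ} (hs : (d : ℝ) < s) {F : Cd d → ℂ}
    (hF : Continuous F) : Integrable F (mu d s) := by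
  have := isFiniteMeasure_mu hs
  obtain ⟨C, hC⟩ := (isCompact_closedBall (0 : Cd d) 1).exists_bound_of_continuousOn
    hF.continuousOn
  refine Integrable.of_bound hF.aestronglyMeasurable C ?_
  filter_upwards [ae_mem_unitBall d s] with z hz
  exact hC z (Metric.ball_subset_closedBall hz)

theorem binomCoeff_mul_sobolevWeight {lam : ℝ} (hlam : 0 < lam) (n m : ℕ) :
    sobolevWeight lam n m * binomCoeff lam m *
      (m.factorial / risingFactorial (lam + 2 * n) m) = 1 := by
  have h1 := (risingFactorial_pos hlam m).ne'
  have h2 := (risingFactorial_pos (show 0 < lam + 2 * n by positivity) m).ne'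
  have h3 : (m.factorial : ℝ) ≠ 0 := by positivity
  rw [sobolevWeight, shiftEigen_mul_shiftEigen hlam, binomCoeff]
  field_simp

/-- Finite words in the letters `Fin d`. -/
abbrev Word (d : ℕ) : Type := Σ m, Fin m → Fin d

/-- The normalized monomials, as functions on `ℂ^d`. -/
def framePoly (lam : ℝ) {d : ℕ} (σ : Word d) (z : Cd d) : ℂ :=
  (√(binomCoeff lam σ.1) : ℝ) * wordMonomial σ.2 z

theorem continuous_framePoly (lam : ℝ) {d : ℕ} (σ : Word d) :
    Continuous (framePoly lam σ) := by
  have := continuous_wordMonomial σ.2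
  unfold framePoly
  fun_prop

theorem framePoly_smul (lam : ℝ) {d : ℕ} (σ : Word d) (c : ℂ) (z : Cd d) :
    framePoly lam σ (c • z) = c ^ σ.1 * framePoly lam σ z := by
  rw [framePoly, framePoly, wordMonomial_smul]
  ring

theorem sum_conj_framePoly_mul {lam : ℝ} (hlam : 0 < lam) {d : ℕ} (m : ℕ) (w z : Cd d) :
    ∑ σ : Fin m → Fin d, conj (framePoly lam ⟨m, σ⟩ w) * framePoly lam ⟨m, σ⟩ z =
      binomCoeff lam m * inner ℂ w z ^ m := by
  rw [← sum_conj_wordMonomial_mul, Finset.mul_sum]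
  refine Finset.sum_congr rfl fun σ _ => ?_
  have h := Real.mul_self_sqrt (binomCoeff_pos hlam m).le
  have h' : ((√(binomCoeff lam m) : ℝ) : ℂ) * ((√(binomCoeff lam m) : ℝ) : ℂ) =
      binomCoeff lam m := by exact_mod_cast h
  simp only [framePoly, map_mul, Complex.conj_ofReal]
  linear_combination conj (wordMonomial σ w) * wordMonomial σ z * h'

theorem inner_self_eq_ofReal {E : Type*} [NormedAddCommGroup E] [InnerProductSpace ℂ E] (x : E) :
    inner ℂ x x = ((‖x‖ ^ 2 : ℝ) : ℂ) := by
  rw [inner_self_eq_norm_sq_to_K]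
  push_cast
  rfl

theorem conj_mul_self_eq_ofReal (x : ℂ) : conj x * x = ((‖x‖ ^ 2 : ℝ) : ℂ) := by
  rw [← Complex.normSq_eq_conj_mul_self, Complex.normSq_eq_norm_sq]

theorem sum_norm_framePoly_sq {lam : ℝ} (hlam : 0 < lam) {d : ℕ} (m : ℕ) (z : Cd d) :
    ∑ σ : Fin m → Fin d, ‖framePoly lam ⟨m, σ⟩ z‖ ^ 2 = binomCoeff lam m * (‖z‖ ^ 2) ^ m := by
  have h := sum_conj_framePoly_mul hlam m z z
  rw [inner_self_eq_ofReal] at h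
  have e : ∀ σ : Fin m → Fin d, conj (framePoly lam ⟨m, σ⟩ z) * framePoly lam ⟨m, σ⟩ z =
      ((‖framePoly lam ⟨m, σ⟩ z‖ ^ 2 : ℝ) : ℂ) := fun σ => by
    rw [← Complex.normSq_eq_conj_mul_self, Complex.normSq_eq_norm_sq]
  simp only [e] at h
  exact_mod_cast h

theorem hasSum_word {d : ℕ} {g : Word d → ℝ} (hg : ∀ σ, 0 ≤ g σ) {S : ℝ}
    (h : HasSum (fun m => ∑ σ : Fin m → Fin d, g ⟨m, σ⟩) S) : HasSum g S := by
  have hs : Summable g := by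
    rw [summable_sigma_of_nonneg hg]
    refine ⟨fun m => (hasSum_fintype _).summable, ?_⟩
    simpa only [tsum_fintype] using h.summable
  have h2 := hs.hasSum.sigma fun m => hasSum_fintype fun σ : Fin m → Fin d => g ⟨m, σ⟩
  rw [← h2.unique h]
  exact hs.hasSum

theorem norm_sq_lt_one {d : ℕ} {z : Cd d} (hz : z ∈ unitBall d) : |‖z‖ ^ 2| < 1 := by
  rw [abs_of_nonneg (by positivity)]
  linarith [one_sub_norm_sq_pos hz]

theorem hasSum_norm_framePoly_sq {lam : ℝ} (hlam : 0 < lam) {d : ℕ} {z : Cd d}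
    (hz : z ∈ unitBall d) :
    HasSum (fun σ : Word d => ‖framePoly lam σ z‖ ^ 2) ((1 - ‖z‖ ^ 2) ^ (-lam)) := by
  refine hasSum_word (fun _ => by positivity) ?_
  simp only [sum_norm_framePoly_sq hlam]
  exact hasSum_binomCoeff hlam (norm_sq_lt_one hz)

/-- The normalized monomials, as holomorphic functions on the ball. -/
def frameHol (lam : ℝ) {d : ℕ} (σ : Word d) : Hol d :=
  ((√(binomCoeff lam σ.1) : ℝ) : ℂ) • wordHol σ.2

theorem frameHol_apply (lam : ℝ) {d : ℕ} (σ : Word d) {z : Cd d} (hz : z ∈ unitBall d) :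
    (frameHol lam σ : Cd d → ℂ) z = framePoly lam σ z := by
  change _ * (wordHol σ.2 : Cd d → ℂ) z = _
  rw [wordHol_apply _ hz, framePoly]

theorem sliceCoeff_frameHol (lam : ℝ) {d : ℕ} (σ : Word d) {z : Cd d} (hz : z ∈ unitBall d)
    (k : ℕ) : sliceCoeff (frameHol lam σ) z k = if k = σ.1 then framePoly lam σ z else 0 := by
  rw [frameHol, sliceCoeff_smul, sliceCoeff_wordHol _ hz, framePoly]
  split_ifs <;> simp

theorem frameHol_mem {d : ℕ} {lam : ℝ} (hlam : 0 < lam) {n : ℕ} (hn : (d : ℝ) < lam + 2 * n)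
    (σ : Word d) : frameHol lam σ ∈ sobolevSubmodule d lam n := by
  refine mem_sobolevSubmodule_of_tsum hlam ?_
  rw [tsum_eq_single σ.1]
  · refine ENNReal.mul_lt_top ENNReal.ofReal_lt_top ?_
    have h : ∫⁻ z, ‖sliceCoeff (frameHol lam σ) z σ.1‖ₑ ^ 2 ∂mu d (lam + 2 * n) =
        ∫⁻ z, ‖framePoly lam σ z ^ 2‖ₑ ∂mu d (lam + 2 * n) := by
      refine lintegral_congr_ae ?_
      filter_upwards [ae_mem_unitBall d _] with z hz
      rw [sliceCoeff_frameHol lam σ hz, if_pos rfl, enorm_pow]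
    rw [h]
    have hc : Continuous fun z => framePoly lam σ z ^ 2 := (continuous_framePoly lam σ).pow 2
    exact (integrable_mu_of_continuous hn hc).2
  · intro m hm
    refine mul_eq_zero_of_right _ ((lintegral_congr_ae ?_).trans lintegral_zero)
    filter_upwards [ae_mem_unitBall d _] with z hz
    rw [sliceCoeff_frameHol lam σ hz, if_neg hm]
    simp

theorem hol_ext {d : ℕ} {f g : Hol d}
    (h : ∀ z ∈ unitBall d, ∀ m, sliceCoeff f z m = sliceCoeff g z m) : f = g := by
  ext z
  by_cases hz : z ∈ unitBall d
  · have h1 := hasSum_slice f hz 0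
    have h2 := hasSum_slice g hz 0
    simp only [h z hz] at h1
    have h3 := h1.unique h2
    simpa [cis] using h3
  · rw [f.2.2 z hz, g.2.2 z hz]

section Frame

variable {d : ℕ} {lam : ℝ} {n : ℕ} {hlam : 0 < lam} {hn : (d : ℝ) < lam + 2 * n}

/-- The normalized monomials, as elements of `H(𝔹^d, lam)`. -/
def frame (σ : Word d) : GenBergman d lam n hlam hn :=
  ⟨frameHol lam σ, frameHol_mem hlam hn σ⟩

theorem frame_toHol (σ : Word d) :
    (frame σ : GenBergman d lam n hlam hn).toHol = frameHol lam σ := rfl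

theorem inner_eq_integral_tsum (f g : GenBergman d lam n hlam hn) :
    inner ℂ f g = ∫ z, ∑' m, (sobolevWeight lam n m : ℂ) *
      (conj (sliceCoeff f.toHol z m) * sliceCoeff g.toHol z m) ∂mu d (lam + 2 * n) := by
  apply mul_left_cancel₀ two_pi_ne_zero
  rw [GenBergman.inner_def, sobolevForm_average f.mem g.mem, ← integral_const_mul]
  congr 1
  funext z
  rw [← tsum_mul_left]
  congr 1
  funext m
  rw [sobolevWeight]
  push_cast
  ring

theorem inner_frame (σ : Word d) (f : GenBergman d lam n hlam hn) :
    inner ℂ (frame σ) f = sobolevWeight lam n σ.1 *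
      ∫ z, conj (framePoly lam σ z) * sliceCoeff f.toHol z σ.1 ∂mu d (lam + 2 * n) := by
  rw [inner_eq_integral_tsum, ← integral_const_mul]
  refine integral_congr_ae ?_
  filter_upwards [ae_mem_unitBall d _] with z hz
  rw [tsum_eq_single σ.1]
  · rw [frame_toHol, sliceCoeff_frameHol lam σ hz, if_pos rfl]
  · intro m hm
    rw [frame_toHol, sliceCoeff_frameHol lam σ hz, if_neg hm]
    simp

theorem continuous_sliceCoeff (f : Hol d) (m : ℕ) : Continuous fun z => sliceCoeff f z m := by
  obtain ⟨a, ha⟩ := exists_sliceCoeff_eq_sum f m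
  simp only [ha]
  have h (σ : Fin m → Fin d) := continuous_wordMonomial σ
  fun_prop

theorem integral_inner_pow_mul_sliceCoeff {s : ℝ} (hs : (d : ℝ) < s) (f : Hol d) (m : ℕ)
    (w : Cd d) : ∫ z, conj (inner ℂ w z ^ m) * sliceCoeff f z m ∂mu d s =
      ((m.factorial / risingFactorial s m : ℝ) : ℂ) * sliceCoeff f w m := by
  obtain ⟨a, ha⟩ := exists_sliceCoeff_eq_sum f m
  simp only [ha, Finset.mul_sum]
  rw [integral_finsetSum]
  · refine Finset.sum_congr rfl fun τ _ => ?_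
    rw [mul_left_comm, ← integral_mu_inner_pow hs, ← integral_const_mul]
    congr 1
    funext z
    ring
  · intro τ _
    have h := continuous_wordMonomial τ
    exact integrable_mu_of_continuous hs (by fun_prop)

theorem sum_inner_frame_mul (f : GenBergman d lam n hlam hn) (m : ℕ) (w : Cd d) :
    ∑ σ : Fin m → Fin d, inner ℂ (frame ⟨m, σ⟩) f * framePoly lam ⟨m, σ⟩ w =
      sliceCoeff f.toHol w m := by
  have h1 : ∑ σ : Fin m → Fin d, inner ℂ (frame ⟨m, σ⟩) f * framePoly lam ⟨m, σ⟩ w =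
      sobolevWeight lam n m * ∫ z, ∑ σ : Fin m → Fin d, framePoly lam ⟨m, σ⟩ w *
        (conj (framePoly lam ⟨m, σ⟩ z) * sliceCoeff f.toHol z m) ∂mu d (lam + 2 * n) := by
    rw [integral_finsetSum, Finset.mul_sum]
    · refine Finset.sum_congr rfl fun σ _ => ?_
      rw [inner_frame, integral_const_mul]
      ring
    · intro σ _
      have h1 := continuous_framePoly lam (⟨m, σ⟩ : Word d)
      have h2 := continuous_sliceCoeff f.toHol m
      exact integrable_mu_of_continuous hn (by fun_prop)
  have h2 (z : Cd d) : ∑ σ : Fin m → Fin d, framePoly lam ⟨m, σ⟩ w *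
        (conj (framePoly lam ⟨m, σ⟩ z) * sliceCoeff f.toHol z m) =
      binomCoeff lam m * (conj (inner ℂ w z ^ m) * sliceCoeff f.toHol z m) := by
    rw [← mul_assoc]
    have := congrArg conj (sum_conj_framePoly_mul hlam m w z)
    rw [map_mul, Complex.conj_ofReal] at this
    rw [← this, map_sum, Finset.sum_mul]
    refine Finset.sum_congr rfl fun σ _ => ?_
    rw [map_mul, Complex.conj_conj]
    ring
  simp only [h2] at h1
  rw [h1, integral_const_mul, integral_inner_pow_mul_sliceCoeff hn]
  have h3 := binomCoeff_mul_sobolevWeight hlam n m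
  have h3' : (sobolevWeight lam n m : ℂ) * binomCoeff lam m *
      ((m.factorial / risingFactorial (lam + 2 * n) m : ℝ) : ℂ) = 1 := by
    rw [← Complex.ofReal_mul, ← Complex.ofReal_mul, h3, Complex.ofReal_one]
  linear_combination sliceCoeff f.toHol w m * h3'

theorem sobolevWeight_mul_integral_eq (f : GenBergman d lam n hlam hn) (m : ℕ) :
    sobolevWeight lam n m * ∫ z, ‖sliceCoeff f.toHol z m‖ ^ 2 ∂mu d (lam + 2 * n) =
      ∑ σ : Fin m → Fin d, ‖inner ℂ (frame ⟨m, σ⟩) f‖ ^ 2 := by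
  have h2 := continuous_sliceCoeff f.toHol m
  have h (σ : Fin m → Fin d) : ((‖inner ℂ (frame ⟨m, σ⟩) f‖ ^ 2 : ℝ) : ℂ) =
      sobolevWeight lam n m * ∫ z, conj (inner ℂ (frame ⟨m, σ⟩) f * framePoly lam ⟨m, σ⟩ z) *
        sliceCoeff f.toHol z m ∂mu d (lam + 2 * n) := by
    rw [← Complex.normSq_eq_norm_sq, Complex.normSq_eq_conj_mul_self]
    nth_rw 2 [inner_frame]
    rw [mul_left_comm, ← integral_const_mul]
    simp only [map_mul, mul_assoc]
  have e : ((sobolevWeight lam n m *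
      ∫ z, ‖sliceCoeff f.toHol z m‖ ^ 2 ∂mu d (lam + 2 * n) : ℝ) : ℂ) =
      ((∑ σ : Fin m → Fin d, ‖inner ℂ (frame ⟨m, σ⟩) f‖ ^ 2 : ℝ) : ℂ) := by
    rw [Complex.ofReal_sum]
    simp only [h]
    rw [← Finset.mul_sum, ← integral_finsetSum]
    · rw [Complex.ofReal_mul, ← integral_complex_ofReal]
      congr 2
      funext z
      rw [← Finset.sum_mul, ← map_sum, sum_inner_frame_mul, ← Complex.normSq_eq_conj_mul_self,
        Complex.normSq_eq_norm_sq]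
    · intro σ _
      have h1 := continuous_framePoly lam (⟨m, σ⟩ : Word d)
      exact integrable_mu_of_continuous hn (by fun_prop)
  exact_mod_cast e

theorem hasSum_norm_sq (f : GenBergman d lam n hlam hn) :
    HasSum (fun m => sobolevWeight lam n m *
      ∫ z, ‖sliceCoeff f.toHol z m‖ ^ 2 ∂mu d (lam + 2 * n)) (‖f‖ ^ 2) := by
  set ν := mu d (lam + 2 * n)
  let G : ℕ → Cd d → ℝ := fun m z => sobolevWeight lam n m * ‖sliceCoeff f.toHol z m‖ ^ 2
  have hG0 (m : ℕ) (z : Cd d) : 0 ≤ G m z := by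
    have := one_le_sobolevWeight hlam n m
    positivity
  have hGi (m : ℕ) : Integrable (G m) ν := by
    have h2 := continuous_sliceCoeff f.toHol m
    have h3 : Continuous fun z => (sliceCoeff f.toHol z m) ^ 2 := by fun_prop
    have h4 := (integrable_mu_of_continuous hn h3).norm
    simp only [norm_pow] at h4
    exact h4.const_mul _
  have hcirc : ∀ z ∈ unitBall d, HasSum (fun m => G m z) ((2 * Real.pi)⁻¹ *
      (∫ θ, conj ((shiftProd d (lam + n) n f.toHol : Cd d → ℂ) (cis θ • z)) *
        (shiftProd d lam n f.toHol : Cd d → ℂ) (cis θ • z) ∂arc).re) := by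
    intro z hz
    have h := (Complex.hasSum_re (hasSum_circle (lam + n) lam n f.toHol f.toHol hz)).mul_left
      (2 * Real.pi)⁻¹
    have e : (fun m => G m z) = fun m => (2 * Real.pi)⁻¹ *
        ((((2 * Real.pi) * (shiftEigen (lam + n) n m * shiftEigen lam n m) : ℝ) : ℂ) *
          (conj (sliceCoeff f.toHol z m) * sliceCoeff f.toHol z m)).re := by
      funext m
      rw [conj_mul_self_eq_ofReal, ← Complex.ofReal_mul, Complex.ofReal_re]
      have := Real.pi_ne_zero
      simp only [G, sobolevWeight]
      field_simp
    rw [e]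
    exact h
  have hint : Integrable (fun z => ∑' m, G m z) ν := by
    have h := ((integrable_average (integrable_form (lam + n) lam f.mem f.mem)).re).const_mul
      (2 * Real.pi)⁻¹
    refine h.congr ?_
    filter_upwards [ae_mem_unitBall d _] with z hz
    exact (hcirc z hz).tsum_eq.symm
  have hsum : Summable fun m => ∫ z, G m z ∂ν := by
    refine summable_of_sum_le (c := ∫ z, ∑' m, G m z ∂ν)
      (fun m => integral_nonneg (hG0 m)) fun u => ?_
    rw [← integral_finsetSum _ fun m _ => hGi m]
    refine integral_mono_ae (integrable_finsetSum _ fun m _ => hGi m) hint ?_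
    filter_upwards [ae_mem_unitBall d _] with z hz
    exact (hcirc z hz).summable.sum_le_tsum _ fun m _ => hG0 m z
  have key := hasSum_integral_of_summable_integral_norm hGi (by
    simpa only [Real.norm_of_nonneg (hG0 _ _)] using hsum)
  have e : ∫ z, ∑' m, G m z ∂ν = ‖f‖ ^ 2 := by
    have h1 := inner_eq_integral_tsum f f
    rw [inner_self_eq_ofReal] at h1
    have h2 : ∀ z, ∑' m, (sobolevWeight lam n m : ℂ) *
        (conj (sliceCoeff f.toHol z m) * sliceCoeff f.toHol z m) = ((∑' m, G m z : ℝ) : ℂ) := by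
      intro z
      rw [Complex.ofReal_tsum]
      congr 1
      funext m
      rw [← Complex.normSq_eq_conj_mul_self, Complex.normSq_eq_norm_sq, ← Complex.ofReal_mul]
    simp only [h2] at h1
    rw [integral_complex_ofReal] at h1
    exact (Complex.ofReal_injective h1).symm
  rw [e] at key
  simpa only [G, integral_const_mul] using key

/-- The normalized monomials form a Parseval frame. -/
theorem hasSum_norm_inner_frame_sq (f : GenBergman d lam n hlam hn) :
    HasSum (fun σ : Word d => ‖inner ℂ (frame σ) f‖ ^ 2) (‖f‖ ^ 2) := by
  refine hasSum_word (fun _ => by positivity) ?_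
  simpa only [sobolevWeight_mul_integral_eq] using hasSum_norm_sq f

end Frame


section Synthesis

variable {d : ℕ}

theorem norm_sum_mul_le_sqrt {ι : Type*} (s : Finset ι) (f g : ι → ℂ) :
    ‖∑ i ∈ s, f i * g i‖ ≤ √(∑ i ∈ s, ‖f i‖ ^ 2) * √(∑ i ∈ s, ‖g i‖ ^ 2) := by
  refine (norm_sum_le _ _).trans ?_
  simp only [norm_mul]
  exact Real.sum_mul_le_sqrt_mul_sqrt s _ _

/-- The multilinear form with coefficients `a` on words of length `m`. -/
def wordForm {m : ℕ} (a : (Fin m → Fin d) → ℂ) :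
    ContinuousMultilinearMap ℂ (fun _ : Fin m => Cd d) ℂ :=
  ∑ σ, a σ • (ContinuousMultilinearMap.mkPiAlgebra ℂ (Fin m) ℂ).compContinuousLinearMap
    fun i => (EuclideanSpace.proj (σ i) : Cd d →L[ℂ] ℂ)

theorem wordForm_apply {m : ℕ} (a : (Fin m → Fin d) → ℂ) (v : Fin m → Cd d) :
    wordForm a v = ∑ σ, a σ * ∏ i, v i (σ i) := by
  simp [wordForm]

theorem norm_wordForm_le {m : ℕ} (a : (Fin m → Fin d) → ℂ) :
    ‖wordForm a‖ ≤ √(∑ σ, ‖a σ‖ ^ 2) := by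
  refine ContinuousMultilinearMap.opNorm_le_bound (Real.sqrt_nonneg _) fun v => ?_
  rw [wordForm_apply]
  refine (norm_sum_mul_le_sqrt _ _ _).trans (le_of_eq ?_)
  congr 1
  have h : ∑ σ : Fin m → Fin d, ‖∏ i, v i (σ i)‖ ^ 2 = (∏ i, ‖v i‖) ^ 2 := by
    simp only [norm_prod, ← Finset.prod_pow, EuclideanSpace.norm_sq_eq]
    rw [Finset.prod_univ_sum, Fintype.piFinset_univ]
  rw [h, Real.sqrt_sq (Finset.prod_nonneg fun _ _ => norm_nonneg _)]

theorem exists_hol_of_wordForm {a : ∀ m, (Fin m → Fin d) → ℂ}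
    (ha : ∀ r : ℝ, 0 ≤ r → r < 1 → ∃ C, ∀ m, √(∑ σ, ‖a m σ‖ ^ 2) * r ^ m ≤ C) :
    ∃ f : Hol d, ∀ z m, sliceCoeff f z m = ∑ σ, a m σ * wordMonomial σ z := by
  let p : FormalMultilinearSeries ℂ (Cd d) ℂ := fun m => wordForm (a m)
  have hrad : 1 ≤ p.radius := by
    refine ENNReal.le_of_forall_nnreal_lt fun r hr => ?_
    obtain ⟨C, hC⟩ := ha r r.2 (by exact_mod_cast hr)
    refine p.le_radius_of_bound C fun m => le_trans ?_ (hC m)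
    gcongr
    exact norm_wordForm_le _
  have hp := p.hasFPowerSeriesOnBall (zero_lt_one.trans_le hrad)
  have hsub : unitBall d ⊆ Metric.eball 0 p.radius := by
    intro z hz
    have hz1 : ‖z‖ < 1 := by simpa [unitBall] using hz
    have : ‖z‖ₑ < 1 := by
      rw [← ofReal_norm, ENNReal.ofReal_lt_one]
      exact hz1
    simpa using this.trans_le hrad
  let f : Hol d := ⟨(unitBall d).indicator p.sum,
    (hp.analyticOnNhd.mono hsub).congr (isOpen_unitBall d)
      fun z hz => (indicator_of_mem hz _).symm, fun z hz => indicator_of_notMem hz _⟩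
  have hf : HasFPowerSeriesAt (f : Cd d → ℂ) p 0 := by
    refine hp.hasFPowerSeriesAt.congr ?_
    filter_upwards [(isOpen_unitBall d).mem_nhds (zero_mem_unitBall d)] with z hz
    exact (indicator_of_mem hz _).symm
  refine ⟨f, fun z m => ?_⟩
  rw [sliceCoeff_eq_of_hasFPowerSeriesAt hf]
  exact wordForm_apply _ _

variable {lam : ℝ} {n : ℕ} {hlam : 0 < lam} {hn : (d : ℝ) < lam + 2 * n}

theorem norm_sum_smul_frame_sq_le (m : ℕ) (F : (Fin m → Fin d) → ℂ) :
    ‖∑ σ, F σ • (frame ⟨m, σ⟩ : GenBergman d lam n hlam hn)‖ ^ 2 ≤ ∑ σ, ‖F σ‖ ^ 2 := by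
  set g := ∑ σ, F σ • (frame ⟨m, σ⟩ : GenBergman d lam n hlam hn) with hg
  have h1 : ((‖g‖ ^ 2 : ℝ) : ℂ) = ∑ σ, F σ * inner ℂ g (frame ⟨m, σ⟩) := by
    rw [← inner_self_eq_ofReal]
    nth_rw 2 [hg]
    rw [inner_sum]
    simp only [inner_smul_right]
  have h2 := norm_sum_mul_le_sqrt Finset.univ F fun σ => inner ℂ g (frame ⟨m, σ⟩)
  rw [← h1, Complex.norm_real, Real.norm_of_nonneg (by positivity)] at h2
  have h3 : ∑ σ : Fin m → Fin d, ‖inner ℂ g (frame ⟨m, σ⟩)‖ ^ 2 ≤ ‖g‖ ^ 2 := by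
    have h := (hasSum_norm_inner_frame_sq g).summable
    have h4 := h.sum_le_tsum (Finset.univ.map (Function.Embedding.sigmaMk (β := fun m =>
      Fin m → Fin d) m)) fun σ _ => by positivity
    rw [(hasSum_norm_inner_frame_sq g).tsum_eq, Finset.sum_map] at h4
    simpa only [Function.Embedding.sigmaMk_apply, norm_inner_symm g] using h4
  have h5 : √(∑ σ : Fin m → Fin d, ‖inner ℂ g (frame ⟨m, σ⟩)‖ ^ 2) ≤ ‖g‖ :=
    (Real.sqrt_le_sqrt h3).trans_eq (Real.sqrt_sq (norm_nonneg _))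
  have h6 : ‖g‖ ^ 2 ≤ √(∑ σ, ‖F σ‖ ^ 2) * ‖g‖ := h2.trans (by gcongr)
  have h7 : ‖g‖ ≤ √(∑ σ, ‖F σ‖ ^ 2) := by
    rcases (norm_nonneg g).eq_or_lt with h | h
    · rw [← h]
      exact Real.sqrt_nonneg _
    · exact le_of_mul_le_mul_right (by rwa [← pow_two]) h
  exact (Real.le_sqrt (norm_nonneg _) (Finset.sum_nonneg fun _ _ => by positivity)).1 h7

theorem toHol_sum_smul_frame (m : ℕ) (F : (Fin m → Fin d) → ℂ) :
    (∑ σ, F σ • (frame ⟨m, σ⟩ : GenBergman d lam n hlam hn)).toHol =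
      ∑ σ, F σ • frameHol lam ⟨m, σ⟩ := by
  let φ : GenBergman d lam n hlam hn →ₗ[ℂ] Hol d := (sobolevSubmodule d lam n).subtype
  change φ _ = _
  rw [map_sum]
  rfl

/-- Every square summable family is the family of coefficients of an element of `H(𝔹^d, lam)`
in the normalized monomials. -/
theorem exists_synthesis {F : Word d → ℂ} {C : ℝ} (hF : HasSum (fun σ => ‖F σ‖ ^ 2) C) :
    ∃ f : GenBergman d lam n hlam hn, ‖f‖ ^ 2 ≤ C ∧ ∀ z m, sliceCoeff f.toHol z m =
      ∑ σ : Fin m → Fin d, F ⟨m, σ⟩ * framePoly lam ⟨m, σ⟩ z := by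
  have hFm := hF.sigma fun m => hasSum_fintype fun σ : Fin m → Fin d => ‖F ⟨m, σ⟩‖ ^ 2
  have hle (m : ℕ) : ∑ σ : Fin m → Fin d, ‖F ⟨m, σ⟩‖ ^ 2 ≤ C :=
    le_hasSum hFm m fun _ _ => Finset.sum_nonneg fun _ _ => by positivity
  let a : ∀ m, (Fin m → Fin d) → ℂ := fun m σ => F ⟨m, σ⟩ * (√(binomCoeff lam m) : ℝ)
  obtain ⟨f, hf⟩ := exists_hol_of_wordForm (a := a) (by
    intro r hr0 hr1
    have hr2 : |r ^ 2| < 1 := by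
      rw [abs_of_nonneg (by positivity)]
      nlinarith
    refine ⟨√(C * (1 - r ^ 2) ^ (-lam)), fun m => ?_⟩
    have hb := binomCoeff_pos hlam m
    have e : √(∑ σ, ‖a m σ‖ ^ 2) * r ^ m =
        √((∑ σ : Fin m → Fin d, ‖F ⟨m, σ⟩‖ ^ 2) * (binomCoeff lam m * (r ^ 2) ^ m)) := by
      have : ∑ σ, ‖a m σ‖ ^ 2 =
          (∑ σ : Fin m → Fin d, ‖F ⟨m, σ⟩‖ ^ 2) * binomCoeff lam m := by
        rw [Finset.sum_mul]
        refine Finset.sum_congr rfl fun σ _ => ?_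
        rw [norm_mul, mul_pow, Complex.norm_real, Real.norm_of_nonneg (Real.sqrt_nonneg _),
          Real.sq_sqrt hb.le]
      rw [this, ← mul_assoc, ← pow_mul, mul_comm 2 m, pow_mul,
        Real.sqrt_mul' _ (sq_nonneg (r ^ m)), Real.sqrt_sq (pow_nonneg hr0 m)]
    rw [e]
    refine Real.sqrt_le_sqrt (mul_le_mul (hle m) ?_ (by positivity) ?_)
    · exact le_hasSum (hasSum_binomCoeff hlam hr2) m fun k _ => by
        have := binomCoeff_pos hlam k
        positivity
    · exact (Finset.sum_nonneg fun _ _ => by positivity).trans (hle 0))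
  have hf' (z : Cd d) (m : ℕ) : sliceCoeff f z m =
      ∑ σ : Fin m → Fin d, F ⟨m, σ⟩ * framePoly lam ⟨m, σ⟩ z := by
    rw [hf]
    refine Finset.sum_congr rfl fun σ _ => ?_
    simp only [a, framePoly, mul_assoc]
  have hslice (m : ℕ) : sobolevWeight lam n m *
      ∫ z, ‖sliceCoeff f z m‖ ^ 2 ∂mu d (lam + 2 * n) ≤ ∑ σ : Fin m → Fin d, ‖F ⟨m, σ⟩‖ ^ 2 := by
    refine le_trans ?_ (norm_sum_smul_frame_sq_le (hlam := hlam) (hn := hn) m fun σ => F ⟨m, σ⟩)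
    set g := ∑ σ : Fin m → Fin d, F ⟨m, σ⟩ • (frame ⟨m, σ⟩ : GenBergman d lam n hlam hn) with hg
    have h1 := le_hasSum (hasSum_norm_sq g) m fun k _ => by
      have := one_le_sobolevWeight hlam n k
      have := integral_nonneg (μ := mu d (lam + 2 * n)) (f := fun z =>
        ‖sliceCoeff g.toHol z k‖ ^ 2) fun _ => by positivity
      positivity
    refine le_trans (le_of_eq ?_) h1
    congr 1
    refine integral_congr_ae ?_
    filter_upwards [ae_mem_unitBall d _] with z hz
    have h2 : sliceCoeff g.toHol z m = sliceCoeff f z m := by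
      rw [hf', hg, toHol_sum_smul_frame]
      change sliceCoeffLin hz m _ = _
      rw [map_sum]
      refine Finset.sum_congr rfl fun σ _ => ?_
      rw [map_smul, smul_eq_mul]
      congr 1
      exact (sliceCoeff_frameHol lam ⟨m, σ⟩ hz m).trans (if_pos rfl)
    rw [h2]
  have hmem : f ∈ sobolevSubmodule d lam n := by
    refine mem_sobolevSubmodule_of_tsum hlam ?_
    have h1 (m : ℕ) : ENNReal.ofReal (sobolevWeight lam n m) *
        ∫⁻ z, ‖sliceCoeff f z m‖ₑ ^ 2 ∂mu d (lam + 2 * n) ≤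
        ENNReal.ofReal (∑ σ : Fin m → Fin d, ‖F ⟨m, σ⟩‖ ^ 2) := by
      have hc := continuous_sliceCoeff f m
      have hi : Integrable (fun z => ‖sliceCoeff f z m‖ ^ 2) (mu d (lam + 2 * n)) := by
        have h3 : Continuous fun z => (sliceCoeff f z m) ^ 2 := by fun_prop
        have h4 := (integrable_mu_of_continuous hn h3).norm
        simpa only [norm_pow] using h4
      have h2 : ∫⁻ z, ‖sliceCoeff f z m‖ₑ ^ 2 ∂mu d (lam + 2 * n) =
          ENNReal.ofReal (∫ z, ‖sliceCoeff f z m‖ ^ 2 ∂mu d (lam + 2 * n)) := by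
        rw [ofReal_integral_eq_lintegral_ofReal hi (ae_of_all _ fun _ => by positivity)]
        simp [ENNReal.ofReal_pow]
      rw [h2, ← ENNReal.ofReal_mul (zero_le_one.trans (one_le_sobolevWeight hlam n m))]
      exact ENNReal.ofReal_le_ofReal (hslice m)
    refine (ENNReal.tsum_le_tsum h1).trans_lt ?_
    rw [← ENNReal.ofReal_tsum_of_nonneg (fun m => Finset.sum_nonneg fun _ _ => by positivity)
      hFm.summable]
    exact ENNReal.ofReal_lt_top
  refine ⟨⟨f, hmem⟩, ?_, hf'⟩
  exact hasSum_le hslice (hasSum_norm_sq (⟨f, hmem⟩ : GenBergman d lam n hlam hn)) hFm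

/-- The analysis operator of the frame of normalized monomials. -/
def analysis : GenBergman d lam n hlam hn →ₗᵢ[ℂ] lp (fun _ : Word d => ℂ) 2 where
  toFun f := ⟨fun σ => inner ℂ (frame σ) f, by
    refine memℓp_gen ?_
    simpa using (hasSum_norm_inner_frame_sq f).summable⟩
  map_add' f g := by
    ext σ
    exact inner_add_right _ _ _
  map_smul' c f := by
    ext σ
    exact inner_smul_right _ _ _
  norm_map' f := by
    have h := lp.hasSum_norm (p := 2) (by simp)
      (⟨fun σ => inner ℂ (frame σ) f, memℓp_gen (by
        simpa using (hasSum_norm_inner_frame_sq f).summable)⟩ : lp (fun _ : Word d => ℂ) 2)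
    simp only [ENNReal.toReal_ofNat, Real.rpow_two] at h
    have h2 := h.unique (hasSum_norm_inner_frame_sq f)
    exact (sq_eq_sq₀ (norm_nonneg _) (norm_nonneg _)).1 h2

theorem analysis_apply (f : GenBergman d lam n hlam hn) (σ : Word d) :
    analysis f σ = inner ℂ (frame σ) f := rfl

instance : CompleteSpace (GenBergman d lam n hlam hn) := by
  refine Metric.complete_of_cauchySeq_tendsto fun u hu => ?_
  obtain ⟨F, hF⟩ := cauchySeq_tendsto_of_complete
    ((analysis (hlam := hlam) (hn := hn)).isometry.uniformContinuous.comp_cauchySeq hu)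
  have hs (G : lp (fun _ : Word d => ℂ) 2) : HasSum (fun σ => ‖G σ‖ ^ 2) (‖G‖ ^ 2) := by
    simpa using lp.hasSum_norm (p := 2) (by simp) G
  obtain ⟨f, -, hf⟩ := exists_synthesis (hlam := hlam) (hn := hn) (hs F)
  refine ⟨f, tendsto_iff_norm_sub_tendsto_zero.2 ?_⟩
  refine squeeze_zero (fun _ => norm_nonneg _) (fun k => ?_)
    (tendsto_iff_norm_sub_tendsto_zero.1 hF)
  obtain ⟨g, hg1, hg⟩ := exists_synthesis (hlam := hlam) (hn := hn) (hs (analysis (u k) - F))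
  have e : g = u k - f := by
    refine Subtype.ext (hol_ext fun z hz m => ?_)
    change sliceCoeff g.toHol z m = sliceCoeffLin hz m ((u k).toHol - f.toHol)
    rw [map_sub]
    change _ = sliceCoeff (u k).toHol z m - sliceCoeff f.toHol z m
    rw [hg, hf, ← sum_inner_frame_mul (u k), ← Finset.sum_sub_distrib]
    refine Finset.sum_congr rfl fun σ _ => ?_
    rw [lp.coeFn_sub, Pi.sub_apply, analysis_apply, sub_mul]
  rw [← e]
  exact (sq_le_sq₀ (norm_nonneg _) (norm_nonneg _)).1 hg1

end Synthesis


section Schur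

variable {X : Type*} [MeasurableSpace X] {μ : Measure X}

theorem sq_lintegral_mul_le {f g : X → ℝ≥0∞} (hf : AEMeasurable f μ) (hg : AEMeasurable g μ) :
    (∫⁻ x, f x * g x ∂μ) ^ 2 ≤ (∫⁻ x, f x ^ 2 ∂μ) * ∫⁻ x, g x ^ 2 ∂μ := by
  have h := ENNReal.lintegral_mul_le_Lp_mul_Lq μ Real.HolderConjugate.two_two hf hg
  simp only [Pi.mul_apply, ENNReal.rpow_two] at h
  calc (∫⁻ x, f x * g x ∂μ) ^ 2
      ≤ ((∫⁻ x, f x ^ 2 ∂μ) ^ (1 / 2 : ℝ) * (∫⁻ x, g x ^ 2 ∂μ) ^ (1 / 2 : ℝ)) ^ 2 := by gcongr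
    _ = _ := by
      rw [← ENNReal.rpow_two, ← ENNReal.mul_rpow_of_nonneg _ _ (by norm_num), ← ENNReal.rpow_mul]
      norm_num

variable [SFinite μ]

/-- Schur's test for a symmetric kernel. -/
theorem lintegral_sq_lintegral_le_of_schur {K : X → X → ℝ≥0∞}
    (hK : Measurable (Function.uncurry K)) (hsymm : ∀ x y, K x y = K y x) {h : X → ℝ≥0∞}
    (hh : Measurable h) (h0 : ∀ᵐ x ∂μ, h x ≠ 0) (htop : ∀ᵐ x ∂μ, h x ≠ ⊤) {C : ℝ≥0∞}
    (hC : ∀ᵐ x ∂μ, ∫⁻ y, K x y * h y ∂μ ≤ C * h x) {f : X → ℝ≥0∞} (hf : AEMeasurable f μ) :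
    ∫⁻ x, (∫⁻ y, K x y * f y ∂μ) ^ 2 ∂μ ≤ C ^ 2 * ∫⁻ x, f x ^ 2 ∂μ := by
  wlog hfm : Measurable f generalizing f
  · have h1 := this hf.measurable_mk.aemeasurable hf.measurable_mk
    have e1 (x : X) : ∫⁻ y, K x y * hf.mk f y ∂μ = ∫⁻ y, K x y * f y ∂μ :=
      lintegral_congr_ae (by filter_upwards [hf.ae_eq_mk] with y hy; rw [hy])
    have e2 : ∫⁻ y, hf.mk f y ^ 2 ∂μ = ∫⁻ y, f y ^ 2 ∂μ :=
      lintegral_congr_ae (by filter_upwards [hf.ae_eq_mk] with y hy; rw [hy])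
    simpa only [e1, e2] using h1
  have hKx (x : X) : Measurable (K x) := hK.of_uncurry_left
  have h1 : ∀ᵐ x ∂μ, (∫⁻ y, K x y * f y ∂μ) ^ 2 ≤
      C * h x * ∫⁻ y, K x y * (f y ^ 2 / h y) ∂μ := by
    filter_upwards [hC] with x hx
    have m1 : Measurable fun y => (K x y * h y) ^ (1 / 2 : ℝ) := by
      have := hKx x
      fun_prop
    have m2 : Measurable fun y => (K x y * (f y ^ 2 / h y)) ^ (1 / 2 : ℝ) := by
      have := hKx x
      fun_prop
    have h2 := sq_lintegral_mul_le (μ := μ) m1.aemeasurable m2.aemeasurable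
    have e0 (a : ℝ≥0∞) : (a ^ (1 / 2 : ℝ)) ^ 2 = a := by
      rw [← ENNReal.rpow_two, ← ENNReal.rpow_mul]
      norm_num
    simp only [e0] at h2
    have e1 : ∫⁻ y, K x y * f y ∂μ =
        ∫⁻ y, (K x y * h y) ^ (1 / 2 : ℝ) * (K x y * (f y ^ 2 / h y)) ^ (1 / 2 : ℝ) ∂μ := by
      refine lintegral_congr_ae ?_
      filter_upwards [h0, htop] with y hy0 hyt
      rw [← ENNReal.mul_rpow_of_nonneg _ _ (by norm_num)]
      have : K x y * h y * (K x y * (f y ^ 2 / h y)) = (K x y * f y) ^ 2 := by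
        rw [div_eq_mul_inv]
        calc K x y * h y * (K x y * (f y ^ 2 * (h y)⁻¹))
            = (K x y * f y) ^ 2 * (h y * (h y)⁻¹) := by ring
          _ = _ := by rw [ENNReal.mul_inv_cancel hy0 hyt, mul_one]
      rw [this, ← ENNReal.rpow_two, ← ENNReal.rpow_mul]
      norm_num
    rw [e1]
    exact h2.trans (by gcongr)
  have hm3 : Measurable (Function.uncurry fun x y => h x * (K x y * (f y ^ 2 / h y))) := by
    have : Function.uncurry (fun x y => h x * (K x y * (f y ^ 2 / h y))) =
      fun p : X × X => h p.1 * (Function.uncurry K p * (f p.2 ^ 2 / h p.2)) := rfl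
    rw [this]
    fun_prop
  calc ∫⁻ x, (∫⁻ y, K x y * f y ∂μ) ^ 2 ∂μ
      ≤ ∫⁻ x, C * h x * ∫⁻ y, K x y * (f y ^ 2 / h y) ∂μ ∂μ := lintegral_mono_ae h1
    _ = C * ∫⁻ x, ∫⁻ y, h x * (K x y * (f y ^ 2 / h y)) ∂μ ∂μ := by
      rw [← lintegral_const_mul _ hm3.lintegral_prod_right]
      refine lintegral_congr fun x => ?_
      have := hKx x
      rw [lintegral_const_mul _ (by fun_prop), mul_assoc]
    _ = C * ∫⁻ y, ∫⁻ x, h x * (K x y * (f y ^ 2 / h y)) ∂μ ∂μ := by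
      rw [lintegral_lintegral_swap hm3.aemeasurable]
    _ ≤ C * ∫⁻ y, C * f y ^ 2 ∂μ := by
      refine mul_le_mul_right (lintegral_mono_ae ?_) _
      filter_upwards [hC, h0, htop] with y hy hy0 hyt
      have := hKx y
      have e : ∫⁻ x, h x * (K x y * (f y ^ 2 / h y)) ∂μ =
          (∫⁻ x, K y x * h x ∂μ) * (f y ^ 2 / h y) := by
        rw [← lintegral_mul_const _ (by fun_prop)]
        refine lintegral_congr fun x => ?_
        rw [hsymm x y]
        ring
      rw [e]
      calc (∫⁻ x, K y x * h x ∂μ) * (f y ^ 2 / h y) ≤ C * h y * (f y ^ 2 / h y) := by gcongr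
        _ = C * f y ^ 2 * (h y * (h y)⁻¹) := by
          rw [div_eq_mul_inv]
          ring
        _ = C * f y ^ 2 := by rw [ENNReal.mul_inv_cancel hy0 hyt, mul_one]
    _ = C ^ 2 * ∫⁻ x, f x ^ 2 ∂μ := by
      rw [lintegral_const_mul _ (by fun_prop)]
      ring

end Schur

theorem norm_inner_lt_one {d : ℕ} {z w : Cd d} (hz : z ∈ unitBall d) (hw : w ∈ unitBall d) :
    ‖inner ℂ z w‖ < 1 := by
  have hz1 : ‖z‖ < 1 := by simpa [unitBall] using hz
  have hw1 : ‖w‖ < 1 := by simpa [unitBall] using hw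
  calc ‖inner ℂ z w‖ ≤ ‖z‖ * ‖w‖ := norm_inner_le_norm z w
    _ ≤ ‖z‖ * 1 := by gcongr
    _ < 1 := by linarith

theorem one_sub_ne_zero_of_norm_lt_one {x : ℂ} (hx : ‖x‖ < 1) : 1 - x ≠ 0 := by
  intro h
  rw [← sub_eq_zero.1 h] at hx
  simp at hx

theorem integral_norm_inner_pow_sq {d : ℕ} {s : ℝ} (hs : (d : ℝ) < s) (z : Cd d) (m : ℕ) :
    ∫ w, ‖inner ℂ z w ^ m‖ ^ 2 ∂mu d s =
      (m.factorial / risingFactorial s m) * (‖z‖ ^ 2) ^ m := by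
  have h1 : ∀ w : Cd d, ((‖inner ℂ z w ^ m‖ ^ 2 : ℝ) : ℂ) =
      ∑ σ : Fin m → Fin d, conj (wordMonomial σ z) *
        (conj (inner ℂ z w ^ m) * wordMonomial σ w) := by
    intro w
    rw [← conj_mul_self_eq_ofReal]
    nth_rw 2 [← sum_conj_wordMonomial_mul]
    rw [Finset.mul_sum]
    refine Finset.sum_congr rfl fun σ _ => ?_
    ring
  have h2 : ((∫ w, ‖inner ℂ z w ^ m‖ ^ 2 ∂mu d s : ℝ) : ℂ) =
      ((m.factorial / risingFactorial s m : ℝ) : ℂ) * inner ℂ z z ^ m := by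
    rw [← integral_complex_ofReal]
    simp only [h1]
    rw [integral_finsetSum, ← sum_conj_wordMonomial_mul, Finset.mul_sum]
    · refine Finset.sum_congr rfl fun σ _ => ?_
      rw [integral_const_mul, integral_mu_inner_pow hs]
      ring
    · intro σ _
      have := continuous_wordMonomial σ
      exact integrable_mu_of_continuous hs (by fun_prop)
  rw [inner_self_eq_ofReal, ← Complex.ofReal_pow, ← Complex.ofReal_mul] at h2
  exact Complex.ofReal_injective h2

theorem lintegral_norm_inner_pow_sq {d : ℕ} {s : ℝ} (hs : (d : ℝ) < s) (z : Cd d) (m : ℕ) :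
    ∫⁻ w, ‖inner ℂ z w ^ m‖ₑ ^ 2 ∂mu d s =
      ENNReal.ofReal ((m.factorial / risingFactorial s m) * (‖z‖ ^ 2) ^ m) := by
  have hi : Integrable (fun w => ‖inner ℂ z w ^ m‖ ^ 2) (mu d s) := by
    have h3 : Continuous fun w : Cd d => (inner ℂ z w ^ m) ^ 2 := by fun_prop
    have h4 := (integrable_mu_of_continuous hs h3).norm
    simpa only [norm_pow] using h4
  rw [← integral_norm_inner_pow_sq hs, ofReal_integral_eq_lintegral_ofReal hi
    (ae_of_all _ fun _ => by positivity)]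
  simp [ENNReal.ofReal_pow]

/-- The integral kernel of `aOp`, up to its constant. -/
def aKernel (d : ℕ) (lam : ℝ) (z w : Cd d) : ℝ :=
  ((1 - ‖z‖ ^ 2) * (1 - ‖w‖ ^ 2) / ‖1 - inner ℂ z w‖ ^ 2) ^ lam

theorem measurable_aKernel (d : ℕ) (lam : ℝ) :
    Measurable (Function.uncurry (aKernel d lam)) := by
  have : Function.uncurry (aKernel d lam) = fun p : Cd d × Cd d =>
    ((1 - ‖p.1‖ ^ 2) * (1 - ‖p.2‖ ^ 2) / ‖1 - inner ℂ p.1 p.2‖ ^ 2) ^ lam := rfl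
  rw [this]
  have h1 : Continuous fun p : Cd d × Cd d => inner ℂ p.1 p.2 := by fun_prop
  have h2 := h1.measurable
  fun_prop

theorem aKernel_symm (d : ℕ) (lam : ℝ) (z w : Cd d) : aKernel d lam z w = aKernel d lam w z := by
  have h : ‖1 - inner ℂ z w‖ = ‖1 - inner ℂ w z‖ := by
    rw [← RCLike.norm_conj (1 - inner ℂ w z), map_sub, map_one, inner_conj_symm]
  rw [aKernel, aKernel, h, mul_comm (1 - ‖z‖ ^ 2)]

theorem aKernel_nonneg {d : ℕ} (lam : ℝ) {z w : Cd d} (hz : z ∈ unitBall d)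
    (hw : w ∈ unitBall d) : 0 ≤ aKernel d lam z w := by
  have h1 := one_sub_norm_sq_pos hz
  have h2 := one_sub_norm_sq_pos hw
  unfold aKernel
  positivity

theorem norm_cpow_neg {x : ℂ} (a : ℝ) : ‖(1 - x) ^ (-a : ℂ)‖ = ‖1 - x‖ ^ (-a) := by
  rw [← Complex.ofReal_neg, Complex.norm_cpow_real]

theorem aKernel_eq {d : ℕ} (lam : ℝ) {z w : Cd d} (hz : z ∈ unitBall d) (hw : w ∈ unitBall d) :
    aKernel d lam z w = (1 - ‖z‖ ^ 2) ^ lam * (1 - ‖w‖ ^ 2) ^ lam *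
      ‖(1 - inner ℂ z w) ^ (-lam : ℂ)‖ ^ 2 := by
  have h1 := one_sub_norm_sq_pos hz
  have h2 := one_sub_norm_sq_pos hw
  have h3 := norm_pos_iff.2 (one_sub_ne_zero_of_norm_lt_one (norm_inner_lt_one hz hw))
  have h4 : (‖1 - inner ℂ z w‖ ^ 2) ^ lam = (‖1 - inner ℂ z w‖ ^ lam) ^ 2 := by
    rw [← Real.rpow_natCast, ← Real.rpow_natCast, ← Real.rpow_mul h3.le, ← Real.rpow_mul h3.le,
      mul_comm]
  rw [aKernel, Real.div_rpow (by positivity) (by positivity), Real.mul_rpow h1.le h2.le,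
    norm_cpow_neg, div_eq_mul_inv, h4, Real.rpow_neg h3.le, inv_pow]

/-- The Forelli-Rudin estimate. -/
theorem exists_lintegral_cpow_le {d : ℕ} {lam : ℝ} (hlam : (d : ℝ) / 2 < lam) :
    ∃ C : ℝ, 0 ≤ C ∧ ∀ z ∈ unitBall d,
      ∫⁻ w, ‖(1 - inner ℂ z w) ^ (-lam : ℂ)‖ₑ ^ 2 ∂mu d (lam + d / 2) ≤
        ENNReal.ofReal (C * (1 - ‖z‖ ^ 2) ^ (-(lam - d / 2))) := by
  have hd0 : (0 : ℝ) ≤ d / 2 := by positivity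
  have hlam0 : 0 < lam := pos_of_half_lt hlam
  have hs : (d : ℝ) < lam + d / 2 := by linarith
  have hs0 : 0 < lam + d / 2 := by linarith
  have hc : 0 < lam - d / 2 := by linarith
  have hratio := risingFactorial_sq_le (a := lam) (δ := d / 2) (by rwa [abs_of_nonneg hd0])
  set C := Real.Gamma (lam + d / 2) * Real.Gamma (lam - d / 2) / Real.Gamma lam ^ 2 with hC
  have hC0 : 0 ≤ C := by
    have := Real.Gamma_pos_of_pos hs0
    have := Real.Gamma_pos_of_pos hc
    positivity
  refine ⟨C, hC0, fun z hz => ?_⟩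
  have hinner : Measurable fun w : Cd d => inner ℂ z w := by
    have : Continuous fun w : Cd d => inner ℂ z w := by fun_prop
    exact this.measurable
  rw [lintegral_norm_sq_eq_tsum (a := fun m w => binomCoeff lam m * inner ℂ z w ^ m)
    (by fun_prop) (fun m => by fun_prop) fun w hw θ => by
      have hw' : cis θ • w ∈ unitBall d := by simpa [unitBall, norm_smul, norm_cis] using hw
      refine (hasSum_binomCoeff_complex hlam0 (norm_inner_lt_one hz hw')).congr_fun fun m => ?_
      rw [inner_smul_right]
      ring]
  have hterm (m : ℕ) : ∫⁻ w, ‖(binomCoeff lam m : ℂ) * inner ℂ z w ^ m‖ₑ ^ 2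
      ∂mu d (lam + d / 2) ≤ ENNReal.ofReal (C * (binomCoeff (lam - d / 2) m * (‖z‖ ^ 2) ^ m)) := by
    have hb := binomCoeff_pos hlam0 m
    have e1 : ∫⁻ w, ‖(binomCoeff lam m : ℂ) * inner ℂ z w ^ m‖ₑ ^ 2 ∂mu d (lam + d / 2) =
        ENNReal.ofReal (binomCoeff lam m ^ 2) *
          ∫⁻ w, ‖inner ℂ z w ^ m‖ₑ ^ 2 ∂mu d (lam + d / 2) := by
      rw [← lintegral_const_mul _ (by fun_prop)]
      refine lintegral_congr fun w => ?_
      rw [enorm_mul, mul_pow, ENNReal.ofReal_pow hb.le, ← ofReal_norm (binomCoeff lam m : ℂ),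
        Complex.norm_real, Real.norm_of_nonneg hb.le]
    rw [e1, lintegral_norm_inner_pow_sq hs, ← ENNReal.ofReal_mul (by positivity), ← mul_assoc,
      ← mul_assoc]
    refine ENNReal.ofReal_le_ofReal (mul_le_mul_of_nonneg_right ?_ (by positivity))
    have h1 := hratio m
    have h2 := risingFactorial_pos hs0 m
    have h3 := risingFactorial_pos hlam0 m
    have hm : (0 : ℝ) < m.factorial := by positivity
    rw [binomCoeff, binomCoeff]
    generalize risingFactorial (lam + d / 2) m = A at h1 h2 ⊢
    generalize risingFactorial (lam - d / 2) m = B at h1 ⊢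
    calc (risingFactorial lam m / m.factorial) ^ 2 *
          (m.factorial / A)
        = risingFactorial lam m ^ 2 / (m.factorial * A) := by
          field_simp
      _ ≤ C * (A * B) / (m.factorial * A) := by gcongr
      _ = _ := by field_simp
  refine (ENNReal.tsum_le_tsum hterm).trans (le_of_eq ?_)
  have hS := (hasSum_binomCoeff hc (norm_sq_lt_one hz)).mul_left C
  rw [← ENNReal.ofReal_tsum_of_nonneg _ hS.summable, hS.tsum_eq]
  intro m
  have := binomCoeff_pos hc m
  positivity

theorem exists_schur_bound {d : ℕ} {lam : ℝ} (hlam : (d : ℝ) / 2 < lam) :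
    ∃ C : ℝ, 0 ≤ C ∧ ∀ z ∈ unitBall d,
      ∫⁻ w, ENNReal.ofReal (aKernel d lam z w) *
        ENNReal.ofReal ((1 - ‖w‖ ^ 2) ^ ((d : ℝ) / 2)) ∂tau d ≤
      ENNReal.ofReal C * ENNReal.ofReal ((1 - ‖z‖ ^ 2) ^ ((d : ℝ) / 2)) := by
  obtain ⟨C, hC0, hC⟩ := exists_lintegral_cpow_le hlam
  have hd0 : (0 : ℝ) ≤ d / 2 := by positivity
  have hs : (d : ℝ) < lam + d / 2 := by linarith
  have hcs := cConst_pos hs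
  refine ⟨(cConst d (lam + d / 2))⁻¹ * C, by positivity, fun z hz => ?_⟩
  have hz1 := one_sub_norm_sq_pos hz
  have e : ∫⁻ w, ENNReal.ofReal (aKernel d lam z w) *
        ENNReal.ofReal ((1 - ‖w‖ ^ 2) ^ ((d : ℝ) / 2)) ∂tau d =
      ENNReal.ofReal ((cConst d (lam + d / 2))⁻¹ * (1 - ‖z‖ ^ 2) ^ lam) *
        ∫⁻ w, ‖(1 - inner ℂ z w) ^ (-lam : ℂ)‖ₑ ^ 2 ∂mu d (lam + d / 2) := by
    rw [lintegral_mu, ← lintegral_const_mul' _ _ ENNReal.ofReal_ne_top]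
    refine lintegral_congr_ae ?_
    filter_upwards [ae_tau_mem_unitBall d] with w hw
    have hw1 := one_sub_norm_sq_pos hw
    rw [← ofReal_norm ((1 - inner ℂ z w) ^ (-lam : ℂ)), ← ENNReal.ofReal_pow (norm_nonneg _),
      ← ENNReal.ofReal_mul (aKernel_nonneg _ hz hw), ← ENNReal.ofReal_mul (by positivity),
      ← ENNReal.ofReal_mul (by positivity), aKernel_eq lam hz hw, Real.rpow_add hw1]
    congr 1
    have hne := hcs.ne'
    generalize cConst d (lam + d / 2) = c at hne ⊢
    field_simp
  rw [e, ← ENNReal.ofReal_mul (by positivity)]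
  refine (mul_le_mul_right (hC z hz) _).trans (le_of_eq ?_)
  rw [← ENNReal.ofReal_mul (by positivity)]
  congr 1
  have : (1 - ‖z‖ ^ 2) ^ ((d : ℝ) / 2) =
      (1 - ‖z‖ ^ 2) ^ lam * (1 - ‖z‖ ^ 2) ^ (-(lam - (d : ℝ) / 2)) := by
    rw [← Real.rpow_add hz1]
    congr 1
    ring
  rw [this]
  ring


instance (d : ℕ) : SFinite (tau d) := by unfold tau; infer_instance

/-- The weight `(1 - |z|²)^lam`. -/
def weight (d : ℕ) (lam : ℝ) (z : Cd d) : ℂ := (((1 - ‖z‖ ^ 2) ^ lam : ℝ) : ℂ)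

theorem measurable_weight (d : ℕ) (lam : ℝ) : Measurable (weight d lam) := by
  unfold weight
  fun_prop

theorem memLp_weight {d : ℕ} {lam : ℝ} (hlam : (d : ℝ) / 2 < lam) :
    MemLp (weight d lam) 2 (tau d) := by
  have hs : (d : ℝ) < 2 * lam := by linarith
  have hc := cConst_pos hs
  refine ⟨(measurable_weight d lam).aestronglyMeasurable, ?_⟩
  rw [eLpNorm_lt_top_iff_lintegral_rpow_enorm_lt_top two_ne_zero ENNReal.ofNat_ne_top]
  simp only [ENNReal.toReal_ofNat, ENNReal.rpow_two]
  have h := (isFiniteMeasure_mu hs).measure_univ_lt_top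
  rw [← lintegral_one, lintegral_mu] at h
  have e : ∫⁻ z, ‖weight d lam z‖ₑ ^ 2 ∂tau d = ENNReal.ofReal (cConst d (2 * lam))⁻¹ *
      ∫⁻ z, ENNReal.ofReal (cConst d (2 * lam) * (1 - ‖z‖ ^ 2) ^ (2 * lam)) * 1 ∂tau d := by
    rw [← lintegral_const_mul' _ _ ENNReal.ofReal_ne_top]
    refine lintegral_congr_ae ?_
    filter_upwards [ae_tau_mem_unitBall d] with z hz
    have hz1 := one_sub_norm_sq_pos hz
    rw [mul_one, ← ENNReal.ofReal_mul (by positivity), ← mul_assoc, inv_mul_cancel₀ hc.ne',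
      one_mul, weight, ← ofReal_norm, Complex.norm_real, Real.norm_of_nonneg (by positivity),
      ← ENNReal.ofReal_pow (by positivity), mul_comm 2 lam, Real.rpow_mul hz1.le, Real.rpow_two]
  rw [e]
  exact ENNReal.mul_lt_top ENNReal.ofReal_lt_top h

theorem integrable_mul_weight {d : ℕ} {lam : ℝ} (hlam : (d : ℝ) / 2 < lam) {φ : Cd d → ℂ}
    (hφ : MemLp φ 2 (tau d)) : Integrable (fun z => φ z * weight d lam z) (tau d) :=
  hφ.integrable_mul (memLp_weight hlam)

theorem aestronglyMeasurable_aKernel_mul {d : ℕ} {lam : ℝ} {φ : Cd d → ℂ}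
    (hφ : AEStronglyMeasurable φ (tau d)) :
    AEStronglyMeasurable (fun p : Cd d × Cd d => (aKernel d lam p.1 p.2 : ℂ) * φ p.2)
      ((tau d).prod (tau d)) := by
  have h : Measurable fun p : Cd d × Cd d => (aKernel d lam p.1 p.2 : ℂ) :=
    Complex.measurable_ofReal.comp (measurable_aKernel d lam)
  exact h.aestronglyMeasurable.mul hφ.comp_snd

theorem lintegral_sq_aKernel_lt_top {d : ℕ} {lam : ℝ} (hlam : (d : ℝ) / 2 < lam) {φ : Cd d → ℂ}
    (hφ : MemLp φ 2 (tau d)) :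
    ∫⁻ z, (∫⁻ w, ENNReal.ofReal (aKernel d lam z w) * ‖φ w‖ₑ ∂tau d) ^ 2 ∂tau d < ⊤ := by
  obtain ⟨C, hC0, hC⟩ := exists_schur_bound hlam
  have hK : Measurable (Function.uncurry fun z w => ENNReal.ofReal (aKernel d lam z w)) :=
    (measurable_aKernel d lam).ennreal_ofReal
  refine (lintegral_sq_lintegral_le_of_schur hK (fun z w => by rw [aKernel_symm])
    (h := fun w => ENNReal.ofReal ((1 - ‖w‖ ^ 2) ^ ((d : ℝ) / 2))) (by fun_prop) ?_
    (ae_of_all _ fun _ => ENNReal.ofReal_ne_top) (C := ENNReal.ofReal C) ?_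
    hφ.1.enorm).trans_lt ?_
  · filter_upwards [ae_tau_mem_unitBall d] with z hz
    have := Real.rpow_pos_of_pos (one_sub_norm_sq_pos hz) ((d : ℝ) / 2)
    simpa using this
  · filter_upwards [ae_tau_mem_unitBall d] with z hz
    exact hC z hz
  · refine ENNReal.mul_lt_top (ENNReal.pow_lt_top ENNReal.ofReal_lt_top) ?_
    have h := hφ.2
    rw [eLpNorm_lt_top_iff_lintegral_rpow_enorm_lt_top two_ne_zero ENNReal.ofNat_ne_top] at h
    simpa only [ENNReal.toReal_ofNat, ENNReal.rpow_two] using h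

theorem lintegral_enorm_aKernel_mul {d : ℕ} {lam : ℝ} {φ : Cd d → ℂ} {z : Cd d}
    (hz : z ∈ unitBall d) : ∫⁻ w, ‖(aKernel d lam z w : ℂ) * φ w‖ₑ ∂tau d =
      ∫⁻ w, ENNReal.ofReal (aKernel d lam z w) * ‖φ w‖ₑ ∂tau d := by
  refine lintegral_congr_ae ?_
  filter_upwards [ae_tau_mem_unitBall d] with w hw
  rw [enorm_mul, ← ofReal_norm (aKernel d lam z w : ℂ), Complex.norm_real,
    Real.norm_of_nonneg (aKernel_nonneg lam hz hw)]

theorem memLp_aOp {d : ℕ} {lam : ℝ} (hlam : (d : ℝ) / 2 < lam) {φ : Cd d → ℂ}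
    (hφ : MemLp φ 2 (tau d)) : MemLp (aOp d lam φ) 2 (tau d) := by
  have h : MemLp (fun z => ∫ w, (aKernel d lam z w : ℂ) * φ w ∂tau d) 2 (tau d) := by
    refine ⟨(aestronglyMeasurable_aKernel_mul hφ.1).integral_prod_right', ?_⟩
    rw [eLpNorm_lt_top_iff_lintegral_rpow_enorm_lt_top two_ne_zero ENNReal.ofNat_ne_top]
    simp only [ENNReal.toReal_ofNat, ENNReal.rpow_two]
    refine lt_of_le_of_lt (lintegral_mono_ae ?_) (lintegral_sq_aKernel_lt_top hlam hφ)
    filter_upwards [ae_tau_mem_unitBall d] with z hz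
    gcongr
    exact (enorm_integral_le_lintegral_enorm _).trans_eq (lintegral_enorm_aKernel_mul hz)
  exact h.const_mul ((cConst d lam : ℂ) ^ 2)

theorem integrable_conj_mul_aKernel_mul {d : ℕ} {lam : ℝ} (hlam : (d : ℝ) / 2 < lam)
    {φ : Cd d → ℂ} (hφ : MemLp φ 2 (tau d)) :
    Integrable (fun p : Cd d × Cd d => conj (φ p.1) * ((aKernel d lam p.1 p.2 : ℂ) * φ p.2))
      ((tau d).prod (tau d)) := by
  have hm := aestronglyMeasurable_aKernel_mul (lam := lam) hφ.1
  have hm2 : AEStronglyMeasurable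
      (fun p : Cd d × Cd d => conj (φ p.1) * ((aKernel d lam p.1 p.2 : ℂ) * φ p.2))
      ((tau d).prod (tau d)) := by
    have h1 : AEStronglyMeasurable (fun z => conj (φ z)) (tau d) :=
      Complex.continuous_conj.comp_aestronglyMeasurable hφ.1
    exact h1.comp_fst.mul hm
  refine ⟨hm2, ?_⟩
  rw [HasFiniteIntegral, lintegral_prod _ hm2.enorm]
  have e : ∫⁻ z, ∫⁻ w, ‖conj (φ z) * ((aKernel d lam z w : ℂ) * φ w)‖ₑ ∂tau d ∂tau d =
      ∫⁻ z, ‖φ z‖ₑ * ∫⁻ w, ‖(aKernel d lam z w : ℂ) * φ w‖ₑ ∂tau d ∂tau d := by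
    refine lintegral_congr fun z => ?_
    rw [← lintegral_const_mul' _ _ (by simp)]
    refine lintegral_congr fun w => ?_
    rw [enorm_mul, RCLike.enorm_conj]
  simp only [e]
  have h2 := sq_lintegral_mul_le (μ := tau d) hφ.1.enorm hm.enorm.lintegral_prod_right'
  have h3 : ∫⁻ z, (∫⁻ w, ‖(aKernel d lam z w : ℂ) * φ w‖ₑ ∂tau d) ^ 2 ∂tau d < ⊤ := by
    refine lt_of_le_of_lt (lintegral_mono_ae ?_) (lintegral_sq_aKernel_lt_top hlam hφ)
    filter_upwards [ae_tau_mem_unitBall d] with z hz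
    rw [lintegral_enorm_aKernel_mul hz]
  have h4 : ∫⁻ z, ‖φ z‖ₑ ^ 2 ∂tau d < ⊤ := by
    have h := hφ.2
    rw [eLpNorm_lt_top_iff_lintegral_rpow_enorm_lt_top two_ne_zero ENNReal.ofNat_ne_top] at h
    simpa only [ENNReal.toReal_ofNat, ENNReal.rpow_two] using h
  have h5 := h2.trans_lt (ENNReal.mul_lt_top h4 h3)
  exact (ENNReal.pow_lt_top_iff.1 h5).resolve_right two_ne_zero

theorem integral_conj_mul_aOp {d : ℕ} {lam : ℝ} (hlam : (d : ℝ) / 2 < lam)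
    {φ : Cd d → ℂ} (hφ : MemLp φ 2 (tau d)) :
    ∫ z, conj (φ z) * aOp d lam φ z ∂tau d = (cConst d lam : ℂ) ^ 2 *
      ∫ p : Cd d × Cd d, conj (φ p.1) * ((aKernel d lam p.1 p.2 : ℂ) * φ p.2)
        ∂(tau d).prod (tau d) := by
  rw [integral_prod _ (integrable_conj_mul_aKernel_mul hlam hφ), ← integral_const_mul]
  congr 1
  funext z
  simp only [integral_const_mul]
  rw [mul_left_comm]
  rfl


section Swap

open Filter Topology

variable {X ι : Type*} [MeasurableSpace X] {μ : Measure X}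

/-- Termwise integration of an absolutely and uniformly convergent series against an integrable
function. -/
theorem hasSum_integral_mul_of_sum_norm_le [Countable ι] {a : ι → X → ℂ}
    (ha : ∀ i, AEStronglyMeasurable (a i) μ) {A ψ : X → ℂ} (hψ : Integrable ψ μ) {C : ℝ}
    (hC : ∀ᵐ x ∂μ, ∀ s : Finset ι, ∑ i ∈ s, ‖a i x‖ ≤ C)
    (hA : ∀ᵐ x ∂μ, HasSum (fun i => a i x) (A x)) :
    HasSum (fun i => ∫ x, a i x * ψ x ∂μ) (∫ x, A x * ψ x ∂μ) := by
  have hb (i : ι) : ∀ᵐ x ∂μ, ‖a i x‖ ≤ C := by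
    filter_upwards [hC] with x hx
    simpa using hx {i}
  have hint (i : ι) : Integrable (fun x => a i x * ψ x) μ := hψ.bdd_mul (ha i) (hb i)
  have hsum : Summable fun i => ∫ x, ‖a i x * ψ x‖ ∂μ := by
    refine summable_of_sum_le (c := ∫ x, C * ‖ψ x‖ ∂μ)
      (fun i => integral_nonneg fun _ => norm_nonneg _) fun s => ?_
    rw [← integral_finsetSum _ fun i _ => (hint i).norm]
    refine integral_mono_ae (integrable_finsetSum _ fun i _ => (hint i).norm)
      (hψ.norm.const_mul C) ?_
    filter_upwards [hC] with x hx
    simp only [norm_mul, ← Finset.sum_mul]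
    exact mul_le_mul_of_nonneg_right (hx s) (norm_nonneg _)
  have h := hasSum_integral_of_summable_integral_norm hint hsum
  have e : ∫ x, A x * ψ x ∂μ = ∫ x, ∑' i, a i x * ψ x ∂μ := by
    refine integral_congr_ae ?_
    filter_upwards [hA] with x hx
    exact (hx.mul_right (ψ x)).tsum_eq.symm
  rw [e]
  exact h

theorem tendsto_tsum_pow_mul {g : ι → ℂ} (hg : Summable fun i => ‖g i‖) (k : ι → ℕ) :
    Tendsto (fun r : ℝ => ∑' i, ((r ^ k i : ℝ) : ℂ) * g i) (𝓝[<] 1) (𝓝 (∑' i, g i)) := by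
  refine tendsto_tsum_of_dominated_convergence hg (fun i => ?_) ?_
  · have : Tendsto (fun r : ℝ => ((r ^ k i : ℝ) : ℂ) * g i) (𝓝 1) (𝓝 (((1 ^ k i : ℝ) : ℂ) * g i)) :=
      Continuous.tendsto (by fun_prop) 1
    simpa using this.mono_left nhdsWithin_le_nhds
  · filter_upwards [Ioo_mem_nhdsLT (zero_lt_one' ℝ)] with r hr i
    rw [norm_mul, Complex.norm_real, Real.norm_of_nonneg (pow_nonneg hr.1.le _)]
    exact mul_le_of_le_one_left (norm_nonneg _) (pow_le_one₀ hr.1.le hr.2.le)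

/-- A Tauberian theorem for Abel means of nonnegative series. -/
theorem hasSum_of_tendsto_abel {g : ι → ℝ} (hg : ∀ i, 0 ≤ g i) (k : ι → ℕ) {Φ : ℝ → ℂ} {L : ℂ}
    (h : ∀ r ∈ Ioo (0 : ℝ) 1, HasSum (fun i => ((r ^ k i : ℝ) : ℂ) * (g i : ℂ)) (Φ r))
    (hL : Tendsto Φ (𝓝[<] 1) (𝓝 L)) : HasSum (fun i => (g i : ℂ)) L := by
  have hs : Summable g := by
    refine summable_of_sum_le hg (c := L.re) fun s => ?_
    have h1 : Tendsto (fun r : ℝ => ∑ i ∈ s, r ^ k i * g i) (𝓝[<] 1) (𝓝 (∑ i ∈ s, g i)) := by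
      have : Tendsto (fun r : ℝ => ∑ i ∈ s, r ^ k i * g i) (𝓝 1) (𝓝 (∑ i ∈ s, 1 ^ k i * g i)) :=
        Continuous.tendsto (by fun_prop) 1
      simpa using this.mono_left nhdsWithin_le_nhds
    refine le_of_tendsto_of_tendsto h1 ((Complex.continuous_re.tendsto L).comp hL) ?_
    filter_upwards [Ioo_mem_nhdsLT (zero_lt_one' ℝ)] with r hr
    have h2 := Complex.hasSum_re (h r hr)
    simp only [← Complex.ofReal_mul, Complex.ofReal_re] at h2
    exact sum_le_hasSum s (fun i _ => mul_nonneg (pow_nonneg hr.1.le _) (hg i)) h2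
  have hs' : Summable fun i => (g i : ℂ) := Complex.summable_ofReal.2 hs
  have h3 := tendsto_tsum_pow_mul hs'.norm k
  have h4 : Tendsto Φ (𝓝[<] 1) (𝓝 (∑' i, (g i : ℂ))) := by
    refine h3.congr' ?_
    filter_upwards [Ioo_mem_nhdsLT (zero_lt_one' ℝ)] with r hr
    exact (h r hr).tsum_eq
  rw [tendsto_nhds_unique hL h4]
  exact hs'.hasSum

theorem sum_mul_le_of_sum_le {κ : Type*} {u : ι → ℝ} {v : κ → ℝ} (hu : ∀ i, 0 ≤ u i)
    (hv : ∀ i, 0 ≤ v i) {U V : ℝ} (hU : ∀ s : Finset ι, ∑ i ∈ s, u i ≤ U)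
    (hV : ∀ s : Finset κ, ∑ i ∈ s, v i ≤ V) (s : Finset (ι × κ)) :
    ∑ p ∈ s, u p.1 * v p.2 ≤ U * V := by
  classical
  calc ∑ p ∈ s, u p.1 * v p.2
      ≤ ∑ p ∈ s.image Prod.fst ×ˢ s.image Prod.snd, u p.1 * v p.2 :=
        Finset.sum_le_sum_of_subset_of_nonneg
          (fun p hp => Finset.mem_product.2 ⟨Finset.mem_image_of_mem _ hp,
            Finset.mem_image_of_mem _ hp⟩) fun p _ _ => mul_nonneg (hu _) (hv _)
    _ = (∑ i ∈ s.image Prod.fst, u i) * ∑ j ∈ s.image Prod.snd, v j := by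
        rw [Finset.sum_mul_sum, Finset.sum_product]
    _ ≤ U * V := mul_le_mul (hU _) (hV _) (Finset.sum_nonneg fun _ _ => hv _)
        ((Finset.sum_nonneg fun _ _ => hu _).trans (hU ∅))

theorem summable_norm_of_sum_le {u : ι → ℂ} {U : ℝ} (hU : ∀ s : Finset ι, ∑ i ∈ s, ‖u i‖ ≤ U) :
    Summable fun i => ‖u i‖ :=
  summable_of_sum_le (fun _ => norm_nonneg _) hU

theorem hasSum_mul_of_sum_le {κ : Type*} {u : ι → ℂ} {v : κ → ℂ} {U V : ℝ} {a b : ℂ}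
    (hU : ∀ s : Finset ι, ∑ i ∈ s, ‖u i‖ ≤ U) (hV : ∀ s : Finset κ, ∑ i ∈ s, ‖v i‖ ≤ V)
    (hu : HasSum u a) (hv : HasSum v b) :
    HasSum (fun p : ι × κ => u p.1 * v p.2) (a * b) := by
  refine hu.mul hv (Summable.of_norm ?_)
  simp only [norm_mul]
  exact (summable_norm_of_sum_le hU).mul_of_nonneg (summable_norm_of_sum_le hV)
    (fun _ => norm_nonneg _) fun _ => norm_nonneg _

end Swap

section Abel

open Filter Topology

variable {d : ℕ} {lam : ℝ}

theorem sum_pow_mul_norm_framePoly_sq_le (hlam : 0 < lam) {r : ℝ} (hr : r ∈ Ioo (0 : ℝ) 1)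
    {z : Cd d} (hz : z ∈ unitBall d) (s : Finset (Word d)) :
    ∑ σ ∈ s, r ^ σ.1 * ‖framePoly lam σ z‖ ^ 2 ≤ (1 - r) ^ (-lam) := by
  have hz1 : ‖z‖ < 1 := by simpa [unitBall] using hz
  have hn : ‖((√r : ℝ) : ℂ) • z‖ ^ 2 = r * ‖z‖ ^ 2 := by
    rw [norm_smul, Complex.norm_real, Real.norm_of_nonneg (Real.sqrt_nonneg _), mul_pow,
      Real.sq_sqrt hr.1.le]
  have hz2 : ‖z‖ ^ 2 ≤ 1 := by nlinarith [norm_nonneg z]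
  have hle : r * ‖z‖ ^ 2 ≤ r := mul_le_of_le_one_right hr.1.le hz2
  have hmem : ((√r : ℝ) : ℂ) • z ∈ unitBall d := by
    have : ‖((√r : ℝ) : ℂ) • z‖ ^ 2 < 1 := by linarith [hr.2]
    have h2 : ‖((√r : ℝ) : ℂ) • z‖ < 1 := by
      rwa [sq_lt_one_iff₀ (norm_nonneg _)] at this
    simpa [unitBall] using h2
  have h := hasSum_norm_framePoly_sq hlam hmem
  have e (σ : Word d) : ‖framePoly lam σ (((√r : ℝ) : ℂ) • z)‖ ^ 2 =
      r ^ σ.1 * ‖framePoly lam σ z‖ ^ 2 := by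
    rw [framePoly_smul, norm_mul, norm_pow, Complex.norm_real,
      Real.norm_of_nonneg (Real.sqrt_nonneg _), mul_pow, ← pow_mul, mul_comm σ.1 2, pow_mul,
      Real.sq_sqrt hr.1.le]
  simp only [e, hn] at h
  refine (sum_le_hasSum s (fun σ _ => mul_nonneg (pow_nonneg hr.1.le _) (by positivity)) h).trans ?_
  exact Real.rpow_le_rpow_of_nonpos (by linarith [hr.2]) (by linarith) (by linarith)

theorem sum_norm_pow_mul_framePoly_mul_le (hlam : 0 < lam) {r : ℝ} (hr : r ∈ Ioo (0 : ℝ) 1)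
    {z w : Cd d} (hz : z ∈ unitBall d) (hw : w ∈ unitBall d) (s : Finset (Word d)) :
    ∑ σ ∈ s, ‖((r ^ σ.1 : ℝ) : ℂ) * (conj (framePoly lam σ z) * framePoly lam σ w)‖ ≤
      (1 - r) ^ (-lam) := by
  have h1 := sum_pow_mul_norm_framePoly_sq_le hlam hr hz s
  have h2 := sum_pow_mul_norm_framePoly_sq_le hlam hr hw s
  have h3 : ∑ σ ∈ s, ‖((r ^ σ.1 : ℝ) : ℂ) * (conj (framePoly lam σ z) * framePoly lam σ w)‖ ≤
      ∑ σ ∈ s, (r ^ σ.1 * ‖framePoly lam σ z‖ ^ 2 + r ^ σ.1 * ‖framePoly lam σ w‖ ^ 2) / 2 := by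
    refine Finset.sum_le_sum fun σ _ => ?_
    have hr0 : 0 ≤ r ^ σ.1 := pow_nonneg hr.1.le _
    rw [norm_mul, norm_mul, Complex.norm_real, Real.norm_of_nonneg hr0, RCLike.norm_conj]
    nlinarith [mul_nonneg hr0 (sq_nonneg (‖framePoly lam σ z‖ - ‖framePoly lam σ w‖))]
  refine h3.trans ?_
  rw [← Finset.sum_div, Finset.sum_add_distrib]
  linarith

theorem hasSum_pow_mul_framePoly_mul (hlam : 0 < lam) {r : ℝ} (hr : r ∈ Ioo (0 : ℝ) 1)
    {z w : Cd d} (hz : z ∈ unitBall d) (hw : w ∈ unitBall d) :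
    HasSum (fun σ : Word d => ((r ^ σ.1 : ℝ) : ℂ) *
      (conj (framePoly lam σ z) * framePoly lam σ w))
      ((1 - (r : ℂ) * inner ℂ z w) ^ (-lam : ℂ)) := by
  have hs : Summable fun σ : Word d => ((r ^ σ.1 : ℝ) : ℂ) *
      (conj (framePoly lam σ z) * framePoly lam σ w) :=
    Summable.of_norm (summable_norm_of_sum_le (sum_norm_pow_mul_framePoly_mul_le hlam hr hz hw))
  have h1 := hs.hasSum.sigma fun m => hasSum_fintype fun σ : Fin m → Fin d =>
    (((r ^ m : ℝ) : ℂ) * (conj (framePoly lam ⟨m, σ⟩ z) * framePoly lam ⟨m, σ⟩ w))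
  have hx : ‖(r : ℂ) * inner ℂ z w‖ < 1 := by
    rw [norm_mul, Complex.norm_real, Real.norm_of_nonneg hr.1.le]
    nlinarith [norm_inner_lt_one hz hw, norm_nonneg (inner ℂ z w), hr.1, hr.2]
  have h2 := hasSum_binomCoeff_complex hlam hx
  have e (m : ℕ) : ∑ σ : Fin m → Fin d, ((r ^ m : ℝ) : ℂ) *
      (conj (framePoly lam ⟨m, σ⟩ z) * framePoly lam ⟨m, σ⟩ w) =
      binomCoeff lam m * ((r : ℂ) * inner ℂ z w) ^ m := by
    rw [← Finset.mul_sum, sum_conj_framePoly_mul hlam, mul_pow]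
    push_cast
    ring
  simp only [e] at h1
  rw [← h1.unique h2]
  exact hs.hasSum

/-- The matrix entries of a Toeplitz operator with density `ψ`. -/
def entry (lam : ℝ) (ψ : Cd d → ℂ) (p : Word d × Word d) : ℂ :=
  ∫ z, conj (framePoly lam p.1 z) * framePoly lam p.2 z * ψ z ∂tau d

theorem ae_prod_mem_unitBall (d : ℕ) :
    ∀ᵐ p ∂(tau d).prod (tau d), p.1 ∈ unitBall d ∧ p.2 ∈ unitBall d :=
  (Measure.quasiMeasurePreserving_fst.ae (ae_tau_mem_unitBall d)).and
    (Measure.quasiMeasurePreserving_snd.ae (ae_tau_mem_unitBall d))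

theorem hasSum_pow_mul_norm_entry_sq (hlam : 0 < lam) {r : ℝ} (hr : r ∈ Ioo (0 : ℝ) 1)
    {ψ : Cd d → ℂ} (hψ : Integrable ψ (tau d)) :
    HasSum (fun p : Word d × Word d => ((r ^ (p.1.1 + p.2.1) : ℝ) : ℂ) *
      ((‖entry lam ψ p‖ ^ 2 : ℝ) : ℂ))
      (∫ q : Cd d × Cd d, ((‖(1 - (r : ℂ) * inner ℂ q.1 q.2) ^ (-lam : ℂ)‖ ^ 2 : ℝ) : ℂ) *
        (conj (ψ q.1) * ψ q.2) ∂(tau d).prod (tau d)) := by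
  have hψ' : Integrable (fun z => conj (ψ z)) (tau d) :=
    memLp_one_iff_integrable.1 (memLp_one_iff_integrable.2 hψ).star
  let u : Word d → Cd d × Cd d → ℂ := fun σ q =>
    ((r ^ σ.1 : ℝ) : ℂ) * (conj (framePoly lam σ q.1) * framePoly lam σ q.2)
  have huc (σ : Word d) : Continuous (u σ) := by
    have := continuous_framePoly lam σ
    simp only [u]
    fun_prop
  have huC : ∀ q : Cd d × Cd d, q.1 ∈ unitBall d ∧ q.2 ∈ unitBall d → ∀ s : Finset (Word d),
      ∑ σ ∈ s, ‖u σ q‖ ≤ (1 - r) ^ (-lam) := fun q hq s =>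
    sum_norm_pow_mul_framePoly_mul_le hlam hr hq.1 hq.2 s
  have huC' : ∀ q : Cd d × Cd d, q.1 ∈ unitBall d ∧ q.2 ∈ unitBall d → ∀ s : Finset (Word d),
      ∑ σ ∈ s, ‖conj (u σ q)‖ ≤ (1 - r) ^ (-lam) := fun q hq s => by
    simpa only [RCLike.norm_conj] using huC q hq s
  have hmeas (p : Word d × Word d) : AEStronglyMeasurable (fun q => conj (u p.1 q) * u p.2 q)
      ((tau d).prod (tau d)) :=
    ((Complex.continuous_conj.comp (huc p.1)).mul (huc p.2)).aestronglyMeasurable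
  have hint : Integrable (fun q : Cd d × Cd d => conj (ψ q.1) * ψ q.2) ((tau d).prod (tau d)) :=
    hψ'.mul_prod hψ
  have hbd : ∀ᵐ q ∂(tau d).prod (tau d), ∀ s : Finset (Word d × Word d),
      ∑ p ∈ s, ‖conj (u p.1 q) * u p.2 q‖ ≤ (1 - r) ^ (-lam) * (1 - r) ^ (-lam) := by
    filter_upwards [ae_prod_mem_unitBall d] with q hq s
    simp only [norm_mul (conj _)]
    exact sum_mul_le_of_sum_le (u := fun σ => ‖conj (u σ q)‖) (v := fun σ => ‖u σ q‖)
      (fun _ => norm_nonneg _) (fun _ => norm_nonneg _) (huC' q hq) (huC q hq) s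
  have hsum : ∀ᵐ q ∂(tau d).prod (tau d), HasSum
      (fun p : Word d × Word d => conj (u p.1 q) * u p.2 q)
      ((‖(1 - (r : ℂ) * inner ℂ q.1 q.2) ^ (-lam : ℂ)‖ ^ 2 : ℝ) : ℂ) := by
    filter_upwards [ae_prod_mem_unitBall d] with q hq
    have h1 := hasSum_pow_mul_framePoly_mul hlam hr hq.1 hq.2
    have h2 : HasSum (fun σ => conj (u σ q))
        (conj ((1 - (r : ℂ) * inner ℂ q.1 q.2) ^ (-lam : ℂ))) :=
      h1.map (starRingEnd ℂ) Complex.continuous_conj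
    rw [← conj_mul_self_eq_ofReal]
    exact hasSum_mul_of_sum_le (u := fun σ => conj (u σ q)) (v := fun σ => u σ q)
      (huC' q hq) (huC q hq) h2 h1
  have key := hasSum_integral_mul_of_sum_norm_le hmeas hint hbd hsum
  have e (p : Word d × Word d) : ∫ q, conj (u p.1 q) * u p.2 q * (conj (ψ q.1) * ψ q.2)
      ∂(tau d).prod (tau d) =
      ((r ^ (p.1.1 + p.2.1) : ℝ) : ℂ) * ((‖entry lam ψ p‖ ^ 2 : ℝ) : ℂ) := by
    have h1 := integral_prod_mul (μ := tau d) (ν := tau d)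
      (fun z => conj (conj (framePoly lam p.1 z) * framePoly lam p.2 z * ψ z))
      (fun z => conj (framePoly lam p.1 z) * framePoly lam p.2 z * ψ z)
    rw [integral_conj] at h1
    rw [← conj_mul_self_eq_ofReal, entry, ← h1, ← integral_const_mul]
    congr 1
    funext q
    simp only [u, map_mul, Complex.conj_conj, Complex.conj_ofReal]
    push_cast
    ring
  simpa only [e] using key

end Abel


section Limit

open Filter Topology

variable {d : ℕ} {lam : ℝ}

theorem norm_one_sub_le_two_mul {r : ℝ} (hr : r ∈ Ioo (0 : ℝ) 1) {x : ℂ} (hx : ‖x‖ < 1) :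
    ‖1 - x‖ ≤ 2 * ‖1 - (r : ℂ) * x‖ := by
  have hrx : ‖(r : ℂ) * x‖ = r * ‖x‖ := by
    rw [norm_mul, Complex.norm_real, Real.norm_of_nonneg hr.1.le]
  have h1 : ‖1 - x‖ ≤ ‖1 - (r : ℂ) * x‖ + (1 - r) * ‖x‖ := by
    have e : 1 - x = (1 - (r : ℂ) * x) - ((1 - r : ℝ) : ℂ) * x := by
      push_cast
      ring
    rw [e]
    refine (norm_sub_le _ _).trans (le_of_eq ?_)
    rw [norm_mul, Complex.norm_real, Real.norm_of_nonneg (by linarith [hr.2])]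
  have h2 : 1 - r * ‖x‖ ≤ ‖1 - (r : ℂ) * x‖ := by
    have := norm_sub_norm_le (1 : ℂ) ((r : ℂ) * x)
    rwa [norm_one, hrx] at this
  nlinarith [norm_nonneg x, hr.1, hr.2]

theorem norm_cpow_neg_mul_le (hlam : 0 < lam) {r : ℝ} (hr : r ∈ Ioo (0 : ℝ) 1) {x : ℂ}
    (hx : ‖x‖ < 1) : ‖(1 - (r : ℂ) * x) ^ (-lam : ℂ)‖ ≤
      2 ^ lam * ‖(1 - x) ^ (-lam : ℂ)‖ := by
  have h := norm_one_sub_le_two_mul hr hx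
  have h1 := norm_pos_iff.2 (one_sub_ne_zero_of_norm_lt_one hx)
  rw [norm_cpow_neg, norm_cpow_neg]
  calc ‖1 - (r : ℂ) * x‖ ^ (-lam)
      ≤ (2⁻¹ * ‖1 - x‖) ^ (-lam) :=
        Real.rpow_le_rpow_of_nonpos (by positivity) (by linarith) (by linarith)
    _ = 2 ^ lam * ‖1 - x‖ ^ (-lam) := by
        rw [Real.mul_rpow (by norm_num) h1.le, Real.inv_rpow (by norm_num), Real.rpow_neg
          (by norm_num), inv_inv]

theorem conj_mul_weight_mul_eq {φ : Cd d → ℂ} {z w : Cd d} (hz : z ∈ unitBall d)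
    (hw : w ∈ unitBall d) : ((‖(1 - inner ℂ z w) ^ (-lam : ℂ)‖ ^ 2 : ℝ) : ℂ) *
      (conj (φ z * weight d lam z) * (φ w * weight d lam w)) =
      conj (φ z) * ((aKernel d lam z w : ℂ) * φ w) := by
  rw [aKernel_eq lam hz hw]
  simp only [weight, map_mul, Complex.conj_ofReal]
  push_cast
  ring

theorem tendsto_integral_abel (hlam : (d : ℝ) / 2 < lam) {φ : Cd d → ℂ}
    (hφ : MemLp φ 2 (tau d)) :
    Tendsto (fun r : ℝ => ∫ q : Cd d × Cd d,
      ((‖(1 - (r : ℂ) * inner ℂ q.1 q.2) ^ (-lam : ℂ)‖ ^ 2 : ℝ) : ℂ) *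
        (conj (φ q.1 * weight d lam q.1) * (φ q.2 * weight d lam q.2)) ∂(tau d).prod (tau d))
      (𝓝[<] 1) (𝓝 (∫ q : Cd d × Cd d, conj (φ q.1) * ((aKernel d lam q.1 q.2 : ℂ) * φ q.2)
        ∂(tau d).prod (tau d))) := by
  have hlam0 := pos_of_half_lt hlam
  have hψ := integrable_mul_weight hlam hφ
  have hψ' : Integrable (fun z => conj (φ z * weight d lam z)) (tau d) :=
    memLp_one_iff_integrable.1 (memLp_one_iff_integrable.2 hψ).star
  have hψ2 : Integrable (fun q : Cd d × Cd d => conj (φ q.1 * weight d lam q.1) *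
      (φ q.2 * weight d lam q.2)) ((tau d).prod (tau d)) := hψ'.mul_prod hψ
  have hI := integrable_conj_mul_aKernel_mul hlam hφ
  refine tendsto_integral_filter_of_dominated_convergence
    (fun q => (2 ^ lam) ^ 2 * ‖conj (φ q.1) * ((aKernel d lam q.1 q.2 : ℂ) * φ q.2)‖)
    (Eventually.of_forall fun r => ?_) ?_ (hI.norm.const_mul _) ?_
  · refine AEStronglyMeasurable.mul (Measurable.aestronglyMeasurable ?_) hψ2.1
    have h1 : Continuous fun p : Cd d × Cd d => inner ℂ p.1 p.2 := by fun_prop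
    have h2 := h1.measurable
    fun_prop
  · filter_upwards [Ioo_mem_nhdsLT (zero_lt_one' ℝ)] with r hr
    filter_upwards [ae_prod_mem_unitBall d] with q hq
    have h1 := norm_cpow_neg_mul_le hlam0 hr (norm_inner_lt_one hq.1 hq.2)
    have e (x : ℝ) (y : ℂ) : ‖((x ^ 2 : ℝ) : ℂ) * y‖ = x ^ 2 * ‖y‖ := by
      rw [norm_mul, Complex.norm_real, Real.norm_of_nonneg (by positivity)]
    rw [← conj_mul_weight_mul_eq hq.1 hq.2, e, e, ← mul_assoc (((2 : ℝ) ^ lam) ^ 2), ← mul_pow]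
    gcongr
  · filter_upwards [ae_prod_mem_unitBall d] with q hq
    rw [← conj_mul_weight_mul_eq hq.1 hq.2]
    refine Tendsto.mul_const _ ?_
    have hne := norm_pos_iff.2 (one_sub_ne_zero_of_norm_lt_one (norm_inner_lt_one hq.1 hq.2))
    simp only [norm_cpow_neg]
    have h1 : Tendsto (fun r : ℝ => ‖1 - (r : ℂ) * inner ℂ q.1 q.2‖) (𝓝 1)
        (𝓝 ‖1 - inner ℂ q.1 q.2‖) := by
      have h : Continuous fun r : ℝ => ‖1 - (r : ℂ) * inner ℂ q.1 q.2‖ := by fun_prop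
      simpa using h.tendsto 1
    have h2 := (h1.rpow_const (p := -lam) (Or.inl hne.ne')).pow 2
    exact (Complex.continuous_ofReal.tendsto _).comp (h2.mono_left nhdsWithin_le_nhds)

/-- The Hilbert-Schmidt norm of the matrix of Toeplitz entries. -/
theorem hasSum_norm_entry_sq (hlam : (d : ℝ) / 2 < lam) {φ : Cd d → ℂ}
    (hφ : MemLp φ 2 (tau d)) :
    HasSum (fun p : Word d × Word d =>
      ((‖(cConst d lam : ℂ) * entry lam (fun z => φ z * weight d lam z) p‖ ^ 2 : ℝ) : ℂ))
      (∫ z, conj (φ z) * aOp d lam φ z ∂tau d) := by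
  have h := hasSum_of_tendsto_abel (g := fun p : Word d × Word d =>
      ‖entry lam (fun z => φ z * weight d lam z) p‖ ^ 2) (fun _ => by positivity)
    (fun p => p.1.1 + p.2.1)
    (fun r hr => hasSum_pow_mul_norm_entry_sq (pos_of_half_lt hlam) hr
      (integrable_mul_weight hlam hφ))
    (tendsto_integral_abel hlam hφ)
  rw [integral_conj_mul_aOp hlam hφ]
  refine (h.mul_left ((cConst d lam : ℂ) ^ 2)).congr_fun fun p => ?_
  rw [norm_mul, mul_pow, Complex.norm_real, Real.norm_eq_abs, sq_abs]
  push_cast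
  ring

end Limit

section Operator

variable {E : Type*} [NormedAddCommGroup E] [InnerProductSpace ℂ E]

theorem norm_tsum_mul_le {ι : Type*} {t c : ι → ℂ} {S C : ℝ} (ht : HasSum (fun i => ‖t i‖ ^ 2) S)
    (hc : HasSum (fun i => ‖c i‖ ^ 2) C) :
    Summable (fun i => ‖t i * c i‖) ∧ ‖∑' i, t i * c i‖ ≤ √S * √C := by
  have hs : Summable fun i => ‖t i * c i‖ := by
    refine Summable.of_nonneg_of_le (fun _ => norm_nonneg _) (fun i => ?_)
      (ht.summable.add hc.summable)
    rw [norm_mul]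
    nlinarith [sq_nonneg (‖t i‖ - ‖c i‖), sq_nonneg ‖t i‖, sq_nonneg ‖c i‖]
  refine ⟨hs, le_of_tendsto' hs.of_norm.hasSum.norm fun s => ?_⟩
  refine (norm_sum_mul_le_sqrt s t c).trans ?_
  gcongr
  · exact sum_le_hasSum s (fun _ _ => by positivity) ht
  · exact sum_le_hasSum s (fun _ _ => by positivity) hc

/-- A family `v` is a Parseval frame. -/
def IsParsevalFrame {κ : Type*} (v : κ → E) : Prop :=
  ∀ f : E, HasSum (fun k => ‖inner ℂ (v k) f‖ ^ 2) (‖f‖ ^ 2)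

/-- A square summable matrix with respect to a Parseval frame defines a bounded operator. -/
theorem exists_operator_of_matrix [CompleteSpace E] {κ : Type*} {v : κ → E}
    (hv : IsParsevalFrame v) {t : κ × κ → ℂ} {S : ℝ} (ht : HasSum (fun p => ‖t p‖ ^ 2) S) :
    ∃ T : E →L[ℂ] E, ∀ f g : E,
      Summable (fun p => ‖t p * (conj (inner ℂ (v p.1) f) * inner ℂ (v p.2) g)‖) ∧
      inner ℂ f (T g) = ∑' p, t p * (conj (inner ℂ (v p.1) f) * inner ℂ (v p.2) g) := by
  have hc (f g : E) : HasSum (fun p : κ × κ => ‖conj (inner ℂ (v p.1) f) * inner ℂ (v p.2) g‖ ^ 2)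
      (‖f‖ ^ 2 * ‖g‖ ^ 2) := by
    have hf : HasSum (fun k => ‖inner ℂ (v k) f‖ ^ 2) (‖f‖ ^ 2) := hv f
    have hg : HasSum (fun k => ‖inner ℂ (v k) g‖ ^ 2) (‖g‖ ^ 2) := hv g
    have hfg : Summable fun p : κ × κ => ‖inner ℂ (v p.1) f‖ ^ 2 * ‖inner ℂ (v p.2) g‖ ^ 2 :=
      hf.summable.mul_of_nonneg hg.summable (fun _ => by positivity) fun _ => by positivity
    refine (HasSum.mul (f := fun k => ‖inner ℂ (v k) f‖ ^ 2) (g := fun k => ‖inner ℂ (v k) g‖ ^ 2)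
      hf hg hfg).congr_fun fun p => ?_
    rw [norm_mul, mul_pow, RCLike.norm_conj]
  have hs (f g : E) : Summable fun p : κ × κ =>
      ‖t p * (conj (inner ℂ (v p.1) f) * inner ℂ (v p.2) g)‖ :=
    (norm_tsum_mul_le ht (hc f g)).1
  have hb (f g : E) : ‖∑' p : κ × κ, t p * (conj (inner ℂ (v p.1) f) * inner ℂ (v p.2) g)‖ ≤
      √S * √(‖f‖ ^ 2 * ‖g‖ ^ 2) := (norm_tsum_mul_le ht (hc f g)).2
  let B : E →ₗ⋆[ℂ] E →ₗ[ℂ] ℂ := LinearMap.mk₂'ₛₗ (starRingEnd ℂ) (RingHom.id ℂ)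
    (fun f g => ∑' p, t p * (conj (inner ℂ (v p.1) f) * inner ℂ (v p.2) g))
    (fun f f' g => by
      rw [← (hs f g).of_norm.tsum_add (hs f' g).of_norm]
      congr 1
      funext p
      rw [inner_add_right, map_add]
      ring)
    (fun c f g => by
      rw [smul_eq_mul, ← tsum_mul_left]
      congr 1
      funext p
      rw [inner_smul_right, map_mul]
      ring)
    (fun f g g' => by
      rw [← (hs f g).of_norm.tsum_add (hs f g').of_norm]
      congr 1
      funext p
      rw [inner_add_right]
      ring)
    (fun c f g => by
      rw [RingHom.id_apply, smul_eq_mul, ← tsum_mul_left]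
      congr 1
      funext p
      rw [inner_smul_right]
      ring)
  let B' : E →L⋆[ℂ] E →L[ℂ] ℂ := B.mkContinuous₂ (√S) fun f g => by
    refine (hb f g).trans (le_of_eq ?_)
    rw [← mul_pow, Real.sqrt_sq (by positivity), mul_assoc]
  refine ⟨ContinuousLinearMap.adjoint (InnerProductSpace.continuousLinearMapOfBilin B'),
    fun f g => ⟨hs f g, ?_⟩⟩
  rw [ContinuousLinearMap.adjoint_inner_right,
    InnerProductSpace.continuousLinearMapOfBilin_apply]
  rfl

theorem tsum_enorm_sq_of_hasSum {ι : Type*} {x : ι → ℂ} {a : ℝ}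
    (h : HasSum (fun i => ‖x i‖ ^ 2) a) : ∑' i, ‖x i‖ₑ ^ 2 = ENNReal.ofReal a := by
  rw [← h.tsum_eq, ENNReal.ofReal_tsum_of_nonneg (fun _ => by positivity) h.summable]
  congr 1
  funext i
  rw [ENNReal.ofReal_pow (norm_nonneg _), ofReal_norm]

theorem IsParsevalFrame.tsum_enorm_sq {κ : Type*} {v : κ → E} (hv : IsParsevalFrame v) (f : E) :
    ∑' k, ‖inner ℂ (v k) f‖ₑ ^ 2 = ‖f‖ₑ ^ 2 := by
  rw [tsum_enorm_sq_of_hasSum (hv f), ENNReal.ofReal_pow (norm_nonneg _), ofReal_norm]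

theorem isParsevalFrame_hilbertBasis {ι : Type*} (e : HilbertBasis ι ℂ E) :
    IsParsevalFrame e := fun f => by
  have h := lp.hasSum_norm (p := 2) (by simp) (e.repr f)
  simpa only [ENNReal.toReal_ofNat, Real.rpow_two, e.repr_apply_apply, e.repr.norm_map] using h

/-- The Hilbert-Schmidt norm can be computed in any Parseval frame. -/
theorem hasSum_norm_sq_of_isParsevalFrame [CompleteSpace E] {κ ι : Type*} {v : κ → E}
    (hv : IsParsevalFrame v) {e : ι → E} (he : IsParsevalFrame e) (T : E →L[ℂ] E) {S : ℝ}
    (h : HasSum (fun p : κ × κ => ‖inner ℂ (v p.1) (T (v p.2))‖ ^ 2) S) :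
    HasSum (fun i => ‖T (e i)‖ ^ 2) S := by
  have key : ∑' i, ‖T (e i)‖ₑ ^ 2 = ENNReal.ofReal S := by
    calc ∑' i, ‖T (e i)‖ₑ ^ 2
        = ∑' i, ∑' k, ‖inner ℂ (v k) (T (e i))‖ₑ ^ 2 := by simp only [hv.tsum_enorm_sq]
      _ = ∑' k, ∑' i, ‖inner ℂ (e i) (ContinuousLinearMap.adjoint T (v k))‖ₑ ^ 2 := by
        rw [ENNReal.tsum_comm]
        congr! 5 with k i
        rw [ContinuousLinearMap.adjoint_inner_right, ← inner_conj_symm, RCLike.enorm_conj]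
      _ = ∑' k, ∑' l, ‖inner ℂ (v l) (ContinuousLinearMap.adjoint T (v k))‖ₑ ^ 2 := by
        simp only [hv.tsum_enorm_sq, he.tsum_enorm_sq]
      _ = ∑' k, ∑' l, ‖inner ℂ (v k) (T (v l))‖ₑ ^ 2 := by
        congr! 5 with k l
        rw [ContinuousLinearMap.adjoint_inner_right, ← inner_conj_symm, RCLike.enorm_conj]
      _ = ENNReal.ofReal S := by
        rw [← ENNReal.tsum_prod, tsum_enorm_sq_of_hasSum h]
  have hS : 0 ≤ S := h.nonneg fun _ => by positivity
  have e1 (i : ι) : (‖T (e i)‖ₑ ^ 2).toReal = ‖T (e i)‖ ^ 2 := by simp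
  have hne : ∑' i, ‖T (e i)‖ₑ ^ 2 ≠ ⊤ := key ▸ ENNReal.ofReal_ne_top
  have hs := ENNReal.summable_toReal hne
  have ht := ENNReal.tsum_toReal_eq (f := fun i => ‖T (e i)‖ₑ ^ 2) fun i => by simp
  rw [key, ENNReal.toReal_ofReal hS] at ht
  simp only [e1] at hs ht
  rw [ht]
  exact hs.hasSum

end Operator


section Toeplitz

open Filter Topology

variable {d : ℕ} {lam : ℝ} {n : ℕ} {hlam : 0 < lam} {hn : (d : ℝ) < lam + 2 * n}

theorem isParsevalFrame_frame : IsParsevalFrame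
    (frame : Word d → GenBergman d lam n hlam hn) := hasSum_norm_inner_frame_sq

theorem smul_mem_unitBall {r : ℝ} (hr : r ∈ Ioo (0 : ℝ) 1) {z : Cd d} (hz : z ∈ unitBall d) :
    (r : ℂ) • z ∈ unitBall d := by
  have hz1 : ‖z‖ < 1 := by simpa [unitBall] using hz
  have h : ‖(r : ℂ) • z‖ < 1 := by
    rw [norm_smul, Complex.norm_real, Real.norm_of_nonneg hr.1.le]
    nlinarith [hr.1, hr.2, norm_nonneg z]
  simpa [unitBall] using h

theorem sum_norm_frame_expansion_le (f : GenBergman d lam n hlam hn) {r : ℝ}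
    (hr : r ∈ Ioo (0 : ℝ) 1) {z : Cd d} (hz : z ∈ unitBall d) (s : Finset (Word d)) :
    ∑ σ ∈ s, ‖((r ^ σ.1 : ℝ) : ℂ) * (inner ℂ (frame σ) f * framePoly lam σ z)‖ ≤
      ‖f‖ ^ 2 + (1 - r ^ 2) ^ (-lam) := by
  have hr2 : r ^ 2 ∈ Ioo (0 : ℝ) 1 := ⟨pow_pos hr.1 2, pow_lt_one₀ hr.1.le hr.2 two_ne_zero⟩
  have h1 := sum_le_hasSum s (fun _ _ => by positivity) (hasSum_norm_inner_frame_sq f)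
  have h2 := sum_pow_mul_norm_framePoly_sq_le hlam hr2 hz s
  refine le_trans ?_ (add_le_add h1 h2)
  rw [← Finset.sum_add_distrib]
  refine Finset.sum_le_sum fun σ _ => ?_
  have hp : 0 ≤ r ^ σ.1 := pow_nonneg hr.1.le _
  rw [norm_mul, norm_mul, Complex.norm_real, Real.norm_of_nonneg hp, ← pow_mul, mul_comm 2,
    pow_mul]
  nlinarith [sq_nonneg (‖inner ℂ (frame σ) f‖ - r ^ σ.1 * ‖framePoly lam σ z‖),
    sq_nonneg ‖inner ℂ (frame σ) f‖, sq_nonneg (r ^ σ.1 * ‖framePoly lam σ z‖)]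

theorem hasSum_frame_expansion (f : GenBergman d lam n hlam hn) {r : ℝ}
    (hr : r ∈ Ioo (0 : ℝ) 1) {z : Cd d} (hz : z ∈ unitBall d) :
    HasSum (fun σ : Word d => ((r ^ σ.1 : ℝ) : ℂ) * (inner ℂ (frame σ) f * framePoly lam σ z))
      ((f : Cd d → ℂ) ((r : ℂ) • z)) := by
  have hs := (summable_norm_of_sum_le (sum_norm_frame_expansion_le f hr hz)).of_norm
  have h1 := hs.hasSum.sigma fun m => hasSum_fintype fun σ : Fin m → Fin d =>
    (((r ^ m : ℝ) : ℂ) * (inner ℂ (frame ⟨m, σ⟩) f * framePoly lam ⟨m, σ⟩ z))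
  have h2 := hasSum_slice f.toHol (smul_mem_unitBall hr hz) 0
  have e (m : ℕ) : ∑ σ : Fin m → Fin d,
      (((r ^ m : ℝ) : ℂ) * (inner ℂ (frame ⟨m, σ⟩) f * framePoly lam ⟨m, σ⟩ z)) =
      sliceCoeff f.toHol ((r : ℂ) • z) m := by
    rw [← sum_inner_frame_mul]
    refine Finset.sum_congr rfl fun σ _ => ?_
    rw [framePoly_smul]
    push_cast
    ring
  have hc : cis 0 = 1 := by simp [cis]
  simp only [hc, one_pow, mul_one, one_smul] at h2
  simp only [e] at h1
  rw [← h1.unique h2]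
  exact hs.hasSum

theorem hasSum_entry_mul (f g : GenBergman d lam n hlam hn) {r : ℝ} (hr : r ∈ Ioo (0 : ℝ) 1)
    {ψ : Cd d → ℂ} (hψ : Integrable ψ (tau d)) :
    HasSum (fun p : Word d × Word d => ((r ^ (p.1.1 + p.2.1) : ℝ) : ℂ) *
      (entry lam ψ p * (conj (inner ℂ (frame p.1) f) * inner ℂ (frame p.2) g)))
      (∫ z, conj ((f : Cd d → ℂ) ((r : ℂ) • z)) * (g : Cd d → ℂ) ((r : ℂ) • z) * ψ z ∂tau d) := by
  let u (f : GenBergman d lam n hlam hn) (z : Cd d) (σ : Word d) : ℂ :=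
    ((r ^ σ.1 : ℝ) : ℂ) * (inner ℂ (frame σ) f * framePoly lam σ z)
  have hu (f : GenBergman d lam n hlam hn) (σ : Word d) : Continuous fun z => u f z σ := by
    have := continuous_framePoly lam σ
    fun_prop
  have hcu {z : Cd d} (hz : z ∈ unitBall d) (s : Finset (Word d)) :
      ∑ σ ∈ s, ‖conj (u f z σ)‖ ≤ ‖f‖ ^ 2 + (1 - r ^ 2) ^ (-lam) := by
    simp only [RCLike.norm_conj]
    exact sum_norm_frame_expansion_le f hr hz s
  have key := hasSum_integral_mul_of_sum_norm_le (μ := tau d)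
    (a := fun (p : Word d × Word d) z => conj (u f z p.1) * u g z p.2)
    (A := fun z => conj ((f : Cd d → ℂ) ((r : ℂ) • z)) * (g : Cd d → ℂ) ((r : ℂ) • z))
    (C := (‖f‖ ^ 2 + (1 - r ^ 2) ^ (-lam)) * (‖g‖ ^ 2 + (1 - r ^ 2) ^ (-lam)))
    (fun p => ((Complex.continuous_conj.comp (hu f p.1)).mul (hu g p.2)).aestronglyMeasurable) hψ
    (by
      filter_upwards [ae_tau_mem_unitBall d] with z hz s
      simp only [norm_mul]
      exact sum_mul_le_of_sum_le (u := fun σ => ‖conj (u f z σ)‖) (v := fun σ => ‖u g z σ‖)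
        (fun _ => norm_nonneg _) (fun _ => norm_nonneg _) (hcu hz)
        (sum_norm_frame_expansion_le g hr hz) s)
    (by
      filter_upwards [ae_tau_mem_unitBall d] with z hz
      exact hasSum_mul_of_sum_le (u := fun σ => conj (u f z σ)) (v := fun σ => u g z σ) (hcu hz)
        (sum_norm_frame_expansion_le g hr hz)
        ((hasSum_frame_expansion f hr hz).map (starRingEnd ℂ) Complex.continuous_conj)
        (hasSum_frame_expansion g hr hz))
  refine key.congr_fun fun p => ?_
  rw [entry, mul_comm (∫ z, _ ∂tau d), ← mul_assoc, ← integral_const_mul]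
  congr 1
  funext z
  simp only [u, map_mul, Complex.conj_ofReal, pow_add]
  push_cast
  ring

theorem GenBergman.continuousOn (f : GenBergman d lam n hlam hn) :
    ContinuousOn (f : Cd d → ℂ) (unitBall d) := f.toHol.2.1.continuousOn

theorem GenBergman.measurable (f : GenBergman d lam n hlam hn) :
    Measurable (f : Cd d → ℂ) := Hol.measurable f.toHol

theorem tendsto_integral_dilation {f g : GenBergman d lam n hlam hn} (hf : IsBoundedOnBall f)
    (hg : IsBoundedOnBall g) {ψ : Cd d → ℂ} (hψ : Integrable ψ (tau d)) :
    Tendsto (fun r : ℝ => ∫ z, conj ((f : Cd d → ℂ) ((r : ℂ) • z)) *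
      (g : Cd d → ℂ) ((r : ℂ) • z) * ψ z ∂tau d) (𝓝[<] 1)
      (𝓝 (∫ z, conj ((f : Cd d → ℂ) z) * (g : Cd d → ℂ) z * ψ z ∂tau d)) := by
  obtain ⟨C, hC⟩ := hf
  obtain ⟨D, hD⟩ := hg
  have hm (f : GenBergman d lam n hlam hn) (r : ℝ) :
      Measurable fun z => (f : Cd d → ℂ) ((r : ℂ) • z) :=
    f.measurable.comp (measurable_const_smul _)
  refine tendsto_integral_filter_of_dominated_convergence (fun z => C * D * ‖ψ z‖)
    (Eventually.of_forall fun r => ?_) ?_ (hψ.norm.const_mul _) ?_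
  · exact ((Complex.continuous_conj.measurable.comp (hm f r)).mul
      (hm g r)).aestronglyMeasurable.mul hψ.1
  · filter_upwards [Ioo_mem_nhdsLT (zero_lt_one' ℝ)] with r hr
    filter_upwards [ae_tau_mem_unitBall d] with z hz
    have h1 := hC _ (smul_mem_unitBall hr hz)
    have h2 := hD _ (smul_mem_unitBall hr hz)
    have h3 := (norm_nonneg _).trans h1
    rw [norm_mul, norm_mul, RCLike.norm_conj]
    gcongr
  · filter_upwards [ae_tau_mem_unitBall d] with z hz
    have hr : Tendsto (fun r : ℝ => (r : ℂ) • z) (𝓝[<] 1) (𝓝 z) := by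
      have h : Continuous fun r : ℝ => (r : ℂ) • z := by fun_prop
      have := (h.tendsto 1).mono_left (nhdsWithin_le_nhds (s := Iio 1))
      simpa using this
    have h (f : GenBergman d lam n hlam hn) :
        Tendsto (fun r : ℝ => (f : Cd d → ℂ) ((r : ℂ) • z)) (𝓝[<] 1)
          (𝓝 ((f : Cd d → ℂ) z)) :=
      (f.continuousOn.continuousAt ((isOpen_unitBall d).mem_nhds hz)).tendsto.comp hr
    exact (((Complex.continuous_conj.tendsto _).comp (h f)).mul (h g)).mul_const _

theorem tsum_entry_mul {f g : GenBergman d lam n hlam hn} (hf : IsBoundedOnBall f)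
    (hg : IsBoundedOnBall g) {ψ : Cd d → ℂ} (hψ : Integrable ψ (tau d))
    (hs : Summable fun p : Word d × Word d =>
      ‖entry lam ψ p * (conj (inner ℂ (frame p.1) f) * inner ℂ (frame p.2) g)‖) :
    ∑' p : Word d × Word d,
      entry lam ψ p * (conj (inner ℂ (frame p.1) f) * inner ℂ (frame p.2) g) =
      ∫ z, conj ((f : Cd d → ℂ) z) * (g : Cd d → ℂ) z * ψ z ∂tau d := by
  refine tendsto_nhds_unique ((tendsto_tsum_pow_mul hs fun p => p.1.1 + p.2.1).congr' ?_)
    (tendsto_integral_dilation hf hg hψ)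
  filter_upwards [Ioo_mem_nhdsLT (zero_lt_one' ℝ)] with r hr
  exact (hasSum_entry_mul f g hr hψ).tsum_eq

theorem toeplitzIntegrand_eq (φ f g : Cd d → ℂ) (z : Cd d) :
    toeplitzIntegrand d lam φ f g z = conj (f z) * g z * (φ z * weight d lam z) := by
  rw [toeplitzIntegrand, weight]
  ring

theorem integrable_toeplitzIntegrand {φ : Cd d → ℂ}
    (hψ : Integrable (fun z => φ z * weight d lam z) (tau d))
    {f g : GenBergman d lam n hlam hn} (hf : IsBoundedOnBall f) (hg : IsBoundedOnBall g) :
    Integrable (toeplitzIntegrand d lam φ f g) (tau d) := by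
  obtain ⟨C, hC⟩ := hf
  obtain ⟨D, hD⟩ := hg
  simp only [funext (toeplitzIntegrand_eq φ f g)]
  refine hψ.bdd_mul (c := C * D) ((Complex.continuous_conj.measurable.comp f.measurable).mul
    g.measurable).aestronglyMeasurable ?_
  filter_upwards [ae_tau_mem_unitBall d] with z hz
  have h1 := hC z hz
  have h2 := hD z hz
  have h3 := (norm_nonneg _).trans h1
  rw [norm_mul, RCLike.norm_conj]
  gcongr

theorem isBoundedOnBall_frame (σ : Word d) :
    IsBoundedOnBall (frame σ : GenBergman d lam n hlam hn) := by
  obtain ⟨C, hC⟩ := (isCompact_closedBall (0 : Cd d) 1).exists_bound_of_continuousOn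
    (continuous_framePoly lam σ).continuousOn
  refine ⟨C, fun z hz => ?_⟩
  rw [frame_toHol, frameHol_apply lam σ hz]
  exact hC z (Metric.ball_subset_closedBall hz)

theorem HasToeplitzEntries.inner_frame {φ : Cd d → ℂ}
    {T : GenBergman d lam n hlam hn →L[ℂ] GenBergman d lam n hlam hn}
    (hT : HasToeplitzEntries φ T) (σ τ : Word d) :
    inner ℂ (frame σ) (T (frame τ)) =
      (cConst d lam : ℂ) * entry lam (fun z => φ z * weight d lam z) (σ, τ) := by
  rw [hT _ _ (isBoundedOnBall_frame σ) (isBoundedOnBall_frame τ), entry]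
  congr 1
  refine integral_congr_ae ?_
  filter_upwards [ae_tau_mem_unitBall d] with z hz
  rw [toeplitzIntegrand_eq, frame_toHol, frame_toHol, frameHol_apply lam _ hz,
    frameHol_apply lam _ hz]

theorem IsParsevalFrame.ext {E κ : Type*} [NormedAddCommGroup E] [InnerProductSpace ℂ E]
    {v : κ → E} (hv : IsParsevalFrame v) {x y : E} (h : ∀ k, inner ℂ (v k) x = inner ℂ (v k) y) :
    x = y := by
  have h1 : HasSum (fun k => ‖inner ℂ (v k) (x - y)‖ ^ 2) (‖x - y‖ ^ 2) := hv (x - y)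
  simp only [inner_sub_right, h, sub_self, norm_zero, ne_eq, OfNat.ofNat_ne_zero,
    not_false_eq_true, zero_pow] at h1
  have h2 := h1.unique hasSum_zero
  rwa [sq_eq_zero_iff, norm_eq_zero, sub_eq_zero] at h2

theorem HasToeplitzEntries.unique {φ : Cd d → ℂ}
    {S T : GenBergman d lam n hlam hn →L[ℂ] GenBergman d lam n hlam hn}
    (hS : HasToeplitzEntries φ S) (hT : HasToeplitzEntries φ T) : S = T := by
  have h (σ : Word d) : ContinuousLinearMap.adjoint S (frame σ) =
      ContinuousLinearMap.adjoint T (frame σ) := by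
    refine isParsevalFrame_frame.ext fun τ => ?_
    rw [ContinuousLinearMap.adjoint_inner_right, ContinuousLinearMap.adjoint_inner_right,
      ← inner_conj_symm, hS.inner_frame, ← hT.inner_frame, inner_conj_symm]
  ext1 f
  refine isParsevalFrame_frame.ext fun σ => ?_
  rw [← ContinuousLinearMap.adjoint_inner_left, h, ContinuousLinearMap.adjoint_inner_left]

theorem exists_hasToeplitzEntries (hlam2 : (d : ℝ) / 2 < lam) {φ : Cd d → ℂ}
    (hφ : MemLp φ 2 (tau d)) :
    ∃ T : GenBergman d lam n hlam hn →L[ℂ] GenBergman d lam n hlam hn, HasToeplitzEntries φ T := by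
  have hψ := integrable_mul_weight hlam2 hφ
  set ψ : Cd d → ℂ := fun z => φ z * weight d lam z with hψd
  have hsum := Complex.hasSum_re (hasSum_norm_entry_sq hlam2 hφ)
  simp only [Complex.ofReal_re] at hsum
  obtain ⟨T, hT⟩ := exists_operator_of_matrix
    (isParsevalFrame_frame (d := d) (lam := lam) (n := n) (hlam := hlam) (hn := hn))
    (t := fun p => (cConst d lam : ℂ) * entry lam ψ p) hsum
  refine ⟨T, fun f g hf hg => ?_⟩
  obtain ⟨h1, h2⟩ := hT f g
  rw [h2]
  simp only [funext (toeplitzIntegrand_eq φ f g)]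
  simp only [mul_assoc (cConst d lam : ℂ)] at h1 ⊢
  rw [tsum_mul_left]
  rcases eq_or_ne (cConst d lam : ℂ) 0 with hc | hc
  · rw [hc, zero_mul, zero_mul]
  · simp only [norm_mul (cConst d lam : ℂ)] at h1
    rw [tsum_entry_mul hf hg hψ ((summable_mul_left_iff (norm_ne_zero_iff.2 hc)).1 h1)]

theorem HasToeplitzEntries.hasSum_norm_sq (hlam2 : (d : ℝ) / 2 < lam) {φ : Cd d → ℂ}
    (hφ : MemLp φ 2 (tau d))
    {T : GenBergman d lam n hlam hn →L[ℂ] GenBergman d lam n hlam hn}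
    (hT : HasToeplitzEntries φ T) {ι : Type*} (e : HilbertBasis ι ℂ (GenBergman d lam n hlam hn)) :
    HasSum (fun i => ((‖T (e i)‖ ^ 2 : ℝ) : ℂ)) (∫ z, conj (φ z) * aOp d lam φ z ∂tau d) := by
  have h := hasSum_norm_entry_sq hlam2 hφ
  have h1 := Complex.hasSum_re h
  simp only [Complex.ofReal_re] at h1
  have h2 : ((∫ z, conj (φ z) * aOp d lam φ z ∂tau d).re : ℂ) =
      ∫ z, conj (φ z) * aOp d lam φ z ∂tau d := (Complex.hasSum_ofReal.2 h1).unique h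
  rw [← h2, Complex.hasSum_ofReal]
  refine hasSum_norm_sq_of_isParsevalFrame isParsevalFrame_frame (isParsevalFrame_hilbertBasis e)
    T ?_
  simpa only [hT.inner_frame] using h1

end Toeplitz

end BergmanBall

end

theorem mainTheorem2 (d n : ℕ) (lam : ℝ) (hlam : (d : ℝ) / 2 < lam)
    (hn : (d : ℝ) < lam + 2 * n) (φ : Lp ℂ 2 (BergmanBall.tau d)) :
    (∀ f g : BergmanBall.GenBergman d lam n (BergmanBall.pos_of_half_lt hlam) hn,
      BergmanBall.IsBoundedOnBall f → BergmanBall.IsBoundedOnBall g →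
        Integrable (BergmanBall.toeplitzIntegrand d lam φ f g) (BergmanBall.tau d)) ∧
    ∃ hA : MemLp (BergmanBall.aOp d lam φ) 2 (BergmanBall.tau d),
    ∃ T : BergmanBall.GenBergman d lam n (BergmanBall.pos_of_half_lt hlam) hn →L[ℂ]
        BergmanBall.GenBergman d lam n (BergmanBall.pos_of_half_lt hlam) hn,
      BergmanBall.IsHilbertSchmidt T ∧
      BergmanBall.HasToeplitzEntries φ T ∧
      (∀ S : BergmanBall.GenBergman d lam n (BergmanBall.pos_of_half_lt hlam) hn →L[ℂ]
          BergmanBall.GenBergman d lam n (BergmanBall.pos_of_half_lt hlam) hn,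
        BergmanBall.IsHilbertSchmidt S → BergmanBall.HasToeplitzEntries φ S → S = T) ∧
      ∀ (ι : Type)
        (e : HilbertBasis ι ℂ
          (BergmanBall.GenBergman d lam n (BergmanBall.pos_of_half_lt hlam) hn)),
        HasSum (fun i => ((‖T (e i)‖ ^ 2 : ℝ) : ℂ)) (inner ℂ φ (hA.toLp _)) := by
  have hφ : MemLp φ 2 (BergmanBall.tau d) := Lp.memLp φ
  have hA := BergmanBall.memLp_aOp hlam hφ
  obtain ⟨T, hT⟩ := BergmanBall.exists_hasToeplitzEntries (n := n) (hlam := BergmanBall.pos_of_half_lt hlam) (hn := hn)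
    hlam hφ
  refine ⟨fun f g hf hg => BergmanBall.integrable_toeplitzIntegrand (BergmanBall.integrable_mul_weight hlam hφ) hf hg, hA,
    T, ?_, hT, fun S _ hS => hS.unique hT, fun ι e => ?_⟩
  · obtain ⟨w, e, -⟩ := exists_hilbertBasis ℂ
      (BergmanBall.GenBergman d lam n (BergmanBall.pos_of_half_lt hlam) hn)
    exact ⟨w, e, Complex.summable_ofReal.1 (hT.hasSum_norm_sq hlam hφ e).summable⟩
  · have h : inner ℂ φ (hA.toLp _) = ∫ z, conj (φ z) * BergmanBall.aOp d lam φ z ∂BergmanBall.tau d := by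
      rw [L2.inner_def]
      refine integral_congr_ae ?_
      filter_upwards [hA.coeFn_toLp] with z hz
      rw [hz, RCLike.inner_apply, mul_comm]
    rw [h]
    exact hT.hasSum_norm_sq hlam hφ e
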